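/- Fix $\lambda\in\mathbb{R}$, $\mu\ge 0$ and a sequence $p=p(n)$ of natural numbers (for instance one with $p/n\to 1/\gamma\in(0,\infty)$). Let $v$ be uniformly distributed on $\{\pm1\}^n$, let $u\sim \mathsf{N}(0,I_p/p)$ be independent of $v$, and define the following observations. Sparse graph: for $d>0$, $A^G$ is the $n\times n$ adjacency matrix (symmetric, zero diagonal) of a random graph on $\{1,\dots,n\}$ in which, conditionally on $v$, the edges $\{i,j\}$, $i\neq j$, are present independently, with probability $(d+\lambda\sqrt d)/n$ if $v_i=v_j$ and $(d-\lambda\sqrt d)/n$ if $v_i\neq v_j$ (these are probabilities once $d\ge\lambda^2$ and $n\ge d+|\lambda|\sqrt d$). Gaussian matrix: $A$ is a symmetric $n\times n$ matrix whose entries $A_{ij}$, $i\le j$, are conditionally independent given $v$, with $A_{ij}\sim\mathsf{N}(\lambda v_iv_j/n,\,1/n)$ for $i<j$ and $A_{ii}\sim\mathsf{N}(\lambda v_i v_i/n,\,2/n)$. Covariates: $B\in\mathbb{R}^{p\times n}$, $B_{ai}=\sqrt{\mu/n}\,v_iu_a+Z_{ai}/\sqrt p$, where the $Z_{ai}$ are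 independent standard normal variables, independent of $(u,v)$; given $v$, $B$ is independent of $A^G$ and of $A$. Let $I(\,\cdot\,;\,\cdot\,)$ denote mutual information in nats, and $$\mathsf{MMSE}(v;A^G,B)=\frac1{n^2}\,\mathbb{E}\Big\{\big\|vv^{\mathsf T}-\mathbb{E}\{vv^{\mathsf T}\mid A^G,B\}\big\|_F^2\Big\}.$$ Then $$\lim_{d\to\infty}\limsup_{n\to\infty}\frac1n\big|I(v;A^G,B)-I(v;A,B)\big|=0 .$$ Moreover, for all sufficiently large $d$ and then all sufficiently large $n$ (depending on $d$), the derivative $\frac{\mathrm{d}I(v;A^G,B)}{\mathrm{d}(\lambda^2)}$ exists (as the limit of $\frac{I_{\theta}-I_{\lambda}}{\theta^2-\lambda^2}$ for $\theta\to\lambda$, $\theta\ne\lambda$, where $I_\theta$ is $I(v;A^G,B)$ at parameter $\theta$ in place of $\lambda$, with $d,n,p,\mu$ fixed), and $$\lim_{d\to\infty}\limsup_{n\to\infty}\Big|\frac1n\frac{\mathrm{d}I(v;A^G,B)}{\mathrm{d}(\lambda^2)}-\frac14\mathsf{MMSE}(v;A^G,B)\Big|=0 .$$ -/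

import Mathlib

open MeasureTheory ProbabilityTheory InformationTheory Filter Topology
open scoped ENNReal NNReal

noncomputable section

namespace CSBM

/-- Cluster labellings `v ∈ {±1}ⁿ`. Below, `lam` is the parameter `λ` and `mu` the parameter `μ`. -/
abbrev Label (n : ℕ) : Type := Fin n → ℤˣ

/-- An entry `±1` of a labelling (or a product of such entries), as a real number. -/
def sgn (ε : ℤˣ) : ℝ := ((ε : ℤ) : ℝ)

/-- What is observed: an `n × n` real matrix (`A^G` or `A`), and the `p × n` covariate matrix `B`. -/
abbrev Obs (n p : ℕ) : Type := (Fin n → Fin n → ℝ) × (Fin p → Fin n → ℝ)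

/-- The symmetric matrix with the given entries on the unordered pairs `{i, j}` (`i = j` allowed). -/
def symMat {n : ℕ} (W : Sym2 (Fin n) → ℝ) : Fin n → Fin n → ℝ := fun i j => W s(i, j)

/-- Law of one entry `A^G_{ij}` of the adjacency matrix, given `v_i v_j = ε`: the diagonal is `0`
(no loops), and off the diagonal it is `1` with probability `(d + λ √d ε) / n` and `0` otherwise,
that is, `c_in / n` for `v_i = v_j` and `c_out / n` for `v_i ≠ v_j`, where `c_in = d + λ √d` and
`c_out = d - λ √d`. (`Set.projIcc` changes nothing when that number is a probability, which is so
once `d ≥ λ²` and `n ≥ d + |λ| √d`.) -/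
def graphEntry (n : ℕ) (d lam : ℝ) (diag : Prop) [Decidable diag] (ε : ℤˣ) : Measure ℝ :=
  if diag then Measure.dirac 0
  else bernoulliMeasure 1 0
    (Set.projIcc (0 : ℝ) 1 zero_le_one ((d + lam * Real.sqrt d * sgn ε) / n))

/-- Law of one entry `A_{ij}` of the Gaussian observation, given `v_i v_j = ε`:
`N(λ ε / n, 1 / n)` off the diagonal and `N(λ ε / n, 2 / n)` on it. -/
def gaussEntry (n : ℕ) (lam : ℝ) (diag : Prop) [Decidable diag] (ε : ℤˣ) : Measure ℝ :=
  gaussianReal (lam * sgn ε / n) (if diag then 2 / n else 1 / n)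

/-- Law of `A^G` given `v`: the entries on distinct unordered pairs are independent.
For a pair `e = {i, j}`, `(e.map v).mul` is `v_i v_j`. -/
def graphLaw {n : ℕ} (d lam : ℝ) (v : Label n) : Measure (Fin n → Fin n → ℝ) :=
  (Measure.pi fun e : Sym2 (Fin n) => graphEntry n d lam e.IsDiag (e.map v).mul).map symMat

/-- Law of the Gaussian matrix `A` given `v`. -/
def gaussLaw {n : ℕ} (lam : ℝ) (v : Label n) : Measure (Fin n → Fin n → ℝ) :=
  (Measure.pi fun e : Sym2 (Fin n) => gaussEntry n lam e.IsDiag (e.map v).mul).map symMat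

/-- Law of `B` given `v`: `B_{ai} = √(μ/n) v_i u_a + Z_{ai} / √p`, where `u ∼ N(0, I_p / p)` and the
independent standard normal variables `Z_{ai}` are independent of `u`. -/
def covLaw {n : ℕ} (p : ℕ) (mu : ℝ) (v : Label n) : Measure (Fin p → Fin n → ℝ) :=
  ((Measure.pi fun _ : Fin p => gaussianReal 0 (1 / p)).prod
    (Measure.pi fun _ : Fin p => Measure.pi fun _ : Fin n => gaussianReal 0 1)).map
    fun uZ a i => Real.sqrt (mu / n) * sgn (v i) * uZ.1 a + uZ.2 a i / Real.sqrt p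

/-- Joint law of `v`, uniform on `{±1}ⁿ`, and of an observation with law `L v` given `v`. -/
def jointLaw {n : ℕ} {β : Type} [MeasurableSpace β] (L : Label n → Measure β) :
    Measure (Label n × β) :=
  (2 ^ n : ℝ≥0∞)⁻¹ • ∑ v : Label n, (Measure.dirac v).prod (L v)

/-- Joint law of `(v, (A^G, B))`; `A^G` and `B` are conditionally independent given `v`. -/
def graphModel (n p : ℕ) (d lam mu : ℝ) : Measure (Label n × Obs n p) :=
  jointLaw fun v => (graphLaw d lam v).prod (covLaw p mu v)

/-- Joint law of `(v, (A, B))`; `A` and `B` are conditionally independent given `v`. -/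
def gaussModel (n p : ℕ) (lam mu : ℝ) : Measure (Label n × Obs n p) :=
  jointLaw fun v => (gaussLaw lam v).prod (covLaw p mu v)

/-- Mutual information `I(X; Y)` (in nats) of a pair `(X, Y)` with joint law `P`: the
Kullback-Leibler divergence of the joint law from the product of its marginals. -/
def mutualInfo {α β : Type} [MeasurableSpace α] [MeasurableSpace β] (P : Measure (α × β)) : ℝ≥0∞ :=
  klDiv P (P.fst.prod P.snd)

/-- `I(v; A^G, B)`, which is finite: see `mutualInfo_graphModel_ne_top`. -/
def graphInfo (n p : ℕ) (d lam mu : ℝ) : ℝ := (mutualInfo (graphModel n p d lam mu)).toReal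

/-- `I(v; A, B)`, which is finite: see `mutualInfo_gaussModel_ne_top`. -/
def gaussInfo (n p : ℕ) (lam mu : ℝ) : ℝ := (mutualInfo (gaussModel n p lam mu)).toReal

/-- `n⁻² E ‖v vᵀ - E[v vᵀ | Y]‖_F²`, where `(v, Y)` has the joint law `P`: the conditional
expectation is entrywise, with respect to the σ-algebra generated by `Y`. -/
def mmse {n : ℕ} {β : Type} [MeasurableSpace β] (P : Measure (Label n × β)) : ℝ :=
  ((n : ℝ) ^ 2)⁻¹ * ∫ ω, ∑ i, ∑ j,
    (sgn (ω.1 i) * sgn (ω.1 j) -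
      (P[fun ω' => sgn (ω'.1 i) * sgn (ω'.1 j) |
        MeasurableSpace.comap Prod.snd (inferInstance : MeasurableSpace β)]) ω) ^ 2 ∂P

/-- `D` is the derivative `dF / d(λ²)` at `λ = lam` of a function `F` of `λ`:
the limit of `(F θ - F lam) / (θ² - lam²)` as `θ → lam`. For `lam ≠ 0` it is `F'(lam) / (2 lam)`. -/
def HasDerivSqAt (F : ℝ → ℝ) (D lam : ℝ) : Prop :=
  Tendsto (fun θ => (F θ - F lam) / (θ ^ 2 - lam ^ 2)) (𝓝[≠] lam) (𝓝 D)

instance {n : ℕ} (d lam : ℝ) (q : Prop) [Decidable q] (ε : ℤˣ) :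
    IsProbabilityMeasure (graphEntry n d lam q ε) := by
  unfold graphEntry; split_ifs <;> infer_instance

instance {n : ℕ} (lam : ℝ) (q : Prop) [Decidable q] (ε : ℤˣ) :
    IsProbabilityMeasure (gaussEntry n lam q ε) := by
  unfold gaussEntry; infer_instance

lemma measurable_symMat {n : ℕ} : Measurable (symMat (n := n)) := by
  unfold symMat; fun_prop

instance {n : ℕ} (d lam : ℝ) (v : Label n) : IsProbabilityMeasure (graphLaw d lam v) :=
  Measure.isProbabilityMeasure_map measurable_symMat.aemeasurable

instance {n : ℕ} (lam : ℝ) (v : Label n) : IsProbabilityMeasure (gaussLaw lam v) :=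
  Measure.isProbabilityMeasure_map measurable_symMat.aemeasurable

instance {n : ℕ} (p : ℕ) (mu : ℝ) (v : Label n) : IsProbabilityMeasure (covLaw p mu v) :=
  Measure.isProbabilityMeasure_map (by fun_prop)

instance : MeasurableSingletonClass ℤˣ where
  measurableSet_singleton a :=
    ⟨{(a : ℤ)}, measurableSet_singleton _, by ext b; simp [Units.ext_iff]⟩

lemma klDiv_ne_top_of_le_smul {α : Type} [MeasurableSpace α] (P Q : Measure α) [IsFiniteMeasure P]
    [IsFiniteMeasure Q] (c : ℝ≥0) (h : P ≤ c • Q) : klDiv P Q ≠ ∞ := by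
  have hac : P ≪ Q := (Measure.absolutelyContinuous_of_le h).trans
    (Measure.smul_absolutelyContinuous)
  have hle : P.rnDeriv Q ≤ᵐ[Q] fun _ => (c : ℝ≥0∞) := by
    refine ae_le_of_forall_setLIntegral_le_of_sigmaFinite (Measure.measurable_rnDeriv P Q) ?_
    intro s hs _
    calc ∫⁻ x in s, P.rnDeriv Q x ∂Q ≤ P s := Measure.setLIntegral_rnDeriv_le s
      _ ≤ (c • Q) s := h s
      _ = _ := by simp
  rw [klDiv_eq_lintegral_klFun_of_ac hac]
  obtain ⟨K, hK⟩ := (isCompact_Icc (a := (0 : ℝ)) (b := c)).bddAbove_image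
    (f := klFun) continuous_klFun.continuousOn
  refine ne_top_of_le_ne_top (b := ∫⁻ _, ENNReal.ofReal K ∂Q) (by simp [ENNReal.mul_eq_top]) ?_
  refine lintegral_mono_ae ?_
  filter_upwards [hle] with x hx
  refine ENNReal.ofReal_le_ofReal (hK ⟨_, ⟨ENNReal.toReal_nonneg, ?_⟩, rfl⟩)
  exact ENNReal.toReal_mono (by simp) hx

instance {n : ℕ} {β : Type} [MeasurableSpace β] (L : Label n → Measure β)
    [∀ v, IsProbabilityMeasure (L v)] : IsProbabilityMeasure (jointLaw L) := by
  constructor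
  simp [jointLaw, ENNReal.inv_mul_cancel]

lemma mutualInfo_jointLaw_ne_top {n : ℕ} {β : Type} [MeasurableSpace β] (L : Label n → Measure β)
    [∀ v, IsProbabilityMeasure (L v)] : mutualInfo (jointLaw L) ≠ ∞ := by
  have h2 : (2 ^ n : ℝ≥0∞) ≠ 0 := by positivity
  have h2' : (2 ^ n : ℝ≥0∞) ≠ ∞ := by finiteness
  have hfst : ∀ v : Label n, (2 ^ n : ℝ≥0∞)⁻¹ • Measure.dirac v ≤ (jointLaw L).fst := by
    intro v
    refine Measure.le_iff.2 fun s hs => ?_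
    rw [Measure.fst_apply hs]
    simp only [jointLaw, Measure.smul_apply, Measure.finsetSum_apply]
    gcongr
    refine le_trans (le_of_eq ?_) (Finset.single_le_sum (f := fun w : Label n =>
      ((Measure.dirac w).prod (L w)) (Prod.fst ⁻¹' s)) (fun _ _ => zero_le) (Finset.mem_univ v))
    rw [← Measure.fst_apply hs, Measure.fst_prod]
  have hfstv : ∀ v : Label n, (2 ^ n : ℝ≥0∞)⁻¹ ≤ (jointLaw L).fst {v} := by
    intro v
    simpa using hfst v {v}
  refine klDiv_ne_top_of_le_smul _ _ (2 ^ n) ?_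
  refine Measure.le_iff.2 fun s hs => ?_
  have hQ : ∀ v : Label n, (2 ^ n : ℝ≥0∞)⁻¹ * (jointLaw L).snd (Prod.mk v ⁻¹' s)
      ≤ (jointLaw L).fst {v} * (jointLaw L).snd (Prod.mk v ⁻¹' s) := fun v => by
    gcongr; exact hfstv v
  have hP : (jointLaw L) s = (2 ^ n : ℝ≥0∞)⁻¹ * ∑ v, L v (Prod.mk v ⁻¹' s) := by
    simp [jointLaw, Measure.prod_apply hs, lintegral_dirac' _ (measurable_measure_prodMk_left hs)]
  have hS : (jointLaw L).snd = (2 ^ n : ℝ≥0∞)⁻¹ • ∑ v, L v := by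
    ext t ht
    rw [Measure.snd_apply ht]
    simp only [jointLaw, Measure.smul_apply, Measure.finsetSum_apply]
    congr 1
    refine Finset.sum_congr rfl fun v _ => ?_
    rw [← Measure.snd_apply ht, Measure.snd_prod]
  have hL : ∀ v : Label n, (2 ^ n : ℝ≥0∞)⁻¹ * L v (Prod.mk v ⁻¹' s)
      ≤ (jointLaw L).snd (Prod.mk v ⁻¹' s) := fun v => by
    rw [hS]
    simp only [Measure.smul_apply, Measure.finsetSum_apply, smul_eq_mul]
    gcongr
    exact Finset.single_le_sum (f := fun w : Label n => L w (Prod.mk v ⁻¹' s))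
      (fun _ _ => zero_le) (Finset.mem_univ v)
  have hprod : ((jointLaw L).fst.prod (jointLaw L).snd) s
      = ∑ v, (jointLaw L).snd (Prod.mk v ⁻¹' s) * (jointLaw L).fst {v} := by
    rw [Measure.prod_apply hs, lintegral_fintype]
  have key : (2 ^ n : ℝ≥0∞)⁻¹ * (jointLaw L) s
      ≤ ((jointLaw L).fst.prod (jointLaw L).snd) s := by
    rw [hprod, hP, Finset.mul_sum, Finset.mul_sum]
    refine Finset.sum_le_sum fun v _ => ?_
    rw [mul_comm ((jointLaw L).snd _)]
    exact (mul_le_mul_right (hL v) _).trans (hQ v)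
  calc (jointLaw L) s = 2 ^ n * ((2 ^ n : ℝ≥0∞)⁻¹ * (jointLaw L) s) := by
        rw [← mul_assoc, ENNReal.mul_inv_cancel h2 h2', one_mul]
    _ ≤ 2 ^ n * ((jointLaw L).fst.prod (jointLaw L).snd) s := by gcongr
    _ = _ := by simp [ENNReal.smul_def]

lemma mutualInfo_graphModel_ne_top (n p : ℕ) (d lam mu : ℝ) :
    mutualInfo (graphModel n p d lam mu) ≠ ∞ :=
  mutualInfo_jointLaw_ne_top _

lemma mutualInfo_gaussModel_ne_top (n p : ℕ) (lam mu : ℝ) :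
    mutualInfo (gaussModel n p lam mu) ≠ ∞ :=
  mutualInfo_jointLaw_ne_top _

end CSBM

end

noncomputable section

namespace CSBM

/-! Both models show `v` through independent channels, one for each unordered pair e = {i, j}, with
binary input v_i v_j, next to the same side information B. Diagonal pairs carry nothing because v_i²
= 1. The mutual information is n log 2 minus the conditional entropy of `v`
(`toReal_mutualInfo_model`), so only the channels have to be compared.

Adding one channel to the other observations lowers the conditional entropy by the expectation of
`Channel.info` at m, the posterior mean of the input given the other observations
(`condEntropy_update`). If f₊ and f₋ are the output densities, a weak channel has information (1 -
m²)/8 · ∫ (f₊ - f₋)² up to third absolute moments (`Channel.Valid.abs_info_sub_le`). For the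
Bernoulli and the Gaussian channel alike the leading term is (1 - m²)/2 · λ²/n; for fixed λ the two
differ by O(1/(n√d)) + O_d(n^(-3/2)), uniformly in m (`Regime.abs_info_sub_le`). Swapping the
channels one at a time, as in Lindeberg's method (`abs_condEntropy_sub_le`), costs at most n² such
errors; after division by n there remains O(1/√d) + O_d(1/√n).

For the derivative put a = λ/√d and P = d/n. The derivative of the information in a² is the sum over
pairs of the expected derivative of one channel's information, the other channels being fixed
(`hasDerivSqAt_condEntropy`). Each summand is the expectation of P(1 - m²)/2, up to O(P|a| + P²),
where m is again the mean without that channel. One sparse observation changes the mean square of m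
by O(P) only (`abs_integral_postMean_sq_sub_le`), so m may be replaced by the full posterior mean.
Division by nd then gives a quarter of the MMSE: one factor 1/2 is the one just displayed, the other
comes from counting unordered pairs. -/

/-! ### Elementary estimates for y log y and log (1 + x) -/

lemma abs_mul_log_sub_le {y : ℝ} (hy : 0 < y) :
    |y * Real.log y - (y - 1) - (y - 1) ^ 2 / 2| ≤ |y - 1| ^ 3 := by
  -- The second-order Taylor polynomial (y - 1) + (y - 1)²/2 equals (y² - 1)/2 = y sinh (log y).
  -- Comparing log y with its sinh therefore gives one side with no cubic error; the other side is
  -- the Padé bound 2x/(x + 2) ≤ log (1 + x), used at y or at 1/y.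
  have hs : Real.sinh (Real.log y) = (y - y⁻¹) / 2 := Real.sinh_log hy
  rcases le_total 1 y with h | h
  · have h1 : Real.log y ≤ (y - y⁻¹) / 2 := by
      rw [← hs, Real.self_le_sinh_iff]; exact Real.log_nonneg h
    have h2 : 2 * (y - 1) / (y - 1 + 2) ≤ Real.log (1 + (y - 1)) :=
      Real.le_log_one_add_of_nonneg (by linarith)
    rw [add_sub_cancel] at h2
    have h3 : y * Real.log y ≤ y * ((y - y⁻¹) / 2) := by gcongr
    have h3' : y * ((y - y⁻¹) / 2) = (y ^ 2 - 1) / 2 := by field_simp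
    have h4 : y * (2 * (y - 1) / (y - 1 + 2)) ≤ y * Real.log y := by gcongr
    have h5 : (y - 1) + (y - 1) ^ 2 / 2 - (y - 1) ^ 3 ≤ y * (2 * (y - 1) / (y - 1 + 2)) := by
      rw [← mul_div_assoc, le_div_iff₀ (by linarith)]
      have : 0 ≤ (y - 1) ^ 3 * (y + 1 / 2) := by
        have : 0 ≤ y - 1 := by linarith
        positivity
      nlinarith
    rw [abs_of_nonneg (by linarith : 0 ≤ y - 1), abs_le]
    have : 0 ≤ (y - 1) ^ 3 := pow_nonneg (by linarith) 3
    constructor <;> nlinarith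
  · have h1 : (y - y⁻¹) / 2 ≤ Real.log y := by
      rw [← hs, Real.sinh_le_self_iff]; exact Real.log_nonpos hy.le h
    have hi : 0 ≤ y⁻¹ - 1 := by have := (one_le_inv₀ hy).2 h; linarith
    have h2 : 2 * (y⁻¹ - 1) / (y⁻¹ - 1 + 2) ≤ Real.log (1 + (y⁻¹ - 1)) :=
      Real.le_log_one_add_of_nonneg hi
    rw [add_sub_cancel, Real.log_inv] at h2
    have h2' : 2 * (y⁻¹ - 1) / (y⁻¹ - 1 + 2) = 2 * (1 - y) / (1 + y) := by field_simp; ring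
    rw [h2'] at h2
    have h3 : y * ((y - y⁻¹) / 2) ≤ y * Real.log y := by gcongr
    have h3' : y * ((y - y⁻¹) / 2) = (y ^ 2 - 1) / 2 := by field_simp
    have h4 : y * (2 * (1 - y) / (1 + y)) ≤ y * -Real.log y := by gcongr
    have h5 : -((y - 1) + (y - 1) ^ 2 / 2 + (1 - y) ^ 3) ≤ y * (2 * (1 - y) / (1 + y)) := by
      rw [← mul_div_assoc, le_div_iff₀ (by linarith)]
      have : 0 ≤ (1 - y) ^ 3 * (y + 1 / 2) := by
        have : 0 ≤ 1 - y := by linarith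
        positivity
      nlinarith
    rw [abs_of_nonpos (by linarith : y - 1 ≤ 0), abs_le, neg_sub]
    have : 0 ≤ (1 - y) ^ 3 := pow_nonneg (by linarith) 3
    constructor <;> nlinarith

/-- The convexity gap of `y ↦ y log y` between `a` and `b` at the mixture of mean `m`. -/
def logGap (a b m : ℝ) : ℝ :=
  (1 + m) / 2 * (a * Real.log a) + (1 - m) / 2 * (b * Real.log b) -
    ((1 + m) / 2 * a + (1 - m) / 2 * b) * Real.log ((1 + m) / 2 * a + (1 - m) / 2 * b)

lemma mix_pos {a b m : ℝ} (ha : 0 < a) (hb : 0 < b) (hm : |m| ≤ 1) :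
    0 < (1 + m) / 2 * a + (1 - m) / 2 * b := by
  obtain ⟨h1, h2⟩ := abs_le.1 hm
  rcases le_total 0 m with h | h
  · have : 0 < (1 + m) / 2 * a := by positivity
    have : 0 ≤ (1 - m) / 2 * b := mul_nonneg (by linarith) hb.le
    linarith
  · have : 0 < (1 - m) / 2 * b := mul_pos (by linarith) hb
    have : 0 ≤ (1 + m) / 2 * a := mul_nonneg (by linarith) ha.le
    linarith

/-- In the expansion of y log y at 1 the linear terms cancel, and the quadratic ones leave half the
variance of the two-point law on `a`, `b`, which is (1 - m²)/4 · (a - b)². The cubic error at the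
mixture is dominated by those at the endpoints, since the mixture is no farther from 1 than the
farther endpoint. -/
lemma abs_logGap_sub_le {a b m : ℝ} (ha : 0 < a) (hb : 0 < b) (hm : |m| ≤ 1) :
    |logGap a b m - (1 - m ^ 2) / 8 * (a - b) ^ 2| ≤ 2 * (|a - 1| ^ 3 + |b - 1| ^ 3) := by
  obtain ⟨h1, h2⟩ := abs_le.1 hm
  set c := (1 + m) / 2 * a + (1 - m) / 2 * b with hc
  have hcp : 0 < c := mix_pos ha hb hm
  have ea := abs_mul_log_sub_le ha
  have eb := abs_mul_log_sub_le hb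
  have ec := abs_mul_log_sub_le hcp
  have hcc : |c - 1| ^ 3 ≤ |a - 1| ^ 3 + |b - 1| ^ 3 := by
    have hle : |c - 1| ≤ max |a - 1| |b - 1| := by
      have : c - 1 = (1 + m) / 2 * (a - 1) + (1 - m) / 2 * (b - 1) := by rw [hc]; ring
      rw [this]
      refine (abs_add_le _ _).trans ?_
      rw [abs_mul, abs_mul, abs_of_nonneg (by linarith : 0 ≤ (1 + m) / 2),
        abs_of_nonneg (by linarith : 0 ≤ (1 - m) / 2)]
      have k1 := mul_le_mul_of_nonneg_left (le_max_left |a - 1| |b - 1|)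
        (by linarith : 0 ≤ (1 + m) / 2)
      have k2 := mul_le_mul_of_nonneg_left (le_max_right |a - 1| |b - 1|)
        (by linarith : 0 ≤ (1 - m) / 2)
      linarith
    have := pow_le_pow_left₀ (abs_nonneg _) hle 3
    rcases max_cases |a - 1| |b - 1| with ⟨h, _⟩ | ⟨h, _⟩ <;> rw [h] at this
    · have := pow_nonneg (abs_nonneg (b - 1)) 3; linarith
    · have := pow_nonneg (abs_nonneg (a - 1)) 3; linarith
  have hA := pow_nonneg (abs_nonneg (a - 1)) 3
  have hB := pow_nonneg (abs_nonneg (b - 1)) 3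
  have key : logGap a b m - (1 - m ^ 2) / 8 * (a - b) ^ 2 =
      (1 + m) / 2 * (a * Real.log a - (a - 1) - (a - 1) ^ 2 / 2) +
      (1 - m) / 2 * (b * Real.log b - (b - 1) - (b - 1) ^ 2 / 2) -
      (c * Real.log c - (c - 1) - (c - 1) ^ 2 / 2) := by
    simp only [logGap, ← hc]
    rw [hc]; ring
  rw [key]
  set A := a * Real.log a - (a - 1) - (a - 1) ^ 2 / 2
  set B := b * Real.log b - (b - 1) - (b - 1) ^ 2 / 2
  set X := c * Real.log c - (c - 1) - (c - 1) ^ 2 / 2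
  have hα : |(1 + m) / 2 * A| ≤ |a - 1| ^ 3 := by
    rw [abs_mul, abs_of_nonneg (by linarith : 0 ≤ (1 + m) / 2)]
    nlinarith [abs_nonneg A]
  have hβ : |(1 - m) / 2 * B| ≤ |b - 1| ^ 3 := by
    rw [abs_mul, abs_of_nonneg (by linarith : 0 ≤ (1 - m) / 2)]
    nlinarith [abs_nonneg B]
  rw [abs_le] at *
  constructor <;> linarith [hα.1, hα.2, hβ.1, hβ.2, ec.1, ec.2]

/-- `log (1 + x) / x`, continued by `1` at `x = 0`. -/
def logRatio (x : ℝ) : ℝ := dslope (fun y => Real.log (1 + y)) 0 x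

lemma mul_logRatio (x : ℝ) : x * logRatio x = Real.log (1 + x) := by
  have := sub_smul_dslope (fun y => Real.log (1 + y)) 0 x
  simpa [logRatio] using this

lemma hasDerivAt_log_one_add {x : ℝ} (hx : -1 < x) :
    HasDerivAt (fun y => Real.log (1 + y)) (1 + x)⁻¹ x := by
  have := ((hasDerivAt_id x).const_add 1).log (by simp; linarith)
  simpa [one_div] using this

lemma logRatio_zero : logRatio 0 = 1 := by
  rw [logRatio, dslope_same]
  simpa using (hasDerivAt_log_one_add (x := 0) (by norm_num)).deriv

lemma continuousAt_logRatio {x : ℝ} (hx : -1 < x) : ContinuousAt logRatio x := by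
  rcases eq_or_ne x 0 with rfl | h
  · exact continuousAt_dslope_same.2 (hasDerivAt_log_one_add hx).differentiableAt
  · exact (continuousAt_dslope_of_ne h).2 (hasDerivAt_log_one_add hx).continuousAt

lemma abs_logRatio_sub_one_le {x : ℝ} (hx : |x| ≤ 1 / 2) : |logRatio x - 1| ≤ |x| := by
  rcases eq_or_ne x 0 with rfl | h
  · simp [logRatio_zero]
  obtain ⟨h1, h2⟩ := abs_le.1 hx
  have hu : Real.log (1 + x) - x ≤ 0 := by
    have := Real.log_le_sub_one_of_pos (by linarith : 0 < 1 + x); linarith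
  have hl : -x ^ 2 ≤ Real.log (1 + x) - x := by
    by_cases hx0 : 0 ≤ x
    · have := Real.le_log_one_add_of_nonneg hx0
      have h5 : x - x ^ 2 ≤ 2 * x / (x + 2) := by
        rw [le_div_iff₀ (by linarith)]; nlinarith [sq_nonneg x, mul_nonneg hx0 (sq_nonneg x)]
      linarith
    · push Not at hx0
      have hs : Real.sinh (Real.log (1 + x)) = ((1 + x) - (1 + x)⁻¹) / 2 :=
        Real.sinh_log (by linarith)
      have h7 : ((1 + x) - (1 + x)⁻¹) / 2 ≤ Real.log (1 + x) := by
        rw [← hs, Real.sinh_le_self_iff]; exact Real.log_nonpos (by linarith) (by linarith)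
      have h8 : x - x ^ 2 ≤ ((1 + x) - (1 + x)⁻¹) / 2 := by
        have : (1 + x)⁻¹ ≤ 1 - x + 2 * x ^ 2 := by
          rw [inv_le_iff_one_le_mul₀ (by linarith)]
          nlinarith [mul_nonneg (sq_nonneg x) (by linarith : 0 ≤ 1 + 2 * x)]
        linarith
      linarith
  have e : x * (logRatio x - 1) = Real.log (1 + x) - x := by rw [mul_sub, mul_logRatio]; ring
  have : |x| * |logRatio x - 1| ≤ |x| * |x| := by
    rw [← abs_mul, e, abs_of_nonpos hu, abs_mul_abs_self]; linarith
  exact le_of_mul_le_mul_left this (abs_pos.2 h)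

lemma measurable_logRatio : Measurable logRatio := by
  have : logRatio = fun x => if x = 0 then 1 else Real.log (1 + x) / x := by
    ext x
    split_ifs with h
    · rw [h, logRatio_zero]
    · rw [← mul_logRatio, mul_div_cancel_left₀ _ h]
  rw [this]
  exact Measurable.ite (measurableSet_singleton 0) measurable_const (by fun_prop)

/-! ### Entropy of unnormalised weights -/

/-- Total mass times the entropy of the normalised weights. -/
def massEntropy {V : Type} [Fintype V] (w : V → ℝ) : ℝ :=
  ∑ v, Real.negMulLog (w v) - Real.negMulLog (∑ v, w v)

section MassEntropy

variable {V : Type} [Fintype V] {w : V → ℝ}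

lemma massEntropy_eq_sum (hw : ∀ v, 0 ≤ w v) (hS : 0 < ∑ v, w v) :
    massEntropy w = ∑ v, (∑ u, w u) * Real.negMulLog (w v / ∑ u, w u) := by
  set S := ∑ u, w u with hSd
  have h : ∀ v, S * Real.negMulLog (w v / S) = Real.negMulLog (w v) + w v * Real.log S := by
    intro v
    rcases (hw v).eq_or_lt with h0 | h0
    · simp [← h0]
    · rw [Real.negMulLog, Real.negMulLog, Real.log_div h0.ne' hS.ne']
      field_simp
      ring
  simp_rw [h, Finset.sum_add_distrib, ← Finset.sum_mul, ← hSd, massEntropy, ← hSd]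
  rw [Real.negMulLog]; ring

lemma div_sum_mem (hw : ∀ v, 0 ≤ w v) (v : V) : 0 ≤ w v / ∑ u, w u ∧ w v / ∑ u, w u ≤ 1 :=
  ⟨div_nonneg (hw v) (Finset.sum_nonneg fun _ _ => hw _),
    div_le_one_of_le₀ (Finset.single_le_sum (f := w) (fun _ _ => hw _) (Finset.mem_univ v))
      (Finset.sum_nonneg fun _ _ => hw _)⟩

/-- A crude bound, linear in the total mass, which serves only to make entropies integrable. -/
lemma abs_massEntropy_le (hw : ∀ v, 0 ≤ w v) (hS : 0 < ∑ v, w v) :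
    |massEntropy w| ≤ Fintype.card V * ∑ v, w v := by
  rw [massEntropy_eq_sum hw hS]
  have h : ∀ v, 0 ≤ Real.negMulLog (w v / ∑ u, w u) ∧ Real.negMulLog (w v / ∑ u, w u) ≤ 1 := by
    intro v
    obtain ⟨h0, h1⟩ := div_sum_mem hw v
    exact ⟨Real.negMulLog_nonneg h0 h1, (Real.negMulLog_le_one_sub_self h0).trans (by linarith)⟩
  rw [abs_of_nonneg (Finset.sum_nonneg fun v _ => mul_nonneg hS.le (h v).1)]
  refine (Finset.sum_le_sum fun v _ => mul_le_of_le_one_right hS.le (h v).2).trans ?_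
  simp

end MassEntropy

/-! ### Mutual information and mean square error in terms of densities -/

section Density

variable {n : ℕ} {β : Type} [MeasurableSpace β] {ρ : Measure β}
  {w : Label n → β → ℝ} {L : Label n → Measure β} [∀ v, IsProbabilityMeasure (L v)]

/-- Throughout this section `w v` is the density of `L v` times the prior mass 2⁻ⁿ. Thus `w` is the
joint density against counting measure times `ρ`, its sum over labels is the density of the
observation, and their quotient is the posterior. -/
lemma lintegral_jointLaw (hwm : ∀ v, Measurable (w v))
    (hL : ∀ v, L v = ρ.withDensity fun b => ENNReal.ofReal (2 ^ n * w v b))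
    {F : Label n × β → ℝ≥0∞} (hF : Measurable F) :
    ∫⁻ z, F z ∂(jointLaw L) = ∑ v, ∫⁻ b, ENNReal.ofReal (w v b) * F (v, b) ∂ρ := by
  have h2 : (2 ^ n : ℝ≥0∞) ≠ 0 := by positivity
  have h2' : (2 ^ n : ℝ≥0∞) ≠ ∞ := by finiteness
  simp only [jointLaw, lintegral_smul_measure, lintegral_finsetSum_measure, smul_eq_mul,
    Finset.mul_sum, Measure.dirac_prod]
  refine Finset.sum_congr rfl fun v _ => ?_
  rw [lintegral_map hF (by fun_prop), hL v,
    lintegral_withDensity_eq_lintegral_mul _ (by fun_prop) (by fun_prop)]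
  simp only [Pi.mul_apply]
  rw [← lintegral_const_mul _ (by fun_prop)]
  refine lintegral_congr fun b => ?_
  rw [ENNReal.ofReal_mul (by positivity), ENNReal.ofReal_pow (by norm_num), ENNReal.ofReal_ofNat,
    ← mul_assoc, ← mul_assoc, ENNReal.inv_mul_cancel h2 h2', one_mul]

lemma integral_jointLaw (hwm : ∀ v, Measurable (w v)) (hw : ∀ v b, 0 ≤ w v b)
    (hL : ∀ v, L v = ρ.withDensity fun b => ENNReal.ofReal (2 ^ n * w v b))
    {F : Label n × β → ℝ} (hF : Measurable F)
    (hi : ∀ v, Integrable (fun b => w v b * F (v, b)) ρ) :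
    Integrable F (jointLaw L) ∧ ∫ z, F z ∂(jointLaw L) = ∑ v, ∫ b, w v b * F (v, b) ∂ρ := by
  have hd : ∀ v, Measurable fun b => Real.toNNReal (2 ^ n * w v b) := fun v => by fun_prop
  have hint : ∀ v, Integrable F ((Measure.dirac v).prod (L v)) := by
    intro v
    rw [Measure.dirac_prod, integrable_map_measure hF.aestronglyMeasurable (by fun_prop), hL v]
    refine (integrable_withDensity_iff_integrable_smul (hd v)).2 ?_
    refine ((hi v).const_mul (2 ^ n)).congr (ae_of_all _ fun b => ?_)
    simp only [NNReal.smul_def, smul_eq_mul, Function.comp]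
    rw [Real.coe_toNNReal _ (mul_nonneg (by positivity) (hw v b)), mul_assoc]
  constructor
  · rw [jointLaw]
    refine Integrable.smul_measure ?_ (by simp)
    exact integrable_finsetSum_measure.2 fun v _ => hint v
  · rw [jointLaw, integral_smul_measure, integral_finsetSum_measure fun v _ => hint v,
      Finset.smul_sum]
    refine Finset.sum_congr rfl fun v _ => ?_
    rw [Measure.dirac_prod, integral_map (by fun_prop) hF.aestronglyMeasurable, hL v]
    have := integral_withDensity_eq_integral_smul (μ := ρ) (hd v) (fun b => F (v, b))
    change _ • ∫ b, F (v, b) ∂(ρ.withDensity fun b => (Real.toNNReal (2 ^ n * w v b) : ℝ≥0∞)) = _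
    rw [this, ← integral_smul]
    refine integral_congr_ae (ae_of_all _ fun b => ?_)
    simp only [NNReal.smul_def, smul_eq_mul]
    rw [Real.coe_toNNReal _ (mul_nonneg (by positivity) (hw v b))]
    simp only [ENNReal.toReal_inv, ENNReal.toReal_pow, ENNReal.toReal_ofNat]
    field_simp

lemma integrable_weight (hwm : ∀ v, Measurable (w v)) (hw : ∀ v b, 0 ≤ w v b)
    (hL : ∀ v, L v = ρ.withDensity fun b => ENNReal.ofReal (2 ^ n * w v b)) (v : Label n) :
    Integrable (w v) ρ := by
  have h1 : ∫⁻ b, ENNReal.ofReal (2 ^ n * w v b) ∂ρ = 1 := by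
    have := measure_univ (μ := L v)
    rwa [hL v, withDensity_apply _ MeasurableSet.univ, setLIntegral_univ] at this
  have h2 : Integrable (fun b => 2 ^ n * w v b) ρ := by
    refine ⟨(by fun_prop), ?_⟩
    rw [hasFiniteIntegral_iff_ofReal (ae_of_all _ fun b => mul_nonneg (by positivity) (hw v b)),
      h1]
    simp
  refine (h2.const_mul ((2 ^ n)⁻¹)).congr (ae_of_all _ fun b => ?_)
  simp

lemma integral_sum_weight (hwm : ∀ v, Measurable (w v)) (hw : ∀ v b, 0 ≤ w v b)
    (hL : ∀ v, L v = ρ.withDensity fun b => ENNReal.ofReal (2 ^ n * w v b)) :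
    ∫ b, ∑ v, w v b ∂ρ = 1 := by
  have h := (integral_jointLaw hwm hw hL (F := fun _ => 1) measurable_const
    fun v => by simpa using integrable_weight hwm hw hL v).2
  rw [integral_finsetSum _ fun v _ => integrable_weight hwm hw hL v]
  simpa using h.symm

/-- The density of the joint law against the product of its marginals is posterior over prior. It is
written out in order to identify the log-likelihood ratio in the divergence. -/
lemma jointLaw_eq_withDensity (hwm : ∀ v, Measurable (w v)) (hw : ∀ v b, 0 ≤ w v b)
    (hS : ∀ b, 0 < ∑ v, w v b)
    (hL : ∀ v, L v = ρ.withDensity fun b => ENNReal.ofReal (2 ^ n * w v b)) :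
    jointLaw L = ((jointLaw L).fst.prod (jointLaw L).snd).withDensity
      fun z => ENNReal.ofReal (2 ^ n * w z.1 z.2 / ∑ v, w v z.2) := by
  have h2 : (2 ^ n : ℝ≥0∞) ≠ 0 := by positivity
  have h2' : (2 ^ n : ℝ≥0∞) ≠ ∞ := by finiteness
  have hwm' : Measurable fun z : Label n × β => w z.1 z.2 := measurable_from_prod_countable_right hwm
  have hfst : ∀ G : Label n → ℝ≥0∞, ∫⁻ v, G v ∂(jointLaw L).fst = (2 ^ n)⁻¹ * ∑ v, G v := by
    intro G
    have hG : Measurable G := measurable_of_countable G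
    rw [Measure.fst, lintegral_map hG measurable_fst]
    simp only [jointLaw, lintegral_smul_measure, lintegral_finsetSum_measure, smul_eq_mul,
      Measure.dirac_prod]
    congr 1
    refine Finset.sum_congr rfl fun v _ => ?_
    rw [lintegral_map (by fun_prop) (by fun_prop)]
    simp
  have hsnd : ∀ G : β → ℝ≥0∞, Measurable G →
      ∫⁻ b, G b ∂(jointLaw L).snd = ∫⁻ b, ENNReal.ofReal (∑ v, w v b) * G b ∂ρ := by
    intro G hG
    rw [Measure.snd, lintegral_map hG measurable_snd, lintegral_jointLaw hwm hL (by fun_prop),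
      ← lintegral_finsetSum _ (fun v _ => by fun_prop)]
    refine lintegral_congr fun b => ?_
    rw [ENNReal.ofReal_sum_of_nonneg fun v _ => hw v b, Finset.sum_mul]
  have hD : Measurable fun z : Label n × β =>
      ENNReal.ofReal (2 ^ n * w z.1 z.2 / ∑ v, w v z.2) := by fun_prop
  ext s hs
  have hsi : Measurable (s.indicator (1 : Label n × β → ℝ≥0∞)) := measurable_one.indicator hs
  rw [withDensity_apply _ hs, ← lintegral_indicator hs, ← lintegral_indicator_one hs,
    lintegral_jointLaw hwm hL hsi, lintegral_prod _ (hD.indicator hs).aemeasurable, hfst,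
    Finset.mul_sum]
  refine Finset.sum_congr rfl fun v _ => ?_
  have hm : Measurable fun b => s.indicator (fun z : Label n × β =>
      ENNReal.ofReal (2 ^ n * w z.1 z.2 / ∑ v, w v z.2)) (v, b) :=
    (hD.indicator hs).comp measurable_prodMk_left
  rw [hsnd _ hm, ← lintegral_const_mul _ (by fun_prop)]
  refine lintegral_congr fun b => ?_
  by_cases hb : (v, b) ∈ s
  · simp only [Set.indicator_of_mem hb, Pi.one_apply, mul_one]
    rw [← ENNReal.ofReal_mul (hS b).le, mul_div_cancel₀ _ (hS b).ne',
      ENNReal.ofReal_mul (by positivity), ENNReal.ofReal_pow (by norm_num), ENNReal.ofReal_ofNat,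
      ← mul_assoc, ENNReal.inv_mul_cancel h2 h2', one_mul]
  · simp [Set.indicator_of_notMem hb]

/-- This is I(v; Y) = H(v) - H(v | Y): the logarithm of posterior over prior splits into n log 2 and
the logarithm of the posterior, whose mean is minus the conditional entropy. -/
lemma toReal_mutualInfo_jointLaw (hwm : ∀ v, Measurable (w v)) (hw : ∀ v b, 0 ≤ w v b)
    (hS : ∀ b, 0 < ∑ v, w v b)
    (hL : ∀ v, L v = ρ.withDensity fun b => ENNReal.ofReal (2 ^ n * w v b)) :
    (mutualInfo (jointLaw L)).toReal =
      n * Real.log 2 - ∫ b, massEntropy (fun v => w v b) ∂ρ := by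
  have hwm' : Measurable fun z : Label n × β => w z.1 z.2 := measurable_from_prod_countable_right hwm
  set P := jointLaw L with hP
  set Q := P.fst.prod P.snd with hQ
  set D : Label n × β → ℝ := fun z => 2 ^ n * w z.1 z.2 / ∑ v, w v z.2 with hDdef
  have hD : Measurable D := by fun_prop
  have hD0 : ∀ z, 0 ≤ D z := fun z =>
    div_nonneg (mul_nonneg (by positivity) (hw _ _)) (hS _).le
  have hPQ : P = Q.withDensity fun z => ENNReal.ofReal (D z) := jointLaw_eq_withDensity hwm hw hS hL
  have hac : P ≪ Q := by rw [hPQ]; exact withDensity_absolutelyContinuous _ _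
  have hrn : llr P Q =ᵐ[P] fun z => Real.log (D z) := by
    refine hac.ae_le ?_
    have := Measure.rnDeriv_withDensity Q (f := fun z => ENNReal.ofReal (D z)) (by fun_prop)
    rw [← hPQ] at this
    filter_upwards [this] with z hz
    rw [llr, hz, ENNReal.toReal_ofReal (hD0 z)]
  have hwi := integrable_weight hwm hw hL
  have hterm : ∀ v b, w v b * Real.log (D (v, b)) = w v b * (n * Real.log 2) -
      (∑ u, w u b) * Real.negMulLog (w v b / ∑ u, w u b) := by
    intro v b
    have hSb := hS b
    rcases (hw v b).eq_or_lt with h0 | h0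
    · simp [← h0]
    · simp only [hDdef]
      rw [mul_div_assoc, Real.log_mul (by positivity) (by positivity), Real.log_pow,
        Real.negMulLog]
      field_simp
      ring
  have hSi : Integrable (fun b => ∑ u, w u b) ρ := integrable_finsetSum _ fun v _ => hwi v
  have hneg : ∀ v, Integrable
      (fun b => (∑ u, w u b) * Real.negMulLog (w v b / ∑ u, w u b)) ρ := by
    intro v
    refine hSi.mul_of_top_left ?_
    refine memLp_top_of_bound (Measurable.aestronglyMeasurable
      (Real.continuous_negMulLog.measurable.comp (by fun_prop))) 1 (ae_of_all _ fun b => ?_)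
    obtain ⟨h0, h1⟩ := div_sum_mem (w := fun v => w v b) (fun v => hw v b) v
    rw [Real.norm_eq_abs, abs_of_nonneg (Real.negMulLog_nonneg h0 h1)]
    exact (Real.negMulLog_le_one_sub_self h0).trans (by linarith)
  have hi : ∀ v, Integrable (fun b => w v b * Real.log (D (v, b))) ρ := by
    intro v
    simp_rw [hterm]
    exact ((hwi v).mul_const _).sub (hneg v)
  rw [mutualInfo, toReal_klDiv_of_measure_eq hac (by simp), integral_congr_ae hrn,
    (integral_jointLaw hwm hw hL (by fun_prop) hi).2]
  simp_rw [hterm]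
  rw [← integral_finsetSum (f := fun v b => w v b * (n * Real.log 2) -
    (∑ u, w u b) * Real.negMulLog (w v b / ∑ u, w u b)) _
    fun v _ => ((hwi v).mul_const _).sub (hneg v)]
  simp_rw [Finset.sum_sub_distrib, ← Finset.sum_mul]
  rw [integral_sub (hSi.mul_const _) (integrable_finsetSum _ fun v _ => hneg v),
    integral_mul_const, integral_sum_weight hwm hw hL, one_mul]
  congr 1
  refine integral_congr_ae (ae_of_all _ fun b => ?_)
  simp only
  rw [massEntropy_eq_sum (fun v => hw v b) (hS b)]

lemma spin_mul_sq (v : Label n) (i j : Fin n) : (sgn (v i) * sgn (v j)) ^ 2 = 1 := by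
  have h : ∀ ε : ℤˣ, sgn ε ^ 2 = 1 := fun ε => by
    rcases Int.units_eq_one_or ε with rfl | rfl <;> simp [sgn]
  rw [mul_pow, h, h, one_mul]

lemma abs_sum_mul_le {V : Type} [Fintype V] {w s : V → ℝ} (hw : ∀ v, 0 ≤ w v)
    (hs : ∀ v, |s v| ≤ 1) : |∑ v, s v * w v| ≤ ∑ v, w v := by
  refine (Finset.abs_sum_le_sum_abs _ _).trans (Finset.sum_le_sum fun v _ => ?_)
  rw [abs_mul, abs_of_nonneg (hw v)]
  exact mul_le_of_le_one_left (hw v) (hs v)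

lemma abs_sum_mul_div_le_one {V : Type} [Fintype V] {w s : V → ℝ} (hw : ∀ v, 0 ≤ w v)
    (hs : ∀ v, |s v| ≤ 1) : |(∑ v, s v * w v) / ∑ v, w v| ≤ 1 := by
  have hS : 0 ≤ ∑ v, w v := Finset.sum_nonneg fun v _ => hw v
  rw [abs_div, abs_of_nonneg hS]
  exact div_le_one_of_le₀ (abs_sum_mul_le hw hs) hS

lemma integrable_sq_sum_div (hwm : ∀ v, Measurable (w v)) (hw : ∀ v b, 0 ≤ w v b)
    (hL : ∀ v, L v = ρ.withDensity fun b => ENNReal.ofReal (2 ^ n * w v b))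
    {s : Label n → ℝ} (hs : ∀ v, |s v| ≤ 1) :
    Integrable (fun b => (∑ v, s v * w v b) ^ 2 / ∑ v, w v b) ρ := by
  have hSi : Integrable (fun b => ∑ u, w u b) ρ :=
    integrable_finsetSum _ fun v _ => integrable_weight hwm hw hL v
  refine hSi.mono' (Measurable.aestronglyMeasurable (by fun_prop)) (ae_of_all _ fun b => ?_)
  have h0 : 0 ≤ ∑ v, w v b := Finset.sum_nonneg fun v _ => hw v b
  have h1 := abs_sum_mul_le (w := fun v => w v b) (fun v => hw v b) hs
  rw [Real.norm_eq_abs, abs_of_nonneg (by positivity)]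
  refine div_le_of_le_mul₀ h0 h0 ?_
  rw [← sq, ← sq_abs]
  gcongr

/-- Bayes' formula: integrating the candidate against the marginal density of the observation
cancels the denominator. -/
lemma condExp_jointLaw (hwm : ∀ v, Measurable (w v)) (hw : ∀ v b, 0 ≤ w v b)
    (hS : ∀ b, 0 < ∑ v, w v b)
    (hL : ∀ v, L v = ρ.withDensity fun b => ENNReal.ofReal (2 ^ n * w v b))
    {s : Label n → ℝ} (hs : ∀ v, |s v| ≤ 1) :
    (jointLaw L)[fun z => s z.1 | MeasurableSpace.comap Prod.snd inferInstance] =ᵐ[jointLaw L]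
      fun z => (∑ v, s v * w v z.2) / ∑ v, w v z.2 := by
  have hsm : Measurable fun z : Label n × β => s z.1 := (measurable_of_countable s).comp (by fun_prop)
  have hle : MeasurableSpace.comap (Prod.snd : Label n × β → β) inferInstance ≤
      (inferInstance : MeasurableSpace (Label n × β)) := measurable_snd.comap_le
  have hwi := integrable_weight hwm hw hL
  have hgm : Measurable fun b => (∑ v, s v * w v b) / ∑ v, w v b := by fun_prop
  have hg1 : ∀ b, |(∑ v, s v * w v b) / ∑ v, w v b| ≤ 1 := fun b =>
    abs_sum_mul_div_le_one (fun v => hw v b) hs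
  have hgi : Integrable (fun z : Label n × β => (∑ v, s v * w v z.2) / ∑ v, w v z.2)
      (jointLaw L) :=
    Integrable.of_bound (hgm.comp measurable_snd).aestronglyMeasurable 1
      (ae_of_all _ fun z => hg1 z.2)
  have hfi : Integrable (fun z : Label n × β => s z.1) (jointLaw L) :=
    Integrable.of_bound hsm.aestronglyMeasurable 1 (ae_of_all _ fun z => hs z.1)
  refine (ae_eq_condExp_of_forall_setIntegral_eq hle hfi (fun _ _ _ => hgi.integrableOn) ?_
    ?_).symm
  · rintro _ ⟨t, ht, rfl⟩ -
    have ht' : MeasurableSet (Prod.snd ⁻¹' t : Set (Label n × β)) := measurable_snd ht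
    rw [← integral_indicator ht', ← integral_indicator ht']
    have key : ∀ {F : Label n × β → ℝ}, Measurable F → (∀ z, |F z| ≤ 1) →
        ∫ z, (Prod.snd ⁻¹' t).indicator F z ∂(jointLaw L) =
          ∫ b in t, ∑ v, w v b * F (v, b) ∂ρ := by
      intro F hF hF1
      have hFi : ∀ v, Integrable (fun b => w v b * F (v, b)) ρ := fun v =>
        (hwi v).mul_bdd (c := 1) (Measurable.aestronglyMeasurable (by fun_prop)) (ae_of_all _ fun b => hF1 (v, b))
      have e : ∀ v, (fun b => w v b * (Prod.snd ⁻¹' t).indicator F (v, b)) =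
          t.indicator fun b => w v b * F (v, b) := by
        intro v; ext b
        by_cases hb : b ∈ t <;> simp [hb]
      rw [(integral_jointLaw hwm hw hL (hF.indicator ht') fun v => by
        rw [e v]; exact (hFi v).indicator ht).2, integral_finsetSum _ fun v _ => (hFi v).integrableOn]
      refine Finset.sum_congr rfl fun v _ => ?_
      rw [e v, integral_indicator ht]
    have hgm' : Measurable fun z : Label n × β => (∑ v, s v * w v z.2) / ∑ v, w v z.2 :=
      hgm.comp measurable_snd
    rw [key hgm' fun z => hg1 z.2, key hsm fun z => hs z.1]
    refine integral_congr_ae (ae_of_all _ fun b => ?_)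
    simp only [← Finset.sum_mul]
    rw [mul_div_cancel₀ _ (hS b).ne']
    exact Finset.sum_congr rfl fun v _ => mul_comm _ _
  · exact (hgm.comp (comap_measurable Prod.snd)).aestronglyMeasurable

/-- Orthogonality of the conditional expectation: since s² = 1, the error is one minus the second
moment of the posterior mean. -/
lemma integral_sq_sub_jointLaw (hwm : ∀ v, Measurable (w v)) (hw : ∀ v b, 0 ≤ w v b)
    (hS : ∀ b, 0 < ∑ v, w v b)
    (hL : ∀ v, L v = ρ.withDensity fun b => ENNReal.ofReal (2 ^ n * w v b))
    {s : Label n → ℝ} (hs : ∀ v, s v ^ 2 = 1) :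
    Integrable (fun z => (s z.1 - (∑ v, s v * w v z.2) / ∑ v, w v z.2) ^ 2) (jointLaw L) ∧
    ∫ z, (s z.1 - (∑ v, s v * w v z.2) / ∑ v, w v z.2) ^ 2 ∂(jointLaw L) =
      1 - ∫ b, (∑ v, s v * w v b) ^ 2 / ∑ v, w v b ∂ρ := by
  have hsm : Measurable fun z : Label n × β => s z.1 := (measurable_of_countable s).comp (by fun_prop)
  have hs1 : ∀ v, |s v| ≤ 1 := fun v => by rw [← sq_le_one_iff_abs_le_one, hs v]
  have hwi := integrable_weight hwm hw hL
  have hg1 : ∀ b, |(∑ v, s v * w v b) / ∑ v, w v b| ≤ 1 := fun b =>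
    abs_sum_mul_div_le_one (fun v => hw v b) hs1
  have hb : ∀ v b, |(s v - (∑ v, s v * w v b) / ∑ v, w v b) ^ 2| ≤ 4 := by
    intro v b
    rw [abs_pow]
    have : |s v - (∑ v, s v * w v b) / ∑ v, w v b| ≤ 2 :=
      (abs_sub _ _).trans (by linarith [hs1 v, hg1 b])
    nlinarith [abs_nonneg (s v - (∑ v, s v * w v b) / ∑ v, w v b)]
  have hi : ∀ v, Integrable
      (fun b => w v b * (s v - (∑ v, s v * w v b) / ∑ v, w v b) ^ 2) ρ := fun v =>
    (hwi v).mul_bdd (c := 4) (Measurable.aestronglyMeasurable (by fun_prop)) (ae_of_all _ fun b => hb v b)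
  obtain ⟨h1, h2⟩ := integral_jointLaw hwm hw hL
    (F := fun z => (s z.1 - (∑ v, s v * w v z.2) / ∑ v, w v z.2) ^ 2) (by fun_prop) hi
  refine ⟨h1, ?_⟩
  rw [h2, ← integral_finsetSum _ fun v _ => hi v, ← integral_sum_weight hwm hw hL,
    ← integral_sub (integrable_finsetSum _ fun v _ => hwi v) (integrable_sq_sum_div hwm hw hL hs1)]
  refine integral_congr_ae (ae_of_all _ fun b => ?_)
  simp only
  have hSb := (hS b).ne'
  set S := ∑ v, w v b with hSd
  set N := ∑ v, s v * w v b with hNd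
  have : ∀ v, w v b * (s v - N / S) ^ 2 =
      w v b - 2 * (N / S) * (s v * w v b) + (N / S) ^ 2 * w v b := by
    intro v
    linear_combination w v b * hs v
  simp_rw [this, Finset.sum_add_distrib, Finset.sum_sub_distrib, ← Finset.mul_sum, ← hSd, ← hNd]
  field_simp
  ring

lemma mmse_jointLaw (hwm : ∀ v, Measurable (w v)) (hw : ∀ v b, 0 ≤ w v b)
    (hS : ∀ b, 0 < ∑ v, w v b)
    (hL : ∀ v, L v = ρ.withDensity fun b => ENNReal.ofReal (2 ^ n * w v b)) :
    mmse (jointLaw L) = ((n : ℝ) ^ 2)⁻¹ * ∑ i, ∑ j,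
      (1 - ∫ b, (∑ v, (sgn (v i) * sgn (v j)) * w v b) ^ 2 / ∑ v, w v b ∂ρ) := by
  rw [mmse]
  congr 1
  have h1 := fun i j => integral_sq_sub_jointLaw hwm hw hS hL
    (s := fun v => sgn (v i) * sgn (v j)) (fun v => spin_mul_sq v i j)
  have h2 := fun i j => condExp_jointLaw hwm hw hS hL (s := fun v => sgn (v i) * sgn (v j))
    (fun v => by rw [← sq_le_one_iff_abs_le_one, spin_mul_sq])
  have e : ∀ i j, (fun z : Label n × β => (sgn (z.1 i) * sgn (z.1 j) -
      ((jointLaw L)[fun z' => sgn (z'.1 i) * sgn (z'.1 j) |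
        MeasurableSpace.comap Prod.snd inferInstance]) z) ^ 2) =ᵐ[jointLaw L]
      fun z => (sgn (z.1 i) * sgn (z.1 j) -
        (∑ v, sgn (v i) * sgn (v j) * w v z.2) / ∑ v, w v z.2) ^ 2 := by
    intro i j
    filter_upwards [h2 i j] with z hz
    rw [hz]
  rw [integral_finsetSum _ fun i _ => integrable_finsetSum _ fun j _ =>
    ((h1 i j).1.congr (e i j).symm)]
  refine Finset.sum_congr rfl fun i _ => ?_
  rw [integral_finsetSum _ fun j _ => ((h1 i j).1.congr (e i j).symm)]
  refine Finset.sum_congr rfl fun j _ => ?_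
  rw [integral_congr_ae (e i j), (h1 i j).2]

end Density

/-! ### Binary-input channels and their information -/

/-- A binary-input channel with real output: reference law and densities given the input `±1`. -/
structure Channel where
  ref : Measure ℝ
  dens : ℤˣ → ℝ → ℝ

namespace Channel

/-- The densities are positive probability densities with finite entropy. -/
structure Valid (c : Channel) : Prop where
  prob : IsProbabilityMeasure c.ref
  meas : ∀ ε, Measurable (c.dens ε)
  pos : ∀ ε t, 0 < c.dens ε t
  int : ∀ ε, Integrable (c.dens ε) c.ref
  int_one : ∀ ε, ∫ t, c.dens ε t ∂c.ref = 1
  int_log : ∀ ε, Integrable (fun t => c.dens ε t * Real.log (c.dens ε t)) c.ref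

/-- Output law given the input. -/
def law (c : Channel) (ε : ℤˣ) : Measure ℝ :=
  c.ref.withDensity fun t => ENNReal.ofReal (c.dens ε t)

/-- Mutual information between the output and an input of mean `m`. -/
def info (c : Channel) (m : ℝ) : ℝ := ∫ t, logGap (c.dens 1 t) (c.dens (-1) t) m ∂c.ref

/-- A channel whose output does not depend on the input. -/
def blank (μ : Measure ℝ) : Channel := ⟨μ, fun _ _ => 1⟩

lemma blank_valid (μ : Measure ℝ) [IsProbabilityMeasure μ] : (blank μ).Valid where
  prob := ‹_›
  meas _ := measurable_const
  pos _ _ := one_pos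
  int _ := integrable_const (μ := μ) (1 : ℝ)
  int_one _ := by simp [blank]
  int_log _ := by simp [blank]

lemma blank_law (μ : Measure ℝ) (ε : ℤˣ) : (blank μ).law ε = μ := by simp [law, blank]

lemma logGap_self (a m : ℝ) : logGap a a m = 0 := by
  have : (1 + m) / 2 * a + (1 - m) / 2 * a = a := by ring
  rw [logGap, this]; ring

lemma blank_info (μ : Measure ℝ) (m : ℝ) : (blank μ).info m = 0 := by
  simp [info, blank, logGap_self]

lemma Valid.isProbabilityMeasure_law {c : Channel} (hc : c.Valid) (ε : ℤˣ) :
    IsProbabilityMeasure (c.law ε) := by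
  constructor
  rw [law, withDensity_apply _ MeasurableSet.univ, setLIntegral_univ,
    ← ofReal_integral_eq_lintegral_ofReal (hc.int ε) (ae_of_all _ fun t => (hc.pos ε t).le),
    hc.int_one, ENNReal.ofReal_one]

/-- Convexity bounds y log y at the mixture from above by its values at the two densities, and y - 1
≤ y log y bounds it from below. -/
lemma Valid.integrable_mix_log {c : Channel} (hc : c.Valid) {m : ℝ} (hm : |m| ≤ 1) :
    Integrable (fun t => ((1 + m) / 2 * c.dens 1 t + (1 - m) / 2 * c.dens (-1) t) *
      Real.log ((1 + m) / 2 * c.dens 1 t + (1 - m) / 2 * c.dens (-1) t)) c.ref := by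
  have := hc.prob
  have m1 := hc.meas 1
  have m2 := hc.meas (-1)
  obtain ⟨h1, h2⟩ := abs_le.1 hm
  refine (((hc.int_log 1).abs.add (hc.int_log (-1)).abs).add (integrable_const 1)).mono'
    (Measurable.aestronglyMeasurable (by fun_prop)) (ae_of_all _ fun t => ?_)
  have p1 := hc.pos 1 t
  have p2 := hc.pos (-1) t
  have hx := mix_pos p1 p2 hm
  have hconv := Real.convexOn_mul_log.2 (Set.mem_Ici.2 p1.le) (Set.mem_Ici.2 p2.le)
    (by linarith : 0 ≤ (1 + m) / 2) (by linarith : 0 ≤ (1 - m) / 2) (by ring)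
  have hlow := Real.self_sub_one_le_mul_log hx.le
  simp only [smul_eq_mul] at hconv
  simp only [Pi.add_apply, Real.norm_eq_abs]
  set A := c.dens 1 t * Real.log (c.dens 1 t)
  set B := c.dens (-1) t * Real.log (c.dens (-1) t)
  have hA : (1 + m) / 2 * A ≤ |A| :=
    (mul_le_mul_of_nonneg_left (le_abs_self A) (by linarith)).trans
      (mul_le_of_le_one_left (abs_nonneg A) (by linarith))
  have hB : (1 - m) / 2 * B ≤ |B| :=
    (mul_le_mul_of_nonneg_left (le_abs_self B) (by linarith)).trans
      (mul_le_of_le_one_left (abs_nonneg B) (by linarith))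
  rw [abs_le]
  constructor <;> linarith [abs_nonneg A, abs_nonneg B]

lemma Valid.integrable_logGap {c : Channel} (hc : c.Valid) {m : ℝ} (hm : |m| ≤ 1) :
    Integrable (fun t => logGap (c.dens 1 t) (c.dens (-1) t) m) c.ref :=
  (((hc.int_log 1).const_mul _).add ((hc.int_log (-1)).const_mul _)).sub (hc.integrable_mix_log hm)

lemma Valid.measurable_info {c : Channel} (hc : c.Valid) : Measurable c.info := by
  have := hc.prob
  have m1 := hc.meas 1
  have m2 := hc.meas (-1)
  refine (StronglyMeasurable.integral_prod_right' (ν := c.ref)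
    (f := fun z : ℝ × ℝ => logGap (c.dens 1 z.2) (c.dens (-1) z.2) z.1) ?_).measurable
  refine Measurable.stronglyMeasurable ?_
  simp only [logGap]
  fun_prop

lemma Valid.abs_info_sub_le {c : Channel} (hc : c.Valid) {m V T : ℝ} (hm : |m| ≤ 1)
    (hV : Integrable (fun t => (c.dens 1 t - c.dens (-1) t) ^ 2) c.ref)
    (hV' : ∫ t, (c.dens 1 t - c.dens (-1) t) ^ 2 ∂c.ref = V)
    (hT : ∀ ε, Integrable (fun t => |c.dens ε t - 1| ^ 3) c.ref)
    (hT' : ∀ ε, ∫ t, |c.dens ε t - 1| ^ 3 ∂c.ref ≤ T) :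
    |c.info m - (1 - m ^ 2) / 8 * V| ≤ 4 * T := by
  rw [info, ← hV', ← integral_const_mul, ← integral_sub (hc.integrable_logGap hm) (hV.const_mul _)]
  have hi := ((hT 1).add (hT (-1))).const_mul 2
  rw [← Real.norm_eq_abs]
  refine (norm_integral_le_of_norm_le hi (ae_of_all _ fun t => ?_)).trans ?_
  · exact abs_logGap_sub_le (hc.pos 1 t) (hc.pos (-1) t) hm
  · rw [integral_const_mul]
    simp only [Pi.add_apply]
    rw [integral_add (hT 1) (hT (-1))]
    linarith [hT' 1, hT' (-1)]

/-- Observing the output of `c` lowers the entropy of weights `u` by the information of `c`. -/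
lemma Valid.integral_massEntropy {c : Channel} (hc : c.Valid) {V : Type} [Fintype V]
    (s : V → ℤˣ) {u : V → ℝ} (hu : ∀ v, 0 ≤ u v) (hS : 0 < ∑ v, u v) :
    ∫ t, massEntropy (fun v => c.dens (s v) t * u v) ∂c.ref =
      massEntropy u - (∑ v, u v) * c.info ((∑ v, sgn (s v) * u v) / ∑ v, u v) := by
  have hs : ∀ v, |sgn (s v)| ≤ 1 := fun v => by
    rcases Int.units_eq_one_or (s v) with h | h <;> simp [h, sgn]
  have hm := abs_sum_mul_div_le_one hu hs
  set S := ∑ v, u v with hSd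
  set m := (∑ v, sgn (s v) * u v) / S with hmd
  have hmS : ∑ v, sgn (s v) * u v = m * S := by rw [hmd, div_mul_cancel₀ _ hS.ne']
  -- Every function on {±1} is affine in the sign, so a weighted sum over labels depends only on the
  -- total mass and the mean of the input.
  have key : ∀ F : ℤˣ → ℝ, ∑ v, F (s v) * u v = S * ((1 + m) / 2 * F 1 + (1 - m) / 2 * F (-1)) := by
    intro F
    have : ∀ v, F (s v) * u v =
        (F 1 + F (-1)) / 2 * u v + (F 1 - F (-1)) / 2 * (sgn (s v) * u v) := by
      intro v
      rcases Int.units_eq_one_or (s v) with h | h <;> simp only [h, sgn] <;> push_cast <;> ring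
    simp_rw [this, Finset.sum_add_distrib, ← Finset.mul_sum, ← hSd, hmS]
    ring
  have hpt : ∀ t, massEntropy (fun v => c.dens (s v) t * u v) =
      (∑ v, c.dens (s v) t * Real.negMulLog (u v)) -
      ((1 + m) / 2 * c.dens 1 t + (1 - m) / 2 * c.dens (-1) t) * Real.negMulLog S -
      S * logGap (c.dens 1 t) (c.dens (-1) t) m := by
    intro t
    rw [massEntropy, key fun ε => c.dens ε t]
    simp_rw [Real.negMulLog_mul, Finset.sum_add_distrib]
    have e := key fun ε => Real.negMulLog (c.dens ε t)
    simp only [mul_comm (Real.negMulLog _) (u _)] at e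
    rw [e, logGap]
    simp only [Real.negMulLog]
    ring
  simp_rw [hpt]
  have i1 : ∀ v, Integrable (fun t => c.dens (s v) t * Real.negMulLog (u v)) c.ref := fun v =>
    (hc.int _).mul_const _
  have i2 : Integrable (fun t => ((1 + m) / 2 * c.dens 1 t + (1 - m) / 2 * c.dens (-1) t) *
      Real.negMulLog S) c.ref :=
    (((hc.int _).const_mul _).add ((hc.int _).const_mul _)).mul_const _
  have i3 : Integrable (fun t => ∑ v, c.dens (s v) t * Real.negMulLog (u v)) c.ref :=
    integrable_finsetSum _ fun v _ => i1 v
  rw [integral_sub (i3.sub' i2) ((hc.integrable_logGap hm).const_mul _), integral_sub i3 i2,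
    integral_finsetSum _ fun v _ => i1 v, integral_const_mul, integral_mul_const,
    integral_add ((hc.int _).const_mul _) ((hc.int _).const_mul _)]
  simp_rw [integral_mul_const, integral_const_mul, hc.int_one]
  rw [massEntropy, ← hSd, info]
  ring_nf

end Channel

/-! ### Independent channels with side information, and the exchange of one channel -/

section Weights

variable {V E β : Type} [Fintype V] [Fintype E] [MeasurableSpace β]

/-- Reference law of the outputs of the channels `C` and of the side information. -/
def refLaw (C : E → Channel) (M : Measure β) : Measure ((E → ℝ) × β) :=
  (Measure.pi fun e => (C e).ref).prod M

/-- Posterior weight of `v`, up to normalisation, given channel outputs and side information. -/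
def weight (C : E → Channel) (s : V → E → ℤˣ) (q : V → β → ℝ) (v : V) (z : (E → ℝ) × β) : ℝ :=
  (∏ e, (C e).dens (s v e) (z.1 e)) * q v z.2

/-- Prior weights given the side information. -/
structure IsPrior (q : V → β → ℝ) : Prop where
  meas : ∀ v, Measurable (q v)
  nonneg : ∀ v b, 0 ≤ q v b
  sum_eq_one : ∀ b, ∑ v, q v b = 1

variable {C : E → Channel} {M : Measure β} [IsProbabilityMeasure M] {s : V → E → ℤˣ}
  {q : V → β → ℝ}

lemma isProbabilityMeasure_refLaw (hC : ∀ e, (C e).Valid) : IsProbabilityMeasure (refLaw C M) := by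
  have := fun e => (hC e).prob
  unfold refLaw; infer_instance

lemma weight_nonneg (hC : ∀ e, (C e).Valid) (hq : IsPrior q) (v : V) (z : (E → ℝ) × β) :
    0 ≤ weight C s q v z :=
  mul_nonneg (Finset.prod_nonneg fun e _ => ((hC e).pos _ _).le) (hq.nonneg v z.2)

lemma sum_weight_pos (hC : ∀ e, (C e).Valid) (hq : IsPrior q) (z : (E → ℝ) × β) :
    0 < ∑ v, weight C s q v z := by
  refine Finset.sum_pos' (fun v _ => weight_nonneg hC hq v z) ?_
  have h : ∃ v, 0 < q v z.2 := by
    by_contra! h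
    have := Finset.sum_nonpos fun v (_ : v ∈ Finset.univ) => h v
    rw [hq.sum_eq_one] at this
    linarith
  obtain ⟨v, hv⟩ := h
  exact ⟨v, Finset.mem_univ v, mul_pos (Finset.prod_pos fun e _ => (hC e).pos _ _) hv⟩

lemma measurable_weight (hC : ∀ e, (C e).Valid) (hq : IsPrior q) (v : V) :
    Measurable (weight C s q v) := by
  have h1 := fun e => (hC e).meas (s v e)
  have h2 := hq.meas v
  unfold weight
  fun_prop

lemma integrable_weight_refLaw (hC : ∀ e, (C e).Valid) (hq : IsPrior q) (v : V) :
    Integrable (weight C s q v) (refLaw C M) := by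
  have := fun e => (hC e).prob
  refine Integrable.mul_prod (Integrable.fintype_prod fun e => (hC e).int (s v e)) ?_
  refine Integrable.of_bound (hq.meas v).aestronglyMeasurable 1 (ae_of_all _ fun b => ?_)
  rw [Real.norm_eq_abs, abs_of_nonneg (hq.nonneg v b), ← hq.sum_eq_one b]
  exact Finset.single_le_sum (f := fun v => q v b) (fun v _ => hq.nonneg v b) (Finset.mem_univ v)

lemma integral_sum_weight_refLaw (hC : ∀ e, (C e).Valid) (hq : IsPrior q) :
    ∫ z, ∑ v, weight C s q v z ∂(refLaw C M) = 1 := by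
  have := fun e => (hC e).prob
  have hqi : ∀ v, Integrable (q v) M := fun v => by
    refine Integrable.of_bound (hq.meas v).aestronglyMeasurable 1 (ae_of_all _ fun b => ?_)
    rw [Real.norm_eq_abs, abs_of_nonneg (hq.nonneg v b), ← hq.sum_eq_one b]
    exact Finset.single_le_sum (f := fun v => q v b) (fun v _ => hq.nonneg v b) (Finset.mem_univ v)
  rw [integral_finsetSum _ fun v _ => integrable_weight_refLaw hC hq v]
  have : ∀ v, ∫ z, weight C s q v z ∂(refLaw C M) = ∫ b, q v b ∂M := by
    intro v
    unfold weight refLaw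
    rw [integral_prod_mul (fun y : E → ℝ => ∏ e, (C e).dens (s v e) (y e)) (q v),
      integral_fintype_prod_eq_prod (fun e => (C e).dens (s v e))]
    simp_rw [(hC _).int_one]
    simp
  simp_rw [this]
  rw [← integral_finsetSum _ fun v _ => hqi v]
  simp_rw [hq.sum_eq_one]
  simp

lemma integrable_sum_weight_mul (hC : ∀ e, (C e).Valid) (hq : IsPrior q)
    {F : (E → ℝ) × β → ℝ} (hF : Measurable F) {c : ℝ} (hc : ∀ z, |F z| ≤ c) :
    Integrable (fun z => (∑ v, weight C s q v z) * F z) (refLaw C M) :=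
  (integrable_finsetSum _ fun v _ => integrable_weight_refLaw hC hq v).mul_bdd (c := c)
    hF.aestronglyMeasurable (ae_of_all _ hc)

/-- The summed weights are the probability density of the observations, so the integral is an
expectation and a uniform bound on `F` passes through it. -/
lemma abs_integral_sum_weight_mul_le (hC : ∀ e, (C e).Valid) (hq : IsPrior q)
    {F : (E → ℝ) × β → ℝ} {c : ℝ} (hc : ∀ z, |F z| ≤ c) :
    |∫ z, (∑ v, weight C s q v z) * F z ∂(refLaw C M)| ≤ c := by
  have hi : Integrable (fun z => ∑ v, weight C s q v z) (refLaw C M) :=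
    integrable_finsetSum _ fun v _ => integrable_weight_refLaw hC hq v
  rw [← Real.norm_eq_abs]
  refine (norm_integral_le_of_norm_le (hi.mul_const c) (ae_of_all _ fun z => ?_)).trans ?_
  · rw [Real.norm_eq_abs, abs_mul, abs_of_pos (sum_weight_pos hC hq z)]
    exact mul_le_mul_of_nonneg_left (hc z) (sum_weight_pos hC hq z).le
  · rw [integral_mul_const, integral_sum_weight_refLaw hC hq, one_mul]

lemma integrable_massEntropy_weight (hC : ∀ e, (C e).Valid) (hq : IsPrior q) :
    Integrable (fun z => massEntropy fun v => weight C s q v z) (refLaw C M) := by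
  have hm := fun v => measurable_weight (s := s) hC hq v
  have hi : Integrable (fun z => ∑ v, weight C s q v z) (refLaw C M) :=
    integrable_finsetSum _ fun v _ => integrable_weight_refLaw hC hq v
  refine (hi.const_mul (Fintype.card V : ℝ)).mono' (Measurable.aestronglyMeasurable ?_)
    (ae_of_all _ fun z => abs_massEntropy_le (fun v => weight_nonneg hC hq v z)
      (sum_weight_pos hC hq z))
  unfold massEntropy
  have := Real.continuous_negMulLog.measurable
  fun_prop

lemma pi_withDensity_ofReal {μ : E → Measure ℝ} [∀ e, IsProbabilityMeasure (μ e)] {f : E → ℝ → ℝ}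
    (hfi : ∀ e, Integrable (f e) (μ e)) (hf : ∀ e t, 0 ≤ f e t)
    [∀ e, IsProbabilityMeasure ((μ e).withDensity fun t => ENNReal.ofReal (f e t))] :
    (Measure.pi fun e => (μ e).withDensity fun t => ENNReal.ofReal (f e t)) =
      (Measure.pi μ).withDensity fun y => ENNReal.ofReal (∏ e, f e (y e)) := by
  refine Measure.pi_eq fun t ht => ?_
  have hi : ∀ e, Integrable ((t e).indicator (f e)) (μ e) := fun e => (hfi e).indicator (ht e)
  have h0 : ∀ e x, 0 ≤ (t e).indicator (f e) x := fun e x =>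
    Set.indicator_nonneg (fun x _ => hf e x) x
  have hpi := MeasurableSet.univ_pi ht
  rw [withDensity_apply _ hpi, ← lintegral_indicator hpi]
  have e1 : ∀ y : E → ℝ, (Set.univ.pi t).indicator (fun y => ENNReal.ofReal (∏ e, f e (y e))) y =
      ENNReal.ofReal (∏ e, (t e).indicator (f e) (y e)) := by
    intro y
    by_cases hy : y ∈ Set.univ.pi t
    · rw [Set.indicator_of_mem hy]
      congr 1
      exact Finset.prod_congr rfl fun e _ => (Set.indicator_of_mem (hy e (Set.mem_univ e)) _).symm
    · rw [Set.indicator_of_notMem hy]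
      simp only [Set.mem_univ_pi, not_forall] at hy
      obtain ⟨e, he⟩ := hy
      rw [Finset.prod_eq_zero (Finset.mem_univ e) (Set.indicator_of_notMem he _),
        ENNReal.ofReal_zero]
  simp_rw [e1]
  rw [← ofReal_integral_eq_lintegral_ofReal (Integrable.fintype_prod hi)
    (ae_of_all _ fun y => Finset.prod_nonneg fun e _ => h0 e _), integral_fintype_prod_eq_prod,
    ENNReal.ofReal_prod_of_nonneg fun e _ => integral_nonneg (h0 e)]
  refine Finset.prod_congr rfl fun e _ => ?_
  rw [withDensity_apply _ (ht e), integral_indicator (ht e),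
    ofReal_integral_eq_lintegral_ofReal (hfi e).integrableOn (ae_of_all _ fun x => hf e x)]

lemma pi_law_prod_eq_withDensity (hC : ∀ e, (C e).Valid) (hq : IsPrior q) {c : ℝ}
    {μ : Measure β} {v : V} (hμ : μ = M.withDensity fun b => ENNReal.ofReal (c * q v b))
    [IsProbabilityMeasure μ] :
    (Measure.pi fun e => (C e).law (s v e)).prod μ =
      (refLaw C M).withDensity fun z => ENNReal.ofReal (c * weight C s q v z) := by
  have := fun e => (hC e).prob
  have := fun e => (hC e).isProbabilityMeasure_law (s v e)
  have h1 := fun e => (hC e).meas (s v e)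
  have h2 := hq.meas v
  unfold Channel.law at *
  subst hμ
  rw [pi_withDensity_ofReal (fun e => (hC e).int (s v e)) fun e t => ((hC e).pos _ t).le,
    prod_withDensity (by fun_prop) (by fun_prop), refLaw]
  congr 1
  ext z
  rw [← ENNReal.ofReal_mul (Finset.prod_nonneg fun e _ => ((hC e).pos _ _).le), weight]
  ring_nf

/-- Expected entropy of `v` given all the observations. -/
def condEntropy (C : E → Channel) (s : V → E → ℤˣ) (q : V → β → ℝ) (M : Measure β) : ℝ :=
  ∫ z, massEntropy (fun v => weight C s q v z) ∂(refLaw C M)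

/-- Posterior mean of the input of channel `e`. -/
def postMean (C : E → Channel) (s : V → E → ℤˣ) (q : V → β → ℝ) (e : E) (z : (E → ℝ) × β) : ℝ :=
  (∑ v, sgn (s v e) * weight C s q v z) / ∑ v, weight C s q v z

lemma abs_sgn_le (ε : ℤˣ) : |sgn ε| ≤ 1 := by
  rcases Int.units_eq_one_or ε with h | h <;> simp [h, sgn]

lemma abs_postMean_le (hC : ∀ e, (C e).Valid) (hq : IsPrior q) (e : E) (z : (E → ℝ) × β) :
    |postMean C s q e z| ≤ 1 :=
  abs_sum_mul_div_le_one (fun v => weight_nonneg hC hq v z) fun _ => abs_sgn_le _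

lemma measurable_postMean (hC : ∀ e, (C e).Valid) (hq : IsPrior q) (e : E) :
    Measurable (postMean C s q e) := by
  have := fun v => measurable_weight (s := s) hC hq v
  unfold postMean
  fun_prop

variable [DecidableEq E]

/-- Overwriting one coordinate by an independent sample replaces its marginal. This isolates the
integral over the output of one channel. -/
lemma map_update_pi (μ : E → Measure ℝ) [∀ e, IsProbabilityMeasure (μ e)] (e : E) (τ : Measure ℝ)
    [IsProbabilityMeasure τ] [∀ i, IsProbabilityMeasure (Function.update μ e τ i)] :
    ((Measure.pi μ).prod τ).map (fun z => Function.update z.1 e z.2) =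
      Measure.pi (Function.update μ e τ) := by
  refine (Measure.pi_eq fun t ht => ?_).symm
  have hmeas : Measurable fun z : (E → ℝ) × ℝ => Function.update z.1 e z.2 := by
    rw [measurable_pi_iff]
    intro i
    by_cases h : i = e
    · subst h; simpa using measurable_snd
    · simp only [Function.update_of_ne h]; fun_prop
  rw [Measure.map_apply hmeas (MeasurableSet.univ_pi ht)]
  have : (fun z : (E → ℝ) × ℝ => Function.update z.1 e z.2) ⁻¹' Set.univ.pi t =
      (Set.univ.pi (Function.update t e Set.univ)) ×ˢ t e := by
    ext ⟨y, x⟩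
    simp only [Set.mem_preimage, Set.mem_univ_pi, Set.mem_prod]
    constructor
    · intro h
      refine ⟨fun i => ?_, by simpa using h e⟩
      by_cases hi : i = e
      · subst hi; simp
      · simpa [Function.update_of_ne hi] using h i
    · rintro ⟨h1, h2⟩ i
      by_cases hi : i = e
      · subst hi; simpa using h2
      · simpa [Function.update_of_ne hi] using h1 i
  rw [this, Measure.prod_prod, Measure.pi_pi, ← Finset.mul_prod_erase _ _ (Finset.mem_univ e),
    ← Finset.mul_prod_erase Finset.univ (fun i => (Function.update μ e τ i) (t i))
      (Finset.mem_univ e)]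
  simp only [Function.update_self, measure_univ, one_mul]
  rw [mul_comm]
  congr 1
  refine Finset.prod_congr rfl fun i hi => ?_
  rw [Function.update_of_ne (Finset.ne_of_mem_erase hi), Function.update_of_ne
    (Finset.ne_of_mem_erase hi)]

lemma map_update_refLaw (hC : ∀ e, (C e).Valid) (e : E) {c : Channel} (hc : c.Valid) :
    ((refLaw C M).prod c.ref).map (fun z => (Function.update z.1.1 e z.2, z.1.2)) =
      refLaw (Function.update C e c) M := by
  have := fun e => (hC e).prob
  have := hc.prob
  have hu : (fun i => (Function.update C e c i).ref) =
      Function.update (fun i => (C i).ref) e c.ref := by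
    ext1 i
    by_cases h : i = e
    · subst h; simp
    · simp [Function.update_of_ne h]
  have : ∀ i, IsProbabilityMeasure (Function.update (fun i => (C i).ref) e c.ref i) := by
    intro i
    by_cases h : i = e
    · subst h; simpa
    · simpa [Function.update_of_ne h] using (hC i).prob
  have hmeas : Measurable fun z : (E → ℝ) × ℝ => Function.update z.1 e z.2 := by
    rw [measurable_pi_iff]
    intro i
    by_cases h : i = e
    · subst h; simpa using measurable_snd
    · simp only [Function.update_of_ne h]; fun_prop
  rw [refLaw, refLaw, hu, ← map_update_pi (fun i => (C i).ref) e c.ref]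
  have hsw : ((Measure.pi fun e => (C e).ref).prod M).prod c.ref =
      ((((Measure.pi fun e => (C e).ref).prod c.ref).prod M)).map
        (fun z => ((z.1.1, z.2), z.1.2)) := by
    refine Measure.ext_prod₃' fun {s t r} hs ht hr => ?_
    rw [Measure.map_apply (by fun_prop) ((hs.prod ht).prod hr), Measure.prod_prod,
      Measure.prod_prod]
    have : (fun z : ((E → ℝ) × ℝ) × β => ((z.1.1, z.2), z.1.2)) ⁻¹' ((s ×ˢ t) ×ˢ r) =
        (s ×ˢ r) ×ˢ t := by
      ext; simp only [Set.mem_preimage, Set.mem_prod]; tauto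
    rw [this, Measure.prod_prod, Measure.prod_prod]
    ring
  rw [hsw, Measure.map_map (by fun_prop) (by fun_prop), ← Measure.map_id (μ := M),
    Measure.map_prod_map _ _ hmeas measurable_id, Measure.map_id]
  rfl

lemma integral_refLaw_update (hC : ∀ e, (C e).Valid) (e : E) {c : Channel} (hc : c.Valid)
    {G : (E → ℝ) × β → ℝ} (hG : Integrable G (refLaw (Function.update C e c) M)) :
    Integrable (fun z => ∫ t, G (Function.update z.1 e t, z.2) ∂c.ref) (refLaw C M) ∧
    ∫ z, G z ∂(refLaw (Function.update C e c) M) =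
      ∫ z, ∫ t, G (Function.update z.1 e t, z.2) ∂c.ref ∂(refLaw C M) := by
  have := hc.prob
  have := isProbabilityMeasure_refLaw (M := M) hC
  have hmeas : Measurable fun z : ((E → ℝ) × β) × ℝ => (Function.update z.1.1 e z.2, z.1.2) := by
    refine Measurable.prodMk ?_ (by fun_prop)
    rw [measurable_pi_iff]
    intro i
    by_cases h : i = e
    · subst h; simpa using measurable_snd
    · simp only [Function.update_of_ne h]; fun_prop
  rw [← map_update_refLaw hC e hc] at hG ⊢
  have hi := (integrable_map_measure hG.1 hmeas.aemeasurable).1 hG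
  refine ⟨hi.integral_prod_left, ?_⟩
  rw [integral_map hmeas.aemeasurable hG.1]
  exact integral_prod _ hi

/-- The slot `e` must be uninformative beforehand, so that installing `c` there multiplies the
weight by one new likelihood and removes none. -/
lemma weight_update (e : E) (hCe : (C e).dens = fun _ _ => 1) (c : Channel) (v : V)
    (z : (E → ℝ) × β) (t : ℝ) :
    weight (Function.update C e c) s q v (Function.update z.1 e t, z.2) =
      c.dens (s v e) t * weight C s q v z := by
  simp only [weight]
  rw [← Finset.mul_prod_erase _ _ (Finset.mem_univ e), ← Finset.mul_prod_erase Finset.univ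
    (fun i => (C i).dens (s v i) (z.1 i)) (Finset.mem_univ e)]
  simp only [Function.update_self, hCe, one_mul]
  rw [mul_assoc]
  congr 2
  refine Finset.prod_congr rfl fun i hi => ?_
  rw [Function.update_of_ne (Finset.ne_of_mem_erase hi), Function.update_of_ne
    (Finset.ne_of_mem_erase hi)]

lemma update_valid (hC : ∀ e, (C e).Valid) (e : E) {c : Channel} (hc : c.Valid) (i : E) :
    (Function.update C e c i).Valid := by
  by_cases h : i = e
  · subst h; simpa
  · simpa [Function.update_of_ne h] using hC i

/-- Chain rule for entropy: given all other observations, channel `e` sees an input whose mean is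
the posterior mean, and `Channel.Valid.integral_massEntropy` gives the entropy it removes. -/
lemma condEntropy_update (hC : ∀ e, (C e).Valid) (hq : IsPrior q) (e : E)
    (hCe : (C e).dens = fun _ _ => 1) {c : Channel} (hc : c.Valid) :
    Integrable (fun z => (∑ v, weight C s q v z) * c.info (postMean C s q e z)) (refLaw C M) ∧
    condEntropy (Function.update C e c) s q M = condEntropy C s q M -
      ∫ z, (∑ v, weight C s q v z) * c.info (postMean C s q e z) ∂(refLaw C M) := by
  have hC' := update_valid hC e hc
  obtain ⟨h1, h2⟩ := integral_refLaw_update hC e hc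
    (integrable_massEntropy_weight (s := s) (M := M) hC' hq)
  have h3 := integrable_massEntropy_weight (s := s) (M := M) hC hq
  simp_rw [weight_update e hCe] at h1 h2
  have h4 : ∀ z : (E → ℝ) × β, _ := fun z => hc.integral_massEntropy (fun v => s v e)
    (u := fun v => weight C s q v z) (fun v => weight_nonneg hC hq v z) (sum_weight_pos hC hq z)
  simp_rw [h4] at h1 h2
  have h5 : Integrable (fun z => (∑ v, weight C s q v z) * c.info (postMean C s q e z))
      (refLaw C M) := by
    refine (h3.sub h1).congr (ae_of_all _ fun z => ?_)
    simp [postMean]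
  refine ⟨h5, ?_⟩
  rw [condEntropy, h2, condEntropy, ← integral_sub h3 h5]
  rfl

lemma condEntropy_update_sub (hC : ∀ e, (C e).Valid) (hq : IsPrior q) (e : E)
    (hCe : (C e).dens = fun _ _ => 1) {c c' : Channel} (hc : c.Valid) (hc' : c'.Valid) :
    condEntropy (Function.update C e c) s q M - condEntropy (Function.update C e c') s q M =
      ∫ z, (∑ v, weight C s q v z) *
        (c'.info (postMean C s q e z) - c.info (postMean C s q e z)) ∂(refLaw C M) := by
  obtain ⟨h1, h2⟩ := condEntropy_update (s := s) (M := M) hC hq e hCe hc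
  obtain ⟨h3, h4⟩ := condEntropy_update (s := s) (M := M) hC hq e hCe hc'
  rw [h2, h4, sub_sub_sub_cancel_left, ← integral_sub h3 h1]
  refine integral_congr_ae (ae_of_all _ fun z => ?_)
  simp only
  ring

/-- `C` with channel `e` made uninformative. -/
def cavity (C : E → Channel) (e : E) : E → Channel :=
  Function.update C e (Channel.blank (Measure.dirac 0))

lemma cavity_valid (hC : ∀ e, (C e).Valid) (e i : E) : (cavity C e i).Valid :=
  update_valid hC e (Channel.blank_valid _) i

lemma cavity_dens (C : E → Channel) (e : E) : (cavity C e e).dens = fun _ _ => 1 := by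
  simp [cavity, Channel.blank]

lemma update_cavity (C : E → Channel) (e : E) (c : Channel) :
    Function.update (cavity C e) e c = Function.update C e c := by
  simp [cavity]

/-- Lindeberg's exchange. When one channel is swapped, both conditional entropies are compared with
that of the same cavity, so the change is an average of differences of `info`. As the bound is
uniform in the mean, nothing about the posterior law is needed. -/
lemma abs_condEntropy_sub_le (hq : IsPrior q) {C' : E → Channel} (hC : ∀ e, (C e).Valid)
    (hC' : ∀ e, (C' e).Valid) {δ : E → ℝ}
    (hδ : ∀ e m, |m| ≤ 1 → |(C' e).info m - (C e).info m| ≤ δ e) :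
    |condEntropy C s q M - condEntropy C' s q M| ≤ ∑ e, δ e := by
  classical
  have key : ∀ S : Finset E, |condEntropy (fun e => if e ∈ S then C e else C' e) s q M -
      condEntropy C' s q M| ≤ ∑ e ∈ S, δ e := by
    intro S
    induction S using Finset.induction_on with
    | empty => simp
    | insert a S ha ih =>
      set D : E → Channel := fun e => if e ∈ S then C e else C' e with hD
      have hDv : ∀ e, (D e).Valid := fun e => by
        simp only [hD]; split_ifs; exacts [hC e, hC' e]
      have e1 : (fun e => if e ∈ insert a S then C e else C' e) =
          Function.update (cavity D a) a (C a) := by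
        rw [update_cavity]
        ext1 e
        by_cases h : e = a
        · subst h; simp
        · simp [h, hD]
      have e2 : D = Function.update (cavity D a) a (C' a) := by
        rw [update_cavity]
        ext1 e
        by_cases h : e = a
        · subst h; simp [hD, ha]
        · simp [h]
      have h1 : |condEntropy (Function.update (cavity D a) a (C a)) s q M -
          condEntropy (Function.update (cavity D a) a (C' a)) s q M| ≤ δ a := by
        rw [condEntropy_update_sub (cavity_valid hDv a) hq a (cavity_dens D a) (hC a) (hC' a)]
        exact abs_integral_sum_weight_mul_le (cavity_valid hDv a) hq fun z =>
          hδ a _ (abs_postMean_le (cavity_valid hDv a) hq a z)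
      rw [← e1, ← e2] at h1
      rw [Finset.sum_insert ha]
      exact (abs_sub_le _ (condEntropy D s q M) _).trans (add_le_add h1 ih)
  simpa using key Finset.univ

end Weights

namespace Channel

lemma sgn_one : sgn 1 = 1 := by simp [sgn]

lemma sgn_neg_one : sgn (-1) = -1 := by simp [sgn]

/-! ### The Bernoulli channel: weak-signal expansion and derivative in a² -/

section Bernoulli

/-- A Bernoulli output which is `1` with probability `P (1 + a ε)` given the input `ε`. -/
def bern (P : unitInterval) (a : ℝ) : Channel where
  ref := bernoulliMeasure 1 0 P
  dens ε t := if t = 1 then 1 + a * sgn ε else 1 - a * (P / (1 - P)) * sgn ε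

variable {P : unitInterval} {a : ℝ}

lemma odds_mem (hP : (P : ℝ) ≤ 1 / 2) : 0 ≤ (P : ℝ) / (1 - P) ∧ (P : ℝ) / (1 - P) ≤ 1 :=
  ⟨div_nonneg P.2.1 (by linarith), (div_le_one (by linarith)).2 (by linarith)⟩

lemma abs_mul_odds_le (hP : (P : ℝ) ≤ 1 / 2) : |a * (P / (1 - P))| ≤ |a| := by
  rw [abs_mul, abs_of_nonneg (odds_mem hP).1]
  exact mul_le_of_le_one_right (abs_nonneg a) (odds_mem hP).2

lemma integral_bern (f : ℝ → ℝ) : ∫ t, f t ∂(bern P a).ref = P * f 1 + (1 - P) * f 0 := by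
  simp [bern, integral_bernoulliMeasure]

lemma abs_mul_sgn (x : ℝ) (ε : ℤˣ) : |x * sgn ε| = |x| := by
  rcases Int.units_eq_one_or ε with rfl | rfl <;> simp [sgn]

lemma bern_valid (hP : (P : ℝ) ≤ 1 / 2) (ha : |a| < 1) : (bern P a).Valid where
  prob := by unfold bern; infer_instance
  meas ε := by
    unfold bern
    exact Measurable.ite (measurableSet_singleton 1) measurable_const measurable_const
  pos ε t := by
    have h1 := abs_le.1 (abs_mul_sgn a ε).le
    have h2 := abs_le.1 ((abs_mul_sgn (a * (P / (1 - P))) ε).le.trans (abs_mul_odds_le hP))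
    simp only [bern]
    split_ifs <;> linarith
  int ε := by unfold bern; exact integrable_bernoulliMeasure _ _ _ _
  int_log ε := by unfold bern; exact integrable_bernoulliMeasure _ _ _ _
  int_one ε := by
    rw [integral_bern]
    have : (1 : ℝ) - P ≠ 0 := by linarith
    simp only [bern, if_true, zero_ne_one, if_false]
    field_simp
    ring

lemma bern_law (hP : (P : ℝ) ≤ 1 / 2) (ha : |a| < 1) {P' : unitInterval} {ε : ℤˣ}
    (h : (P' : ℝ) = P * (1 + a * sgn ε)) : (bern P a).law ε = bernoulliMeasure 1 0 P' := by
  have hv := bern_valid hP ha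
  have hd : Measurable fun t => ENNReal.ofReal ((bern P a).dens ε t) := (hv.meas ε).ennreal_ofReal
  have := hv.prob
  have hP1 : (1 : ℝ) - P ≠ 0 := by linarith
  classical
  ext s hs
  rw [law, withDensity_apply _ hs, ← ofReal_integral_eq_lintegral_ofReal (hv.int ε).integrableOn
    (ae_of_all _ fun t => (hv.pos ε t).le), ← integral_indicator hs, integral_bern,
    ← ofReal_measureReal, bernoulliMeasure_real_apply _ hs]
  congr 1
  have e : (1 : ℝ) - P' = (1 - P) * (1 - a * (P / (1 - P)) * sgn ε) := by
    rw [h]; field_simp; ring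
  by_cases h1 : (1 : ℝ) ∈ s <;> by_cases h0 : (0 : ℝ) ∈ s <;>
    simp [h0, h1, bern, h] <;> linear_combination -e - h

lemma info_bern (m : ℝ) : (bern P a).info m = P * logGap (1 + a) (1 - a) m +
    (1 - P) * logGap (1 + -(a * (P / (1 - P)))) (1 - -(a * (P / (1 - P)))) m := by
  rw [info, integral_bern]
  simp [bern, sgn_one, sgn_neg_one, sub_eq_add_neg]

/-- Here ∫ (f₊ - f₋)² = 4a²P/(1 - P), and replacing P/(1 - P) by P costs the term a²P². With odds r
= P/(1 - P) ≤ 1 the third moment is P|a|³(1 + r²) ≤ 2P|a|³, whence the 8. -/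
lemma abs_info_bern_sub_le (hP : (P : ℝ) ≤ 1 / 2) (ha : |a| < 1) {m : ℝ} (hm : |m| ≤ 1) :
    |(bern P a).info m - (1 - m ^ 2) / 2 * (a ^ 2 * P)| ≤ 8 * (P * |a| ^ 3) + a ^ 2 * P ^ 2 := by
  have hv := bern_valid hP ha
  have hP0 : (0 : ℝ) ≤ P := P.2.1
  have hP1 : (1 : ℝ) - P ≠ 0 := by linarith
  obtain ⟨hr0, hr1⟩ := odds_mem hP
  have hV : ∫ t, ((bern P a).dens 1 t - (bern P a).dens (-1) t) ^ 2 ∂(bern P a).ref =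
      4 * (a ^ 2 * P / (1 - P)) := by
    rw [integral_bern]
    simp only [bern, if_true, zero_ne_one, if_false, sgn_one, sgn_neg_one]
    field_simp
    ring
  have hT : ∀ ε, ∫ t, |(bern P a).dens ε t - 1| ^ 3 ∂(bern P a).ref ≤ 2 * (P * |a| ^ 3) := by
    intro ε
    rw [integral_bern]
    simp only [bern, if_true, zero_ne_one, if_false, add_sub_cancel_left, abs_mul_sgn]
    have e : |1 - a * (P / (1 - P)) * sgn ε - 1| = |a| * (P / (1 - P)) := by
      rw [sub_sub_cancel_left, abs_neg, abs_mul_sgn, abs_mul, abs_of_nonneg hr0]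
    rw [e]
    set r := (P : ℝ) / (1 - P) with hr
    have h1 : (1 - (P : ℝ)) * r = P := by rw [hr]; field_simp
    have h2 : (1 - (P : ℝ)) * (|a| * r) ^ 3 = P * |a| ^ 3 * r ^ 2 := by
      linear_combination |a| ^ 3 * r ^ 2 * h1
    have h3 : P * |a| ^ 3 * r ^ 2 ≤ P * |a| ^ 3 := mul_le_of_le_one_right (by positivity)
      (pow_le_one₀ hr0 hr1)
    linarith
  have hint : ∀ f : ℝ → ℝ, Integrable f (bern P a).ref := fun f =>
    integrable_bernoulliMeasure _ _ _ f
  have h := hv.abs_info_sub_le hm (hint _) hV (fun ε => hint _) hT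
  have hm2 : m ^ 2 ≤ 1 := (sq_le_one_iff_abs_le_one m).2 hm
  have e : a ^ 2 * P / (1 - P) - a ^ 2 * P = a ^ 2 * P ^ 2 / (1 - P) := by field_simp; ring
  have h1 : 0 ≤ a ^ 2 * (P : ℝ) ^ 2 / (1 - P) := div_nonneg (by positivity) (by linarith)
  have h2 : a ^ 2 * (P : ℝ) ^ 2 / (1 - P) ≤ 2 * (a ^ 2 * P ^ 2) := by
    rw [div_le_iff₀ (by linarith)]
    nlinarith [mul_nonneg (sq_nonneg a) (sq_nonneg (P : ℝ))]
  have h3 : |(1 - m ^ 2) / 8 * (4 * (a ^ 2 * P / (1 - P))) - (1 - m ^ 2) / 2 * (a ^ 2 * P)| ≤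
      a ^ 2 * P ^ 2 := by
    have : (1 - m ^ 2) / 8 * (4 * (a ^ 2 * P / (1 - P))) - (1 - m ^ 2) / 2 * (a ^ 2 * P) =
        (1 - m ^ 2) / 2 * (a ^ 2 * P ^ 2 / (1 - P)) := by rw [← e]; ring
    rw [this, abs_of_nonneg (mul_nonneg (by linarith) h1)]
    nlinarith [sq_nonneg m]
  refine (abs_sub_le _ _ _).trans (add_le_add (h.trans (by linarith)) h3)

/-- The derivative of `logGap (1 + a) (1 - a) m` with respect to `a ^ 2`. -/
def gapDeriv (m a : ℝ) : ℝ :=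
  ((1 + m) / 2 * logRatio a + (1 - m) / 2 * logRatio (-a) - m ^ 2 * logRatio (a * m)) / 2

lemma abs_mul_le_of_le_one {m : ℝ} (hm : |m| ≤ 1) (a : ℝ) : |a * m| ≤ |a| := by
  rw [abs_mul]; exact mul_le_of_le_one_right (abs_nonneg a) hm

/-- The derivative combines log (1 + a), log (1 - a) and log (1 + am), the constants cancelling.
Each logarithm contains a factor a, which `logRatio` extracts; so the derivative in a² makes sense
at a = 0 too, as λ = 0 requires. -/
lemma hasDerivAt_logGap {m a : ℝ} (hm : |m| ≤ 1) (ha : |a| < 1) :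
    HasDerivAt (fun x => logGap (1 + x) (1 - x) m) (2 * a * gapDeriv m a) a := by
  obtain ⟨h1, h2⟩ := abs_lt.1 ha
  have hb := (abs_mul_le_of_le_one hm a).trans_lt ha
  have hpos : 0 < 1 + a * m := by linarith [(abs_lt.1 hb).1]
  have k : ∀ {y : ℝ}, y ≠ 0 → HasDerivAt (fun x => x * Real.log x) (Real.log y + 1) y :=
    fun hy => Real.hasDerivAt_mul_log hy
  have d1 := (k (y := 1 + a) (by linarith)).comp a ((hasDerivAt_id a).const_add 1)
  have d2 := (k (y := 1 - a) (by linarith)).comp a ((hasDerivAt_id a).const_sub 1)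
  have d3 := (k (y := 1 + a * m) hpos.ne').comp a (((hasDerivAt_id a).mul_const m).const_add 1)
  have d := ((d1.const_mul ((1 + m) / 2)).add (d2.const_mul ((1 - m) / 2))).sub d3
  have hL1 := mul_logRatio a
  have hL2 := mul_logRatio (-a)
  have hL3 := mul_logRatio (a * m)
  refine (d.congr_deriv ?_).congr_of_eventuallyEq (Eventually.of_forall fun x => ?_)
  · simp only [gapDeriv]
    rw [← sub_eq_add_neg] at hL2
    rw [← hL1, ← hL2, ← hL3]
    ring
  · have : (1 + m) / 2 * (1 + x) + (1 - m) / 2 * (1 - x) = 1 + x * m := by ring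
    simp [logGap, this]

/-- Setting each `logRatio` to 1 leaves (1 - m²)/2, and each replacement costs at most |a|. -/
lemma abs_gapDeriv_sub_le {m a : ℝ} (hm : |m| ≤ 1) (ha : |a| ≤ 1 / 2) :
    |gapDeriv m a - (1 - m ^ 2) / 2| ≤ |a| := by
  obtain ⟨h1, h2⟩ := abs_le.1 hm
  have hm2 : m ^ 2 ≤ 1 := (sq_le_one_iff_abs_le_one m).2 hm
  have e1 := abs_logRatio_sub_one_le ha
  have e2 := abs_logRatio_sub_one_le (x := -a) (by rwa [abs_neg])
  have e3 := (abs_logRatio_sub_one_le (x := a * m) ((abs_mul_le_of_le_one hm a).trans ha)).trans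
    (abs_mul_le_of_le_one hm a)
  rw [abs_neg] at e2
  have e : gapDeriv m a - (1 - m ^ 2) / 2 = ((1 + m) / 2 * (logRatio a - 1) +
      (1 - m) / 2 * (logRatio (-a) - 1) - m ^ 2 * (logRatio (a * m) - 1)) / 2 := by
    rw [gapDeriv]; ring
  rw [e, abs_div, abs_two, div_le_iff₀ two_pos]
  refine (abs_sub _ _).trans ((add_le_add_left (abs_add_le _ _) _).trans ?_)
  rw [abs_mul, abs_mul, abs_mul, abs_of_nonneg (by linarith : 0 ≤ (1 + m) / 2),
    abs_of_nonneg (by linarith : 0 ≤ (1 - m) / 2), abs_of_nonneg (sq_nonneg m)]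
  have k1 := mul_le_mul_of_nonneg_left e1 (by linarith : 0 ≤ (1 + m) / 2)
  have k2 := mul_le_mul_of_nonneg_left e2 (by linarith : 0 ≤ (1 - m) / 2)
  have k3 := mul_le_mul hm2 e3 (abs_nonneg _) zero_le_one
  linarith

lemma continuousAt_gapDeriv {m a : ℝ} (hm : |m| ≤ 1) (ha : |a| < 1) :
    ContinuousAt (fun z : ℝ × ℝ => gapDeriv z.1 z.2) (m, a) := by
  obtain ⟨h1, h2⟩ := abs_lt.1 ha
  have hb := (abs_mul_le_of_le_one hm a).trans_lt ha
  have c1 : ContinuousAt (fun z : ℝ × ℝ => logRatio z.2) (m, a) :=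
    ContinuousAt.comp (f := fun z : ℝ × ℝ => z.2) (continuousAt_logRatio h1) (by fun_prop)
  have c2 : ContinuousAt (fun z : ℝ × ℝ => logRatio (-z.2)) (m, a) :=
    ContinuousAt.comp (f := fun z : ℝ × ℝ => -z.2) (continuousAt_logRatio (by simpa using h2))
      (by fun_prop)
  have c3 : ContinuousAt (fun z : ℝ × ℝ => logRatio (z.2 * z.1)) (m, a) :=
    ContinuousAt.comp (f := fun z : ℝ × ℝ => z.2 * z.1)
      (continuousAt_logRatio (abs_lt.1 hb).1) (by fun_prop)
  unfold gapDeriv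
  fun_prop

/-- The derivative of `(bern P a).info m` with respect to `a ^ 2`. -/
def infoDeriv (P : unitInterval) (m a : ℝ) : ℝ :=
  P * gapDeriv m a + (1 - P) * (P / (1 - P)) ^ 2 * gapDeriv m (-(a * (P / (1 - P))))

lemma hasDerivAt_info_bern (hP : (P : ℝ) ≤ 1 / 2) (ha : |a| < 1) {m : ℝ} (hm : |m| ≤ 1) :
    HasDerivAt (fun x => (bern P x).info m) (2 * a * infoDeriv P m a) a := by
  have h1 := hasDerivAt_logGap hm ha
  have hb : |-(a * (P / (1 - P)))| < 1 := by
    rw [abs_neg]; exact (abs_mul_odds_le hP).trans_lt ha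
  have h2 := (hasDerivAt_logGap hm hb).comp a
    (((hasDerivAt_id a).mul_const ((P : ℝ) / (1 - P))).neg)
  refine (((h1.const_mul (P : ℝ)).add (h2.const_mul (1 - (P : ℝ)))).congr_deriv
    ?_).congr_of_eventuallyEq (Eventually.of_forall fun x => ?_)
  · rw [infoDeriv]; ring
  · simp [info_bern]

/-- The output 1 gives the main term. The output 0 enters with factor (1 - P)(P/(1 - P))² = P²/(1 -
P) ≤ 2P², hence only as an error. -/
lemma abs_infoDeriv_sub_le (hP : (P : ℝ) ≤ 1 / 2) (ha : |a| ≤ 1 / 2) {m : ℝ} (hm : |m| ≤ 1) :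
    |infoDeriv P m a - (1 - m ^ 2) / 2 * P| ≤ P * |a| + 2 * P ^ 2 := by
  have hP0 : (0 : ℝ) ≤ P := P.2.1
  have hP1 : (1 : ℝ) - P ≠ 0 := by linarith
  obtain ⟨hr0, hr1⟩ := odds_mem hP
  have h1 := abs_gapDeriv_sub_le hm ha
  have hb : |-(a * (P / (1 - P)))| ≤ 1 / 2 := by
    rw [abs_neg]; exact (abs_mul_odds_le hP).trans ha
  have h2 := (abs_gapDeriv_sub_le hm hb).trans hb
  have hm2 : m ^ 2 ≤ 1 := (sq_le_one_iff_abs_le_one m).2 hm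
  have h3 : |gapDeriv m (-(a * (P / (1 - P))))| ≤ 1 := by
    rw [abs_le] at h2 ⊢
    constructor <;> nlinarith [sq_nonneg m]
  have h4 : (1 - (P : ℝ)) * (P / (1 - P)) ^ 2 = P ^ 2 / (1 - P) := by field_simp
  have h5 : (P : ℝ) ^ 2 / (1 - P) ≤ 2 * P ^ 2 := by
    rw [div_le_iff₀ (by linarith)]; nlinarith [sq_nonneg (P : ℝ)]
  have h6 : 0 ≤ (P : ℝ) ^ 2 / (1 - P) := div_nonneg (sq_nonneg _) (by linarith)
  have e : infoDeriv P m a - (1 - m ^ 2) / 2 * P = P * (gapDeriv m a - (1 - m ^ 2) / 2) +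
      P ^ 2 / (1 - P) * gapDeriv m (-(a * (P / (1 - P)))) := by
    rw [infoDeriv, h4]; ring
  rw [e]
  refine (abs_add_le _ _).trans ?_
  rw [abs_mul, abs_mul, abs_of_nonneg hP0, abs_of_nonneg h6]
  refine add_le_add (mul_le_mul_of_nonneg_left h1 hP0) ?_
  exact (mul_le_of_le_one_right h6 h3).trans h5

/-- Joint continuity is needed because the posterior mean and the intermediate point of the mean
value theorem move together. -/
lemma continuousAt_infoDeriv (hP : (P : ℝ) ≤ 1 / 2) (ha : |a| < 1) {m : ℝ} (hm : |m| ≤ 1) :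
    ContinuousAt (fun z : ℝ × ℝ => infoDeriv P z.1 z.2) (m, a) := by
  have hb : |-(a * (P / (1 - P)))| < 1 := by
    rw [abs_neg]; exact (abs_mul_odds_le hP).trans_lt ha
  have c1 := continuousAt_gapDeriv hm ha
  have c2 : ContinuousAt (fun z : ℝ × ℝ => gapDeriv z.1 (-(z.2 * (P / (1 - P))))) (m, a) :=
    ContinuousAt.comp (f := fun z : ℝ × ℝ => (z.1, -(z.2 * ((P : ℝ) / (1 - P)))))
      (continuousAt_gapDeriv hm hb) (by fun_prop)
  unfold infoDeriv
  fun_prop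

end Bernoulli

/-! ### The Gaussian channel: weak-signal expansion -/

section Gaussian

/-- Gaussian output with mean `x v ε` and variance `v` given the input `ε`. -/
def gauss (v : ℝ≥0) (x : ℝ) : Channel where
  ref := gaussianReal 0 v
  dens ε t := Real.exp (x * sgn ε * t - x ^ 2 * v / 2)

variable {v : ℝ≥0} {x : ℝ}

lemma sgn_sq (ε : ℤˣ) : sgn ε ^ 2 = 1 := by
  rcases Int.units_eq_one_or ε with rfl | rfl <;> simp [sgn]

lemma integrable_exp_affine (b c : ℝ) :
    Integrable (fun t => Real.exp (b * t - c)) (gaussianReal 0 v) := by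
  simp_rw [Real.exp_sub]
  exact (integrable_exp_mul_gaussianReal b).div_const _

lemma integral_exp_affine (b c : ℝ) :
    ∫ t, Real.exp (b * t - c) ∂(gaussianReal 0 v) = Real.exp (v * b ^ 2 / 2 - c) := by
  simp_rw [Real.exp_sub]
  rw [integral_div]
  congr 1
  have := congrFun (mgf_fun_id_gaussianReal (μ := 0) (v := v)) b
  simpa [mgf] using this

lemma gauss_valid (v : ℝ≥0) (x : ℝ) : (gauss v x).Valid where
  prob := by unfold gauss; infer_instance
  meas ε := by unfold gauss; fun_prop
  pos ε t := Real.exp_pos _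
  int ε := integrable_exp_affine _ _
  int_one ε := by
    change ∫ t, Real.exp (x * sgn ε * t - x ^ 2 * v / 2) ∂(gaussianReal 0 v) = 1
    rw [integral_exp_affine, mul_pow, sgn_sq]
    ring_nf
    simp
  int_log ε := by
    change Integrable (fun t => Real.exp (x * sgn ε * t - x ^ 2 * v / 2) *
      Real.log (Real.exp (x * sgn ε * t - x ^ 2 * v / 2))) (gaussianReal 0 v)
    simp_rw [Real.log_exp]
    refine ((integrable_exp_affine (v := v) (2 * (x * sgn ε)) (x ^ 2 * v)).add
      (integrable_const 1)).mono' (Measurable.aestronglyMeasurable (by fun_prop))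
      (ae_of_all _ fun t => ?_)
    set y := x * sgn ε * t - x ^ 2 * v / 2 with hy
    have e : 2 * (x * sgn ε) * t - x ^ 2 * v = y + y := by rw [hy]; ring
    simp only [Pi.add_apply]
    rw [e, Real.norm_eq_abs, abs_mul, abs_of_pos (Real.exp_pos y)]
    have h1 : |y| ≤ Real.exp y + Real.exp (-y) := by
      rcases abs_cases y with ⟨h, _⟩ | ⟨h, _⟩ <;> rw [h]
      · linarith [Real.add_one_le_exp y, Real.exp_pos (-y)]
      · linarith [Real.add_one_le_exp (-y), Real.exp_pos y]
    refine (mul_le_mul_of_nonneg_left h1 (Real.exp_pos y).le).trans (le_of_eq ?_)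
    rw [mul_add, ← Real.exp_add, ← Real.exp_add, add_neg_cancel, Real.exp_zero]

/-- Exponential tilting of a centred Gaussian shifts its mean and keeps its variance. -/
lemma gauss_law (hv : v ≠ 0) (x : ℝ) (ε : ℤˣ) :
    (gauss v x).law ε = gaussianReal (x * v * sgn ε) v := by
  rw [law, gaussianReal_of_var_ne_zero _ hv]
  change (gaussianReal 0 v).withDensity _ = _
  rw [gaussianReal_of_var_ne_zero _ hv, ← withDensity_mul _ (by fun_prop)
    ((gauss_valid v x).meas ε).ennreal_ofReal]
  congr 1
  ext t
  have hv' : (v : ℝ) ≠ 0 := by exact_mod_cast hv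
  simp only [Pi.mul_apply, gaussianPDF]
  rw [← ENNReal.ofReal_mul (gaussianPDFReal_nonneg _ _ _)]
  congr 1
  simp only [gaussianPDFReal, gauss]
  rw [mul_assoc, ← Real.exp_add]
  congr 2
  field_simp
  linear_combination (x ^ 2 * v ^ 2) * sgn_sq ε

lemma gauss_dens_pow (ε : ℤˣ) (t : ℝ) (k : ℕ) : (gauss v x).dens ε t ^ k =
    Real.exp (k * (x * sgn ε) * t - k * (x ^ 2 * v / 2)) := by
  simp only [gauss]
  rw [← Real.exp_nat_mul]; ring_nf

lemma integrable_gauss_pow (ε : ℤˣ) (k : ℕ) :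
    Integrable (fun t => (gauss v x).dens ε t ^ k) (gauss v x).ref := by
  simp_rw [gauss_dens_pow]
  exact integrable_exp_affine _ _

lemma integral_gauss_pow (ε : ℤˣ) (k : ℕ) :
    ∫ t, (gauss v x).dens ε t ^ k ∂(gauss v x).ref =
      Real.exp (k * (k - 1) / 2 * (x ^ 2 * v)) := by
  simp_rw [gauss_dens_pow]
  change ∫ t, _ ∂(gaussianReal 0 v) = _
  rw [integral_exp_affine]
  congr 1
  linear_combination (k ^ 2 * x ^ 2 * v / 2 : ℝ) * sgn_sq ε

lemma gauss_mul (t : ℝ) :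
    (gauss v x).dens 1 t * (gauss v x).dens (-1) t = Real.exp (-(x ^ 2 * v)) := by
  simp only [gauss, sgn_one, sgn_neg_one]
  rw [← Real.exp_add]; ring_nf

/-- With τ = x²v the product of the two densities is the constant e^(-τ), so ∫ (f₊ - f₋)² = 2e^τ -
2e^(-τ) = 4τ + O(τ²). The third absolute moment is interpolated between the second and the fourth;
`c` is the free parameter of that interpolation. -/
lemma abs_info_gauss_sub_le (h : x ^ 2 * v ≤ 1 / 6) {m : ℝ} (hm : |m| ≤ 1) {c : ℝ} (hc : 0 < c) :
    |(gauss v x).info m - (1 - m ^ 2) / 2 * (x ^ 2 * v)| ≤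
      (x ^ 2 * v) ^ 2 / 2 + 2 * (2 * c * (x ^ 2 * v) + 78 * (x ^ 2 * v) ^ 2 / c) := by
  have hval := gauss_valid v x
  have := hval.prob
  set τ := x ^ 2 * v with hτ
  have hτ0 : 0 ≤ τ := by positivity
  -- The assumption τ ≤ 1/6 keeps kτ in [-1, 1] up to k = 6, the exponent in the fourth moment.
  have hexp : ∀ k : ℝ, |k| ≤ 6 → |Real.exp (k * τ) - 1 - k * τ| ≤ (k * τ) ^ 2 := fun k hk =>
    Real.abs_exp_sub_one_sub_id_le (by rw [abs_mul, abs_of_nonneg hτ0]; nlinarith)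
  have x1 := abs_le.1 (hexp 1 (by norm_num))
  have x3 := abs_le.1 (hexp 3 (by norm_num))
  have x6 := abs_le.1 (hexp 6 (by norm_num))
  have xm := abs_le.1 (hexp (-1) (by norm_num))
  rw [neg_one_mul] at xm
  have i2 := fun ε => integrable_gauss_pow (v := v) (x := x) ε 2
  have i1 := fun ε => hval.int ε
  have i3 := fun ε => integrable_gauss_pow (v := v) (x := x) ε 3
  have i4 := fun ε => integrable_gauss_pow (v := v) (x := x) ε 4
  have n2 := fun ε => integral_gauss_pow (v := v) (x := x) ε 2
  have n3 := fun ε => integral_gauss_pow (v := v) (x := x) ε 3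
  have n4 := fun ε => integral_gauss_pow (v := v) (x := x) ε 4
  rw [← hτ] at n2 n3 n4
  norm_num at n2 n3 n4
  have eV : ∀ t, ((gauss v x).dens 1 t - (gauss v x).dens (-1) t) ^ 2 =
      (gauss v x).dens 1 t ^ 2 + (gauss v x).dens (-1) t ^ 2 - 2 * Real.exp (-τ) := by
    intro t; linear_combination -2 * gauss_mul (v := v) (x := x) t
  have hVi : Integrable (fun t => ((gauss v x).dens 1 t - (gauss v x).dens (-1) t) ^ 2)
      (gauss v x).ref := by
    simp_rw [eV]
    exact ((i2 1).add (i2 (-1))).sub (integrable_const _)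
  have hV : ∫ t, ((gauss v x).dens 1 t - (gauss v x).dens (-1) t) ^ 2 ∂(gauss v x).ref =
      2 * Real.exp τ - 2 * Real.exp (-τ) := by
    simp_rw [eV]
    rw [integral_sub ((i2 1).fun_add (i2 (-1))) (integrable_const _), integral_add (i2 1) (i2 (-1)),
      n2, n2]
    simp
    ring
  -- With z = |y - 1| this is 2z³ ≤ cz² + z⁴/c, with z² and z⁴ expanded into powers of the density,
  -- whose integrals are explicit.
  have e3 : ∀ ε t, |(gauss v x).dens ε t - 1| ^ 3 ≤
      (c * ((gauss v x).dens ε t ^ 2 - 2 * (gauss v x).dens ε t + 1) +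
        ((gauss v x).dens ε t ^ 4 - 4 * (gauss v x).dens ε t ^ 3 + 6 * (gauss v x).dens ε t ^ 2 -
          4 * (gauss v x).dens ε t + 1) / c) / 2 := by
    intro ε t
    set y := (gauss v x).dens ε t
    have h2 : y ^ 2 - 2 * y + 1 = |y - 1| ^ 2 := by rw [sq_abs]; ring
    have h4 : y ^ 4 - 4 * y ^ 3 + 6 * y ^ 2 - 4 * y + 1 = |y - 1| ^ 4 := by
      rw [show |y - 1| ^ 4 = (|y - 1| ^ 2) ^ 2 by ring, sq_abs]; ring
    rw [h2, h4]
    set z := |y - 1|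
    have : (c * z ^ 2 + z ^ 4 / c) / 2 - z ^ 3 = z ^ 2 * (c - z) ^ 2 / (2 * c) := by
      field_simp; ring
    have : 0 ≤ z ^ 2 * (c - z) ^ 2 / (2 * c) := by positivity
    linarith
  have iq : ∀ ε, Integrable (fun t => (gauss v x).dens ε t ^ 2 - 2 * (gauss v x).dens ε t + 1)
      (gauss v x).ref := fun ε =>
    ((i2 ε).sub ((i1 ε).const_mul 2)).add (integrable_const 1)
  have iQ : ∀ ε, Integrable (fun t => (gauss v x).dens ε t ^ 4 - 4 * (gauss v x).dens ε t ^ 3 +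
      6 * (gauss v x).dens ε t ^ 2 - 4 * (gauss v x).dens ε t + 1) (gauss v x).ref := fun ε =>
    ((((i4 ε).sub ((i3 ε).const_mul 4)).add ((i2 ε).const_mul 6)).sub
      ((i1 ε).const_mul 4)).add (integrable_const 1)
  have hbi := fun ε => (((iq ε).const_mul c).add ((iQ ε).div_const c)).div_const 2
  have hTi : ∀ ε, Integrable (fun t => |(gauss v x).dens ε t - 1| ^ 3) (gauss v x).ref := by
    intro ε
    have := hval.meas ε
    refine (hbi ε).mono' (Measurable.aestronglyMeasurable (by fun_prop)) (ae_of_all _ fun t => ?_)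
    rw [Real.norm_eq_abs, abs_of_nonneg (by positivity)]
    exact e3 ε t
  have hT : ∀ ε, ∫ t, |(gauss v x).dens ε t - 1| ^ 3 ∂(gauss v x).ref ≤
      (2 * c * τ + 78 * τ ^ 2 / c) / 2 := by
    intro ε
    refine (integral_mono (hTi ε) (hbi ε) (e3 ε)).trans ?_
    simp only [Pi.add_apply]
    rw [integral_div, integral_add ((iq ε).const_mul c) ((iQ ε).div_const c), integral_const_mul,
      integral_div]
    have q1 : ∫ t, ((gauss v x).dens ε t ^ 2 - 2 * (gauss v x).dens ε t + 1) ∂(gauss v x).ref =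
        Real.exp τ - 1 := by
      rw [integral_add ((i2 ε).sub' ((i1 ε).const_mul 2)) (integrable_const 1),
        integral_sub (i2 ε) ((i1 ε).const_mul 2), integral_const_mul, n2, hval.int_one]
      simp
      ring
    have q2 : ∫ t, ((gauss v x).dens ε t ^ 4 - 4 * (gauss v x).dens ε t ^ 3 +
        6 * (gauss v x).dens ε t ^ 2 - 4 * (gauss v x).dens ε t + 1) ∂(gauss v x).ref =
        Real.exp (6 * τ) - 4 * Real.exp (3 * τ) + 6 * Real.exp τ - 3 := by
      rw [integral_add ((((i4 ε).sub' ((i3 ε).const_mul 4)).fun_add ((i2 ε).const_mul 6)).sub'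
          ((i1 ε).const_mul 4)) (integrable_const 1),
        integral_sub (((i4 ε).sub' ((i3 ε).const_mul 4)).fun_add ((i2 ε).const_mul 6))
          ((i1 ε).const_mul 4),
        integral_add ((i4 ε).sub' ((i3 ε).const_mul 4)) ((i2 ε).const_mul 6),
        integral_sub (i4 ε) ((i3 ε).const_mul 4), integral_const_mul, integral_const_mul,
        integral_const_mul, n2, n3, n4, hval.int_one]
      simp
      ring
    rw [q1, q2]
    have b1 : Real.exp τ - 1 ≤ 2 * τ := by
      have := x1.2
      rw [one_mul] at this
      nlinarith
    -- The terms of order 0 and 1 in τ cancel; the quadratic errors add up to 36 + 4 · 9 + 6 = 78.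
    have b2 : Real.exp (6 * τ) - 4 * Real.exp (3 * τ) + 6 * Real.exp τ - 3 ≤ 78 * τ ^ 2 := by
      have h1 := x1.2
      rw [one_mul] at h1
      nlinarith [x3.1, x6.2]
    have b3 : c * (Real.exp τ - 1) ≤ 2 * c * τ :=
      (mul_le_mul_of_nonneg_left b1 hc.le).trans (le_of_eq (by ring))
    have b4 := div_le_div_of_nonneg_right b2 hc.le
    linarith
  have hmain := hval.abs_info_sub_le hm hVi hV hTi hT
  have hm2 : m ^ 2 ≤ 1 := (sq_le_one_iff_abs_le_one m).2 hm
  have hlast : |(1 - m ^ 2) / 8 * (2 * Real.exp τ - 2 * Real.exp (-τ)) -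
      (1 - m ^ 2) / 2 * τ| ≤ τ ^ 2 / 2 := by
    have : (1 - m ^ 2) / 8 * (2 * Real.exp τ - 2 * Real.exp (-τ)) - (1 - m ^ 2) / 2 * τ =
        (1 - m ^ 2) / 8 * (2 * Real.exp τ - 2 * Real.exp (-τ) - 4 * τ) := by ring
    rw [this, abs_mul, abs_of_nonneg (by linarith : 0 ≤ (1 - m ^ 2) / 8)]
    have hb : |2 * Real.exp τ - 2 * Real.exp (-τ) - 4 * τ| ≤ 4 * τ ^ 2 := by
      rw [one_mul] at x1
      rw [abs_le]; constructor <;> nlinarith [x1.1, x1.2, xm.1, xm.2]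
    calc (1 - m ^ 2) / 8 * |2 * Real.exp τ - 2 * Real.exp (-τ) - 4 * τ| ≤
        1 / 8 * (4 * τ ^ 2) := by gcongr; linarith [sq_nonneg m]
      _ = _ := by ring
  refine (abs_sub_le _ _ _).trans ((add_le_add hmain hlast).trans (le_of_eq ?_))
  ring

end Gaussian

end Channel

/-! ### The two models as families of channels -/

section Model

/-- `M` is the mixture of the laws `L v`, and `q` is the posterior of the label given `B`. Densities
sum to 2ⁿ only almost everywhere; on the exceptional null set `q` is reset to uniform, so that it
sums to one at every point and the weights never all vanish. -/
lemma exists_prior {n : ℕ} {β : Type} [MeasurableSpace β] (L : Label n → Measure β)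
    [∀ v, IsProbabilityMeasure (L v)] : ∃ (M : Measure β) (q : Label n → β → ℝ),
    IsProbabilityMeasure M ∧ IsPrior q ∧
      ∀ v, L v = M.withDensity fun b => ENNReal.ofReal (2 ^ n * q v b) := by
  classical
  have h2 : (2 ^ n : ℝ≥0∞) ≠ 0 := by positivity
  have h2' : (2 ^ n : ℝ≥0∞) ≠ ∞ := by finiteness
  set M : Measure β := (2 ^ n : ℝ≥0∞)⁻¹ • ∑ v, L v with hM
  have hMp : IsProbabilityMeasure M := by
    constructor
    simp [hM, ENNReal.inv_mul_cancel]
  have hac : ∀ v, L v ≪ M := by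
    intro v
    refine Measure.AbsolutelyContinuous.mk fun s _ hs => ?_
    simp only [hM, Measure.smul_apply, Measure.finsetSum_apply, smul_eq_mul, mul_eq_zero,
      Finset.sum_eq_zero_iff, Finset.mem_univ, true_implies] at hs
    exact (hs.resolve_left (ENNReal.inv_ne_zero.2 h2')) v
  have hrn := fun v => Measure.withDensity_rnDeriv_eq (L v) M (hac v)
  have hm := fun v => Measure.measurable_rnDeriv (L v) M
  have hsum : (fun b => ∑ v, (L v).rnDeriv M b) =ᵐ[M] fun _ => 2 ^ n := by
    rw [← withDensity_eq_iff_of_sigmaFinite (by fun_prop) (by fun_prop), withDensity_const]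
    ext s hs
    rw [withDensity_apply _ hs, lintegral_finsetSum _ fun v _ => hm v]
    simp_rw [← withDensity_apply _ hs, hrn]
    simp [hM, ← mul_assoc, ENNReal.mul_inv_cancel h2 h2']
  have hfin : ∀ᵐ b ∂M, ∀ v, (L v).rnDeriv M b < ∞ :=
    ae_all_iff.2 fun v => Measure.rnDeriv_lt_top _ _
  set r : Label n → β → ℝ := fun v b => ((L v).rnDeriv M b).toReal with hr
  have hrm : ∀ v, Measurable (r v) := fun v => (hm v).ennreal_toReal
  have hS : Measurable fun b => ∑ u, r u b := by fun_prop
  refine ⟨M, fun v b => if ∑ u, r u b = 2 ^ n then r v b / 2 ^ n else (2 ^ n)⁻¹, hMp,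
    ⟨fun v => ?_, fun v b => ?_, fun b => ?_⟩, fun v => ?_⟩
  · exact Measurable.ite (hS (measurableSet_singleton _)) ((hrm v).div_const _) measurable_const
  · simp only [hr]; positivity
  · by_cases h : ∑ u, r u b = 2 ^ n
    · simp only [h, if_true]
      rw [← Finset.sum_div, h, div_self (by positivity)]
    · simp [h]
  · conv_lhs => rw [← hrn v]
    refine withDensity_congr_ae ?_
    filter_upwards [hsum, hfin] with b hb hf
    have : ∑ u, r u b = 2 ^ n := by
      simp only [hr]
      rw [← ENNReal.toReal_sum fun v _ => (hf v).ne, hb]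
      simp
    rw [if_pos this, mul_div_cancel₀ _ (by positivity), hr, ENNReal.ofReal_toReal (hf v).ne]

/-- The inputs `v_i v_j` of the edge channels. -/
def edgeSpin {n : ℕ} (v : Label n) (e : Sym2 (Fin n)) : ℤˣ := (e.map v).mul

/-- The probability `d / n`. -/
def edgeProb (n : ℕ) (d : ℝ) : unitInterval := Set.projIcc (0 : ℝ) 1 zero_le_one (d / n)

/-- The channels observed in the sparse graph. -/
def graphChannel (n : ℕ) (d lam : ℝ) (e : Sym2 (Fin n)) : Channel :=
  if e.IsDiag then Channel.blank (Measure.dirac 0)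
  else Channel.bern (edgeProb n d) (lam / Real.sqrt d)

/-- The channels observed in the Gaussian matrix. -/
def gaussChannel (n : ℕ) (lam : ℝ) (e : Sym2 (Fin n)) : Channel :=
  if e.IsDiag then Channel.blank (gaussEntry n lam True 1)
  else Channel.gauss (1 / n) lam

variable {n p : ℕ} {d lam mu : ℝ}

lemma edgeProb_coe (hd : 0 ≤ d) (hn : 2 * d ≤ n) : (edgeProb n d : ℝ) = d / n := by
  have : d / n ∈ Set.Icc (0 : ℝ) 1 :=
    ⟨by positivity, div_le_one_of_le₀ (by linarith) (by positivity)⟩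
  rw [edgeProb, Set.projIcc_of_mem _ this]

lemma edgeProb_le (hd : 0 ≤ d) (hn : 2 * d ≤ n) : (edgeProb n d : ℝ) ≤ 1 / 2 := by
  rw [edgeProb_coe hd hn]
  exact div_le_of_le_mul₀ (by positivity) (by norm_num) (by linarith)

lemma graphChannel_valid (hd : 0 ≤ d) (hn : 2 * d ≤ n) (hl : |lam / Real.sqrt d| < 1)
    (e : Sym2 (Fin n)) : (graphChannel n d lam e).Valid := by
  unfold graphChannel
  split_ifs
  · exact Channel.blank_valid _
  · exact Channel.bern_valid (edgeProb_le hd hn) hl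

lemma gaussChannel_valid (e : Sym2 (Fin n)) : (gaussChannel n lam e).Valid := by
  unfold gaussChannel
  split_ifs
  · exact Channel.blank_valid _
  · exact Channel.gauss_valid _ _

/-- The edge probability factors as d/n · (1 + (λ/√d) ε). As d/n ≤ 1/2 and |λ/√d| < 1 it lies in [0,
1], so the projection in `graphEntry` is the identity. -/
lemma graphChannel_law (hd : 0 < d) (hn : 2 * d ≤ n) (hl : |lam / Real.sqrt d| < 1)
    (e : Sym2 (Fin n)) (ε : ℤˣ) :
    (graphChannel n d lam e).law ε = graphEntry n d lam e.IsDiag ε := by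
  unfold graphChannel graphEntry
  split_ifs
  · exact Channel.blank_law _ _
  · refine Channel.bern_law (edgeProb_le hd.le hn) hl ?_
    have hs : 0 < Real.sqrt d := Real.sqrt_pos.2 hd
    have h1 := (Channel.abs_mul_sgn (lam / Real.sqrt d) ε).trans_lt hl
    have h2 : (d + lam * Real.sqrt d * sgn ε) / n = d / n * (1 + lam / Real.sqrt d * sgn ε) := by
      have : d = Real.sqrt d * Real.sqrt d := (Real.mul_self_sqrt hd.le).symm
      have h3 : d * (lam / Real.sqrt d) = lam * Real.sqrt d := by
        nth_rewrite 1 [this]; field_simp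
      rw [← h3]; ring
    have hP := edgeProb_le hd.le hn
    rw [edgeProb_coe hd.le hn] at hP ⊢
    obtain ⟨l1, l2⟩ := abs_lt.1 h1
    have h0 : 0 ≤ d / n := by positivity
    have : (d + lam * Real.sqrt d * sgn ε) / n ∈ Set.Icc (0 : ℝ) 1 := by
      rw [h2]
      exact ⟨mul_nonneg h0 (by linarith), by nlinarith⟩
    rw [Set.projIcc_of_mem _ this, ← h2]

/-- On the diagonal the input is v_i² = 1, so the entry has the same law for every label and may be
modelled by a blank channel. -/
lemma gaussChannel_law (hn : n ≠ 0) (v : Label n) (e : Sym2 (Fin n)) :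
    (gaussChannel n lam e).law (edgeSpin v e) = gaussEntry n lam e.IsDiag (edgeSpin v e) := by
  unfold gaussChannel
  split_ifs with h
  · have : edgeSpin v e = 1 := by
      induction e with
      | _ i j =>
        rw [Sym2.mk_isDiag_iff] at h
        subst h
        simp [edgeSpin]
    rw [Channel.blank_law, this]
    simp [gaussEntry, h]
  · rw [Channel.gauss_law (by simpa using hn)]
    simp [gaussEntry, h]
    congr 1
    ring

/-- A left inverse of `symMat`: the matrix determines the entries on unordered pairs, so the weights
are functions of what is observed. -/
lemma unsym_symMat (W : Sym2 (Fin n) → ℝ) :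
    (fun e : Sym2 (Fin n) => symMat W (Quot.out e).1 (Quot.out e).2) = W := by
  ext e
  change W (Sym2.mk (Quot.out e).1 (Quot.out e).2) = W e
  congr 1
  exact Quot.out_eq e

variable {C : Sym2 (Fin n) → Channel} {M : Measure (Fin p → Fin n → ℝ)} [IsProbabilityMeasure M]
  {q : Label n → (Fin p → Fin n → ℝ) → ℝ}

/-- Weights as functions of the observed matrices. -/
def obsWeight (C : Sym2 (Fin n) → Channel) (q : Label n → (Fin p → Fin n → ℝ) → ℝ) (v : Label n)
    (o : Obs n p) : ℝ :=
  weight C edgeSpin q v (fun e => o.1 (Quot.out e).1 (Quot.out e).2, o.2)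

lemma obsWeight_symMat (v : Label n) (z : (Sym2 (Fin n) → ℝ) × (Fin p → Fin n → ℝ)) :
    obsWeight C q v (Prod.map symMat id z) = weight C edgeSpin q v z := by
  simp only [obsWeight, Prod.map_fst, Prod.map_snd, id]
  rw [unsym_symMat]

lemma measurable_obsWeight (hC : ∀ e, (C e).Valid) (hq : IsPrior q) (v : Label n) :
    Measurable (obsWeight C q v) :=
  (measurable_weight hC hq v).comp (by fun_prop)

lemma map_symMat_prod_eq_withDensity (hC : ∀ e, (C e).Valid) (hq : IsPrior q) {v : Label n}
    {μ : Measure (Fin p → Fin n → ℝ)} [IsProbabilityMeasure μ]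
    (hμ : μ = M.withDensity fun b => ENNReal.ofReal (2 ^ n * q v b)) :
    ((Measure.pi fun e => (C e).law (edgeSpin v e)).map symMat).prod μ =
      ((refLaw C M).map (Prod.map symMat id)).withDensity
        fun o => ENNReal.ofReal (2 ^ n * obsWeight C q v o) := by
  have := fun e => (hC e).isProbabilityMeasure_law (edgeSpin v e)
  have hf : Measurable (Prod.map (symMat (n := n)) (id : (Fin p → Fin n → ℝ) → _)) :=
    measurable_symMat.prodMap measurable_id
  have hw := measurable_obsWeight hC hq v
  conv_lhs => rw [← Measure.map_id (μ := μ)]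
  rw [Measure.map_prod_map _ _ measurable_symMat measurable_id,
    pi_law_prod_eq_withDensity hC hq hμ]
  ext s hs
  rw [Measure.map_apply hf hs, withDensity_apply _ (hf hs), withDensity_apply _ hs,
    setLIntegral_map hs (by fun_prop) hf]
  simp_rw [obsWeight_symMat]

lemma toReal_mutualInfo_model (hC : ∀ e, (C e).Valid) (hq : IsPrior q)
    {A : Label n → Measure (Fin n → Fin n → ℝ)} {B : Label n → Measure (Fin p → Fin n → ℝ)}
    [∀ v, IsProbabilityMeasure (A v)] [∀ v, IsProbabilityMeasure (B v)]
    (hA : ∀ v, A v = (Measure.pi fun e => (C e).law (edgeSpin v e)).map symMat)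
    (hB : ∀ v, B v = M.withDensity fun b => ENNReal.ofReal (2 ^ n * q v b)) :
    (mutualInfo (jointLaw fun v => (A v).prod (B v))).toReal =
      n * Real.log 2 - condEntropy C edgeSpin q M := by
  have hf : Measurable (Prod.map (symMat (n := n)) (id : (Fin p → Fin n → ℝ) → _)) :=
    measurable_symMat.prodMap measurable_id
  have hm := measurable_obsWeight hC hq
  rw [toReal_mutualInfo_jointLaw (ρ := (refLaw C M).map (Prod.map symMat id))
    (w := obsWeight C q) hm (fun v o => weight_nonneg hC hq v _) (fun o => sum_weight_pos hC hq _)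
    (fun v => by rw [hA v]; exact map_symMat_prod_eq_withDensity hC hq (hB v)),
    integral_map hf.aemeasurable]
  · simp_rw [obsWeight_symMat]; rfl
  · refine Measurable.aestronglyMeasurable ?_
    have := Real.continuous_negMulLog.measurable
    unfold massEntropy
    fun_prop

lemma mmse_model (hC : ∀ e, (C e).Valid) (hq : IsPrior q)
    {A : Label n → Measure (Fin n → Fin n → ℝ)} {B : Label n → Measure (Fin p → Fin n → ℝ)}
    [∀ v, IsProbabilityMeasure (A v)] [∀ v, IsProbabilityMeasure (B v)]
    (hA : ∀ v, A v = (Measure.pi fun e => (C e).law (edgeSpin v e)).map symMat)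
    (hB : ∀ v, B v = M.withDensity fun b => ENNReal.ofReal (2 ^ n * q v b)) :
    mmse (jointLaw fun v => (A v).prod (B v)) = ((n : ℝ) ^ 2)⁻¹ * ∑ i, ∑ j,
      (1 - ∫ z, (∑ v, weight C edgeSpin q v z) * postMean C edgeSpin q s(i, j) z ^ 2
        ∂(refLaw C M)) := by
  have hf : Measurable (Prod.map (symMat (n := n)) (id : (Fin p → Fin n → ℝ) → _)) :=
    measurable_symMat.prodMap measurable_id
  have hm := measurable_obsWeight hC hq
  rw [mmse_jointLaw (ρ := (refLaw C M).map (Prod.map symMat id))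
    (w := obsWeight C q) hm (fun v o => weight_nonneg hC hq v _) (fun o => sum_weight_pos hC hq _)
    (fun v => by rw [hA v]; exact map_symMat_prod_eq_withDensity hC hq (hB v))]
  congr 1
  refine Finset.sum_congr rfl fun i _ => Finset.sum_congr rfl fun j _ => ?_
  rw [integral_map hf.aemeasurable (Measurable.aestronglyMeasurable (by fun_prop))]
  congr 1
  refine integral_congr_ae (ae_of_all _ fun z => ?_)
  simp_rw [obsWeight_symMat, postMean]
  have hS := (sum_weight_pos (s := edgeSpin) hC hq z).ne'
  have : ∀ v : Label n, sgn (edgeSpin v s(i, j)) = sgn (v i) * sgn (v j) := by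
    intro v; simp [edgeSpin, sgn]
  simp_rw [this]
  field_simp

/-- The side information `B` comes with weights that serve every choice of the edge channels. -/
lemma exists_model (n p : ℕ) (mu : ℝ) : ∃ (M : Measure (Fin p → Fin n → ℝ))
    (q : Label n → (Fin p → Fin n → ℝ) → ℝ), IsProbabilityMeasure M ∧ IsPrior q ∧
    (∀ lam : ℝ, n ≠ 0 → gaussInfo n p lam mu =
      n * Real.log 2 - condEntropy (gaussChannel n lam) edgeSpin q M) ∧
    ∀ d lam : ℝ, 0 < d → 2 * d ≤ n → |lam / Real.sqrt d| < 1 →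
      graphInfo n p d lam mu = n * Real.log 2 - condEntropy (graphChannel n d lam) edgeSpin q M ∧
      mmse (graphModel n p d lam mu) = ((n : ℝ) ^ 2)⁻¹ * ∑ i, ∑ j,
        (1 - ∫ z, (∑ v, weight (graphChannel n d lam) edgeSpin q v z) *
          postMean (graphChannel n d lam) edgeSpin q s(i, j) z ^ 2
            ∂(refLaw (graphChannel n d lam) M)) := by
  obtain ⟨M, q, hM, hq, hB⟩ := exists_prior (n := n) (covLaw p mu)
  refine ⟨M, q, hM, hq, fun lam hn => ?_, fun d lam hd hn hl => ?_⟩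
  · refine toReal_mutualInfo_model gaussChannel_valid hq (fun v => ?_) hB
    rw [gaussLaw]
    congr 2
    ext1 e
    exact (gaussChannel_law hn v e).symm
  · have hA : ∀ v : Label n, graphLaw d lam v =
        (Measure.pi fun e => (graphChannel n d lam e).law (edgeSpin v e)).map symMat := by
      intro v
      rw [graphLaw]
      congr 2
      ext1 e
      exact (graphChannel_law hd hn hl e _).symm
    exact ⟨toReal_mutualInfo_model (graphChannel_valid hd.le hn hl) hq hA hB,
      mmse_model (graphChannel_valid hd.le hn hl) hq hA hB⟩

end Model

/-! ### Derivatives with respect to the square of a parameter -/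

/-- The last alternative keeps `b` on the same side of 0 as a nonzero `a`, so that b² ≠ a² and no
point between them is 0. -/
lemma eventually_near {a : ℝ} (ha : |a| < 1 / 2) :
    ∀ᶠ b in 𝓝[≠] a, b ≠ a ∧ |b| < 1 / 2 ∧ (a = 0 ∨ |b - a| < |a|) := by
  have h1 : ∀ᶠ b in 𝓝[≠] a, b ≠ a := eventually_mem_nhdsWithin
  have h2 : ∀ᶠ b in 𝓝 a, |b| < 1 / 2 := continuous_abs.continuousAt.eventually_lt_const ha
  have h3 : ∀ᶠ b in 𝓝 a, a = 0 ∨ |b - a| < |a| := by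
    rcases eq_or_ne a 0 with rfl | h
    · simp
    · filter_upwards [Metric.ball_mem_nhds a (abs_pos.2 h)] with b hb
      exact Or.inr hb
  filter_upwards [h1, h2.filter_mono nhdsWithin_le_nhds, h3.filter_mono nhdsWithin_le_nhds]
    with b k1 k2 k3
  exact ⟨k1, k2, k3⟩

lemma sq_sub_sq_ne_zero {a b : ℝ} (hne : b ≠ a) (h : a = 0 ∨ |b - a| < |a|) :
    b ^ 2 - a ^ 2 ≠ 0 := by
  have h1 : b - a ≠ 0 := sub_ne_zero.2 hne
  have h2 : b + a ≠ 0 := by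
    intro h0
    rcases h with rfl | h
    · exact hne (by linarith)
    · have : b - a = -2 * a := by linarith
      rw [this, abs_mul] at h
      norm_num at h
      linarith [abs_nonneg a]
  rw [sq_sub_sq]
  exact mul_ne_zero h2 h1

lemma HasDerivSqAt.comp_div {F : ℝ → ℝ} {D c x : ℝ} (hc : c ≠ 0) (h : HasDerivSqAt F D (x / c)) :
    HasDerivSqAt (fun θ => F (θ / c)) (D / c ^ 2) x := by
  have hmap : Tendsto (fun θ : ℝ => θ / c) (𝓝[≠] x) (𝓝[≠] (x / c)) := by
    refine tendsto_nhdsWithin_of_tendsto_nhds_of_eventually_within _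
      ((by fun_prop : Continuous fun θ : ℝ => θ / c).tendsto' x _ rfl |>.mono_left
        nhdsWithin_le_nhds) ?_
    filter_upwards [self_mem_nhdsWithin] with θ hθ
    intro h0
    exact hθ ((div_left_inj' hc).1 h0)
  refine ((h.comp hmap).div_const (c ^ 2)).congr fun θ => ?_
  simp only [Function.comp]
  rw [div_pow, div_pow, ← sub_div, div_div_eq_mul_div, div_right_comm, mul_div_assoc]
  rw [div_self (pow_ne_zero 2 hc), mul_one]

lemma HasDerivSqAt.congr_of_eventuallyEq {F G : ℝ → ℝ} {D x : ℝ} (h : HasDerivSqAt F D x)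
    (hFG : G =ᶠ[𝓝 x] F) : HasDerivSqAt G D x := by
  refine Tendsto.congr' ?_ h
  filter_upwards [hFG.filter_mono nhdsWithin_le_nhds] with θ hθ
  rw [hθ, hFG.eq_of_nhds]

namespace Channel

/-- Cauchy's mean value theorem against x². The factor 2ξ is common to both derivatives and cancels
because ξ ≠ 0: either a = 0 and ξ lies strictly between 0 and b, or |ξ - a| < |a|. -/
lemma exists_info_bern_sub_eq {P : unitInterval} (hP : (P : ℝ) ≤ 1 / 2) {a b : ℝ}
    (ha : |a| < 1 / 2) (hb : |b| < 1 / 2) (hne : b ≠ a) (h : a = 0 ∨ |b - a| < |a|) {m : ℝ}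
    (hm : |m| ≤ 1) : ∃ ξ, |ξ - a| ≤ |b - a| ∧ |ξ| < 1 / 2 ∧
      (bern P b).info m - (bern P a).info m = (b ^ 2 - a ^ 2) * infoDeriv P m ξ := by
  have hd : ∀ x ∈ Set.Icc (min a b) (max a b), HasDerivAt (fun x => (bern P x).info m)
      (2 * x * infoDeriv P m x) x := by
    intro x hx
    refine hasDerivAt_info_bern hP ?_ hm
    rw [abs_lt] at *
    rw [Set.mem_Icc, min_le_iff, le_max_iff] at hx
    rcases hx with ⟨h1 | h1, h2 | h2⟩ <;> constructor <;> linarith [ha.1, ha.2, hb.1, hb.2]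
  have hq : ∀ x : ℝ, HasDerivAt (fun x : ℝ => x ^ 2) (2 * x) x := fun x => by
    simpa using hasDerivAt_pow 2 x
  have hlt : min a b < max a b := min_lt_max.2 hne.symm
  obtain ⟨c, hc, hce⟩ := exists_ratio_hasDerivAt_eq_ratio_slope (fun x => (bern P x).info m)
    (fun x => 2 * x * infoDeriv P m x) hlt
    (fun x hx => (hd x hx).continuousAt.continuousWithinAt)
    (fun x hx => hd x (Set.Ioo_subset_Icc_self hx)) (fun x => x ^ 2) (fun x => 2 * x)
    (by fun_prop) (fun x _ => hq x)
  have hca : |c - a| < |b - a| := by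
    rcases le_total a b with hab | hab
    · rw [min_eq_left hab, max_eq_right hab] at hc
      rw [abs_of_pos (by linarith [hc.1]), abs_of_nonneg (by linarith)]; linarith [hc.2]
    · rw [min_eq_right hab, max_eq_left hab] at hc
      rw [abs_of_neg (by linarith [hc.2]), abs_of_nonpos (by linarith)]; linarith [hc.1]
  have hcb : |c| < 1 / 2 := by
    rw [abs_lt] at *
    rcases le_total a b with hab | hab
    · rw [min_eq_left hab, max_eq_right hab] at hc
      constructor <;> linarith [hc.1, hc.2, ha.1, hb.2]
    · rw [min_eq_right hab, max_eq_left hab] at hc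
      constructor <;> linarith [hc.1, hc.2, hb.1, ha.2]
  have hc0 : c ≠ 0 := by
    rintro rfl
    rcases h with rfl | h
    · rcases le_total 0 b with hab | hab
      · rw [min_eq_left hab] at hc; exact lt_irrefl _ hc.1
      · rw [max_eq_left hab] at hc; exact lt_irrefl _ hc.2
    · rw [zero_sub, abs_neg] at hca; linarith
  refine ⟨c, hca.le, hcb, ?_⟩
  have key : ((bern P (max a b)).info m - (bern P (min a b)).info m) =
      ((max a b) ^ 2 - (min a b) ^ 2) * infoDeriv P m c := by
    have h2c : 2 * c ≠ 0 := mul_ne_zero two_ne_zero hc0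
    apply mul_right_cancel₀ h2c
    rw [← hce]; ring
  rcases le_total a b with hab | hab
  · rwa [min_eq_left hab, max_eq_right hab] at key
  · rw [min_eq_right hab, max_eq_left hab] at key
    linear_combination -key

lemma abs_infoDeriv_le {P : unitInterval} (hP : (P : ℝ) ≤ 1 / 2) {a m : ℝ} (ha : |a| ≤ 1 / 2)
    (hm : |m| ≤ 1) : |infoDeriv P m a| ≤ 2 := by
  have h := abs_le.1 (abs_infoDeriv_sub_le hP ha hm)
  have hP0 : (0 : ℝ) ≤ P := P.2.1
  have hm2 : m ^ 2 ≤ 1 := (sq_le_one_iff_abs_le_one m).2 hm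
  have h1 : (P : ℝ) * |a| ≤ 1 / 2 * (1 / 2) := by gcongr
  have h2 : (P : ℝ) ^ 2 ≤ (1 / 2) ^ 2 := by gcongr
  have h3 : 0 ≤ (1 - m ^ 2) / 2 * (P : ℝ) := mul_nonneg (by linarith) hP0
  have h4 : (1 - m ^ 2) / 2 * (P : ℝ) ≤ 1 / 2 * (1 / 2) := by
    gcongr; linarith [sq_nonneg m]
  rw [abs_le]
  constructor <;> linarith [h.1, h.2]

end Channel

/-! ### Derivative of the conditional entropy along the Bernoulli family -/

section Family

variable {V E β : Type} [Fintype V] [Fintype E] [MeasurableSpace β] {s : V → E → ℤˣ}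
  {q : V → β → ℝ}

lemma tendsto_weight {l : Filter ℝ} {C : ℝ → E → Channel} {C₀ : E → Channel}
    (h : ∀ e ε t, Tendsto (fun b => (C b e).dens ε t) l (𝓝 ((C₀ e).dens ε t))) (v : V)
    (z : (E → ℝ) × β) :
    Tendsto (fun b => weight (C b) s q v z) l (𝓝 (weight C₀ s q v z)) :=
  (tendsto_finsetProd _ fun e _ => h e _ _).mul_const _

lemma tendsto_postMean {l : Filter ℝ} {C : ℝ → E → Channel} {C₀ : E → Channel}
    (h : ∀ e ε t, Tendsto (fun b => (C b e).dens ε t) l (𝓝 ((C₀ e).dens ε t)))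
    (hC₀ : ∀ e, (C₀ e).Valid) (hq : IsPrior q) (e : E) (z : (E → ℝ) × β) :
    Tendsto (fun b => postMean (C b) s q e z) l (𝓝 (postMean C₀ s q e z)) :=
  (tendsto_finsetSum _ fun v _ => (tendsto_weight h v z).const_mul _).div
    (tendsto_finsetSum _ fun v _ => tendsto_weight h v z) (sum_weight_pos hC₀ hq z).ne'

/-- Bounded densities bound the weights pointwise, which supplies the dominating constant for the
limit under the integral. -/
lemma sum_weight_le {C : E → Channel} {K : ℝ} (hC : ∀ e, (C e).Valid)
    (hK : ∀ e ε t, (C e).dens ε t ≤ K) (hq : IsPrior q) (z : (E → ℝ) × β) :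
    ∑ v, weight C s q v z ≤ K ^ Fintype.card E := by
  calc ∑ v, weight C s q v z ≤ ∑ v, K ^ Fintype.card E * q v z.2 := by
        refine Finset.sum_le_sum fun v _ => mul_le_mul_of_nonneg_right ?_ (hq.nonneg v z.2)
        exact (Finset.prod_le_prod (fun e _ => ((hC e).pos _ _).le) fun e _ => hK e _ _).trans
          (by simp)
    _ = K ^ Fintype.card E := by rw [← Finset.mul_sum, hq.sum_eq_one, mul_one]

variable [DecidableEq E] {T : E → Prop} [DecidablePred T] {P : unitInterval}
  {M : Measure β} [IsProbabilityMeasure M]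

/-- The channel `bern P b` on the inputs in `T`, and nothing on the others. -/
def bernFamily (T : E → Prop) [DecidablePred T] (P : unitInterval) (b : ℝ) (e : E) : Channel :=
  if T e then Channel.bern P b else Channel.blank (Measure.dirac 0)

lemma bernFamily_valid (hP : (P : ℝ) ≤ 1 / 2) {b : ℝ} (hb : |b| < 1 / 2) (e : E) :
    (bernFamily T P b e).Valid := by
  unfold bernFamily
  split_ifs
  · exact Channel.bern_valid hP (hb.trans (by norm_num))
  · exact Channel.blank_valid _

lemma bern_dens_le (hP : (P : ℝ) ≤ 1 / 2) {b : ℝ} (hb : |b| < 1 / 2) (ε : ℤˣ) (t : ℝ) :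
    (Channel.bern P b).dens ε t ≤ 2 := by
  have h1 := abs_le.1 (Channel.abs_mul_sgn b ε).le
  have h2 := abs_le.1 ((Channel.abs_mul_sgn (b * (P / (1 - P))) ε).le.trans
    (Channel.abs_mul_odds_le hP))
  simp only [Channel.bern]
  split_ifs <;> linarith

lemma continuous_bern_dens (ε : ℤˣ) (t : ℝ) :
    Continuous fun b => (Channel.bern P b).dens ε t := by
  simp only [Channel.bern]
  split_ifs <;> fun_prop

/-- The derivative with respect to `a ^ 2` of the information in channel `e`. -/
def edgeDeriv (T : E → Prop) [DecidablePred T] (P : unitInterval) (a : ℝ) (s : V → E → ℤˣ)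
    (q : V → β → ℝ) (M : Measure β) (e : E) : ℝ :=
  if T e then ∫ z, (∑ v, weight (cavity (bernFamily T P a) e) s q v z) *
    Channel.infoDeriv P (postMean (cavity (bernFamily T P a) e) s q e z) a
      ∂(refLaw (cavity (bernFamily T P a) e) M)
  else 0

/-- Channel parameter `b` on `S` and `a` elsewhere. -/
def hybrid (T : E → Prop) [DecidablePred T] (P : unitInterval) (a b : ℝ) (S : Finset E) (e : E) :
    Channel :=
  if e ∈ S then bernFamily T P b e else bernFamily T P a e

lemma hybrid_valid (hP : (P : ℝ) ≤ 1 / 2) {a b : ℝ} (ha : |a| < 1 / 2) (hb : |b| < 1 / 2)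
    (S : Finset E) (e : E) : (hybrid T P a b S e).Valid := by
  unfold hybrid
  split_ifs
  exacts [bernFamily_valid hP hb e, bernFamily_valid hP ha e]

/-- The reference law of `bern` depends on `P` alone, so all values of `b` share one measure and
dominated convergence applies. -/
lemma cavity_hybrid_ref (a b : ℝ) (S : Finset E) (e i : E) :
    (cavity (hybrid T P a b S) e i).ref = (cavity (bernFamily T P a) e i).ref := by
  by_cases h : i = e
  · subst h; simp [cavity]
  · simp only [cavity, Function.update_of_ne h, hybrid, bernFamily]
    split_ifs <;> rfl

lemma cavity_hybrid_dens_le (hP : (P : ℝ) ≤ 1 / 2) {a b : ℝ} (ha : |a| < 1 / 2)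
    (hb : |b| < 1 / 2) (S : Finset E) (e i : E) (ε : ℤˣ) (t : ℝ) :
    (cavity (hybrid T P a b S) e i).dens ε t ≤ 2 := by
  by_cases h : i = e
  · subst h; simp [cavity, Channel.blank]
  · simp only [cavity, Function.update_of_ne h, hybrid, bernFamily]
    split_ifs
    · exact bern_dens_le hP hb ε t
    · simp [Channel.blank]
    · exact bern_dens_le hP ha ε t
    · simp [Channel.blank]

lemma tendsto_cavity_hybrid_dens (a : ℝ) (S : Finset E) (e i : E) (ε : ℤˣ) (t : ℝ) :
    Tendsto (fun b => (cavity (hybrid T P a b S) e i).dens ε t) (𝓝[≠] a)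
      (𝓝 ((cavity (bernFamily T P a) e i).dens ε t)) := by
  by_cases h : i = e
  · subst h; simp [cavity]
  · simp only [cavity, Function.update_of_ne h, hybrid, bernFamily]
    split_ifs
    · exact (continuous_bern_dens ε t).continuousAt.tendsto.mono_left nhdsWithin_le_nhds
    all_goals exact tendsto_const_nhds

/-- The difference quotient for moving channel `e` alone is minus the expectation of `infoDeriv` at
an intermediate point. The channels in `S` already sit at `b`, but their densities tend to those at
`a`, so the limit does not depend on `S`. -/
lemma tendsto_hybrid_step (hP : (P : ℝ) ≤ 1 / 2) {a : ℝ} (ha : |a| < 1 / 2) (hq : IsPrior q)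
    (S : Finset E) {e : E} (heS : e ∉ S) :
    Tendsto (fun b => (condEntropy (hybrid T P a b (insert e S)) s q M -
        condEntropy (hybrid T P a b S) s q M) / (b ^ 2 - a ^ 2)) (𝓝[≠] a)
      (𝓝 (-edgeDeriv T P a s q M e)) := by
  have e1 : ∀ b, hybrid T P a b (insert e S) =
      Function.update (cavity (hybrid T P a b S) e) e (bernFamily T P b e) := by
    intro b
    rw [update_cavity]
    ext1 i
    by_cases h : i = e
    · subst h; simp [hybrid]
    · simp [hybrid, h]
  have e2 : ∀ b, hybrid T P a b S =
      Function.update (cavity (hybrid T P a b S) e) e (bernFamily T P a e) := by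
    intro b
    rw [update_cavity]
    ext1 i
    by_cases h : i = e
    · subst h; simp [hybrid, heS]
    · simp [h]
  by_cases hT : T e
  swap
  · have h0 : ∀ b, hybrid T P a b (insert e S) = hybrid T P a b S := by
      intro b
      rw [e1 b]
      conv_rhs => rw [e2 b]
      simp [bernFamily, hT]
    simp [h0, edgeDeriv, hT]
  set G : ℝ → E → Channel := fun b => cavity (hybrid T P a b S) e with hG
  set G₀ := cavity (bernFamily T P a) e with hG₀
  have hG₀v : ∀ i, (G₀ i).Valid := cavity_valid (bernFamily_valid hP ha) e
  have hGv : ∀ {b}, |b| < 1 / 2 → ∀ i, (G b i).Valid := fun hb =>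
    cavity_valid (hybrid_valid hP ha hb S) e
  have href : ∀ b, refLaw (G b) M = refLaw G₀ M := by
    intro b
    simp only [refLaw]
    congr 2
    ext1 i
    exact cavity_hybrid_ref a b S e i
  have hbern : ∀ b, bernFamily T P b e = Channel.bern P b := fun b => by simp [bernFamily, hT]
  have hv : ∀ {b}, |b| < 1 / 2 → (Channel.bern P b).Valid := fun hb =>
    Channel.bern_valid hP (hb.trans (by norm_num))
  set F : ℝ → (E → ℝ) × β → ℝ := fun b z => (∑ v, weight (G b) s q v z) *
    (((Channel.bern P b).info (postMean (G b) s q e z) -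
      (Channel.bern P a).info (postMean (G b) s q e z)) / (b ^ 2 - a ^ 2)) with hF
  have hdiff : ∀ᶠ b in 𝓝[≠] a, -∫ z, F b z ∂(refLaw G₀ M) =
      (condEntropy (hybrid T P a b (insert e S)) s q M -
        condEntropy (hybrid T P a b S) s q M) / (b ^ 2 - a ^ 2) := by
    filter_upwards [eventually_near ha] with b ⟨_, hb, _⟩
    have hA := condEntropy_update_sub (s := s) (M := M) (hGv hb) hq e (cavity_dens _ _) (hv hb)
      (hv ha)
    have u1 : Function.update (G b) e (Channel.bern P b) = hybrid T P a b (insert e S) := by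
      rw [← hbern b]; exact (e1 b).symm
    have u2 : Function.update (G b) e (Channel.bern P a) = hybrid T P a b S := by
      rw [← hbern a]; exact (e2 b).symm
    rw [u1, u2] at hA
    rw [hA, href b, ← integral_neg, ← integral_div]
    refine integral_congr_ae (ae_of_all _ fun z => ?_)
    simp only [hF]
    ring
  refine Tendsto.congr' hdiff (Tendsto.neg ?_)
  rw [edgeDeriv, if_pos hT, ← hG₀]
  have hprob := isProbabilityMeasure_refLaw (M := M) hG₀v
  have hquot : ∀ {b}, b ≠ a → |b| < 1 / 2 → (a = 0 ∨ |b - a| < |a|) → ∀ z, ∃ ξ,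
      |ξ - a| ≤ |b - a| ∧ |ξ| < 1 / 2 ∧ F b z = (∑ v, weight (G b) s q v z) *
        Channel.infoDeriv P (postMean (G b) s q e z) ξ := by
    intro b hne hb h z
    obtain ⟨ξ, h1, h2, h3⟩ := Channel.exists_info_bern_sub_eq hP ha hb hne h
      (abs_postMean_le (s := s) (hGv hb) hq e z)
    refine ⟨ξ, h1, h2, ?_⟩
    simp only [hF]
    rw [h3, mul_div_cancel_left₀ _ (sq_sub_sq_ne_zero hne h)]
  refine tendsto_integral_filter_of_dominated_convergence
    (fun _ => 2 ^ Fintype.card E * 2) ?_ ?_ (integrable_const _) (ae_of_all _ fun z => ?_)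
  · filter_upwards [eventually_near ha] with b ⟨_, hb, _⟩
    have m1 := fun v => measurable_weight (s := s) (hGv hb) hq v
    have m2 := measurable_postMean (s := s) (hGv hb) hq e
    have m3 := (hv hb).measurable_info
    have m4 := (hv ha).measurable_info
    refine Measurable.aestronglyMeasurable ?_
    simp only [hF]
    fun_prop
  · filter_upwards [eventually_near ha] with b ⟨hne, hb, h⟩
    refine ae_of_all _ fun z => ?_
    obtain ⟨ξ, -, h2, h3⟩ := hquot hne hb h z
    rw [h3, Real.norm_eq_abs, abs_mul, abs_of_pos (sum_weight_pos (hGv hb) hq z)]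
    refine mul_le_mul (sum_weight_le (hGv hb) (fun i ε t => ?_) hq z)
      (Channel.abs_infoDeriv_le hP h2.le (abs_postMean_le (hGv hb) hq e z)) (abs_nonneg _)
      (by positivity)
    exact cavity_hybrid_dens_le hP ha hb S e i ε t
  · have hdens := tendsto_cavity_hybrid_dens (T := T) (P := P) a S e
    have t1 : Tendsto (fun b => ∑ v, weight (G b) s q v z) (𝓝[≠] a)
        (𝓝 (∑ v, weight G₀ s q v z)) :=
      tendsto_finsetSum _ fun v _ => tendsto_weight hdens v z
    have t2 : Tendsto (fun b => postMean (G b) s q e z) (𝓝[≠] a) (𝓝 (postMean G₀ s q e z)) :=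
      tendsto_postMean hdens hG₀v hq e z
    have hex : ∀ b, ∃ ξ, b ≠ a ∧ |b| < 1 / 2 ∧ (a = 0 ∨ |b - a| < |a|) →
        |ξ - a| ≤ |b - a| ∧ F b z = (∑ v, weight (G b) s q v z) *
          Channel.infoDeriv P (postMean (G b) s q e z) ξ := by
      intro b
      by_cases h : b ≠ a ∧ |b| < 1 / 2 ∧ (a = 0 ∨ |b - a| < |a|)
      · obtain ⟨ξ, h1, -, h3⟩ := hquot h.1 h.2.1 h.2.2 z
        exact ⟨ξ, fun _ => ⟨h1, h3⟩⟩
      · exact ⟨0, fun h' => absurd h' h⟩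
    -- No measurability of ξ is needed: it serves only for the pointwise limit at a fixed z.
    choose ξ hξ using hex
    have t3 : Tendsto ξ (𝓝[≠] a) (𝓝 a) := by
      rw [tendsto_iff_norm_sub_tendsto_zero]
      have t0 : Tendsto (fun b => |b - a|) (𝓝[≠] a) (𝓝 0) :=
        ((by fun_prop : Continuous fun b => |b - a|).tendsto' a 0 (by simp)).mono_left
          nhdsWithin_le_nhds
      refine squeeze_zero' (Eventually.of_forall fun _ => norm_nonneg _) ?_ t0
      filter_upwards [eventually_near ha] with b hb
      exact (hξ b hb).1
    have hc := (Channel.continuousAt_infoDeriv hP (ha.trans (by norm_num))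
      (abs_postMean_le (s := s) hG₀v hq e z)).tendsto.comp (t2.prodMk_nhds t3)
    refine Tendsto.congr' ?_ (t1.mul hc)
    filter_upwards [eventually_near ha] with b hb
    exact (hξ b hb).2.symm

/-- Telescoping over the pairs moved from `a` to `b`, with one limit for each step. -/
lemma hasDerivSqAt_condEntropy (hP : (P : ℝ) ≤ 1 / 2) {a : ℝ} (ha : |a| < 1 / 2)
    (hq : IsPrior q) :
    HasDerivSqAt (fun b => condEntropy (bernFamily T P b) s q M)
      (-∑ e, edgeDeriv T P a s q M e) a := by
  have key : ∀ S : Finset E, Tendsto (fun b => (condEntropy (hybrid T P a b S) s q M -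
      condEntropy (bernFamily T P a) s q M) / (b ^ 2 - a ^ 2)) (𝓝[≠] a)
      (𝓝 (-∑ e ∈ S, edgeDeriv T P a s q M e)) := by
    intro S
    induction S using Finset.induction_on with
    | empty =>
      have : ∀ b, hybrid T P a b ∅ = bernFamily T P a := fun b => by ext1; simp [hybrid]
      simp [this]
    | insert e S he ih =>
      rw [Finset.sum_insert he, neg_add]
      refine ((tendsto_hybrid_step hP ha hq S he).add ih).congr fun b => ?_
      rw [← add_div, sub_add_sub_cancel]
  refine (key Finset.univ).congr fun b => ?_
  have : hybrid T P a b Finset.univ = bernFamily T P b := by ext1; simp [hybrid]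
  rw [this]

lemma sum_spin_mul {s : V → ℤˣ} {u : V → ℝ} (hS : 0 < ∑ v, u v) (F : ℤˣ → ℝ) :
    ∑ v, F (s v) * u v = (∑ v, u v) *
      ((1 + (∑ v, sgn (s v) * u v) / ∑ v, u v) / 2 * F 1 +
        (1 - (∑ v, sgn (s v) * u v) / ∑ v, u v) / 2 * F (-1)) := by
  have : ∀ v, F (s v) * u v =
      (F 1 + F (-1)) / 2 * u v + (F 1 - F (-1)) / 2 * (sgn (s v) * u v) := by
    intro v
    rcases Int.units_eq_one_or (s v) with h | h <;> simp only [h, sgn] <;> push_cast <;> ring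
  simp_rw [this, Finset.sum_add_distrib, ← Finset.mul_sum]
  field_simp
  ring

/-- One observation updates m to (m + a)/(1 + am) with probability P(1 + am), and otherwise to (m -
η)/(1 - ηm) with η = aP/(1 - P). The first case is rare, and in the second the shift satisfies |η| ≤
P, so the mean square moves by O(P); the constant 20 is generous. -/
lemma abs_bern_update_sq_sub_le (hP : (P : ℝ) ≤ 1 / 2) {a : ℝ} (ha : |a| < 1 / 2) {m : ℝ}
    (hm : |m| ≤ 1) :
    |(P : ℝ) * ((m + a) ^ 2 / (1 + a * m)) + (1 - P) * ((m - a * (P / (1 - P))) ^ 2 /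
      (1 - a * (P / (1 - P)) * m)) - m ^ 2| ≤ 20 * (P : ℝ) := by
  have hP0 : (0 : ℝ) ≤ P := P.2.1
  obtain ⟨hr0, hr1⟩ := Channel.odds_mem hP
  have hr : (P : ℝ) / (1 - P) ≤ 2 * P := by rw [div_le_iff₀ (by linarith)]; nlinarith
  set η := a * ((P : ℝ) / (1 - P)) with hη
  have hηP : |η| ≤ P := by
    rw [hη, abs_mul, abs_of_nonneg hr0]
    nlinarith [abs_nonneg a]
  have ham := (Channel.abs_mul_le_of_le_one hm a).trans ha.le
  have hηm := Channel.abs_mul_le_of_le_one hm η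
  obtain ⟨a1, a2⟩ := abs_le.1 ham
  obtain ⟨η1, η2⟩ := abs_le.1 (hηm.trans (hηP.trans hP))
  have hm2 : m ^ 2 ≤ 1 := (sq_le_one_iff_abs_le_one m).2 hm
  have hma : |m + a| ≤ 2 := (abs_add_le _ _).trans (by linarith)
  have hma2 : (m + a) ^ 2 ≤ 4 := by rw [← sq_abs]; nlinarith [abs_nonneg (m + a)]
  have k1 : (m + a) ^ 2 / (1 + a * m) ≤ 8 := by
    rw [div_le_iff₀ (by linarith)]; linarith
  have k1' : 0 ≤ (m + a) ^ 2 / (1 + a * m) := div_nonneg (sq_nonneg _) (by linarith)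
  have hden : 1 - η * m ≠ 0 := by linarith
  have e : (m - η) ^ 2 / (1 - η * m) - m ^ 2 = η * (-2 * m + η + m ^ 3) / (1 - η * m) := by
    rw [eq_div_iff hden, sub_mul, div_mul_cancel₀ _ hden]; ring
  have k2 : |(m - η) ^ 2 / (1 - η * m) - m ^ 2| ≤ 8 * (P : ℝ) := by
    rw [e, abs_div, div_le_iff₀ (abs_pos.2 hden), abs_of_pos (by linarith : 0 < 1 - η * m), abs_mul]
    have : |-2 * m + η + m ^ 3| ≤ 4 := by
      have h3 : |m ^ 3| ≤ 1 := by rw [abs_pow]; exact pow_le_one₀ (abs_nonneg m) hm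
      have h4 : |-2 * m| ≤ 2 := by rw [abs_mul]; norm_num; linarith
      have := abs_add_three (-2 * m) η (m ^ 3)
      linarith
    calc |η| * |-2 * m + η + m ^ 3| ≤ P * 4 := by gcongr
      _ ≤ 8 * P * (1 - η * m) := by nlinarith
  obtain ⟨k3, k4⟩ := abs_le.1 k2
  set X := (m + a) ^ 2 / (1 + a * m)
  set Y := (m - η) ^ 2 / (1 - η * m)
  have : P * X + (1 - P) * Y - m ^ 2 = P * X - P * m ^ 2 + (1 - P) * (Y - m ^ 2) := by ring
  have h5 : P * X ≤ P * 8 := mul_le_mul_of_nonneg_left k1 hP0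
  have h6 : 0 ≤ P * X := mul_nonneg hP0 k1'
  have h7 : P * m ^ 2 ≤ P := mul_le_of_le_one_right hP0 hm2
  have h8 : 0 ≤ P * m ^ 2 := by positivity
  have h9 : |(1 - (P : ℝ)) * (Y - m ^ 2)| ≤ 8 * (P : ℝ) := by
    rw [abs_mul, abs_of_nonneg (by linarith : 0 ≤ 1 - (P : ℝ))]
    exact (mul_le_of_le_one_left (abs_nonneg _) (by linarith)).trans k2
  obtain ⟨h10, h11⟩ := abs_le.1 h9
  rw [this, abs_le]
  constructor <;> linarith

/-- Removing one channel changes the mean square of the posterior mean of its input by `O(P)`. -/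
lemma abs_integral_postMean_sq_sub_le (hP : (P : ℝ) ≤ 1 / 2) {a : ℝ} (ha : |a| < 1 / 2)
    (hq : IsPrior q) {C : E → Channel} (hC : ∀ e, (C e).Valid) {e : E}
    (he : C e = Channel.bern P a) :
    |∫ z, (∑ v, weight C s q v z) * postMean C s q e z ^ 2 ∂(refLaw C M) -
      ∫ z, (∑ v, weight (cavity C e) s q v z) * postMean (cavity C e) s q e z ^ 2
        ∂(refLaw (cavity C e) M)| ≤ 20 * (P : ℝ) := by
  set G := cavity C e with hG
  have hGv : ∀ i, (G i).Valid := cavity_valid hC e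
  have hb := Channel.bern_valid hP (ha.trans (by norm_num))
  have eC : C = Function.update G e (Channel.bern P a) := by
    rw [hG, update_cavity, ← he, Function.update_eq_self]
  have hi : Integrable (fun z => (∑ v, weight C s q v z) * postMean C s q e z ^ 2)
      (refLaw C M) :=
    integrable_sum_weight_mul hC hq ((measurable_postMean hC hq e).pow_const 2) (c := 1) fun z => by
      rw [abs_pow]; exact pow_le_one₀ (abs_nonneg _) (abs_postMean_le hC hq e z)
  have hi' : Integrable (fun z => (∑ v, weight G s q v z) * postMean G s q e z ^ 2)
      (refLaw G M) :=
    integrable_sum_weight_mul hGv hq ((measurable_postMean hGv hq e).pow_const 2) (c := 1)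
      fun z => by
        rw [abs_pow]; exact pow_le_one₀ (abs_nonneg _) (abs_postMean_le hGv hq e z)
  rw [eC] at hi ⊢
  obtain ⟨h1, h2⟩ := integral_refLaw_update hGv e hb hi
  rw [h2, ← integral_sub h1 hi']
  have hdens : (G e).dens = fun _ _ => 1 := cavity_dens C e
  have hpt : ∀ z, (∫ t, (∑ v, weight (Function.update G e (Channel.bern P a)) s q v
        (Function.update z.1 e t, z.2)) *
        postMean (Function.update G e (Channel.bern P a)) s q e (Function.update z.1 e t, z.2) ^ 2
          ∂(Channel.bern P a).ref) - (∑ v, weight G s q v z) * postMean G s q e z ^ 2 =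
      (∑ v, weight G s q v z) * (P * ((postMean G s q e z + a) ^ 2 / (1 + a * postMean G s q e z)) +
        (1 - P) * ((postMean G s q e z - a * (P / (1 - P))) ^ 2 /
          (1 - a * (P / (1 - P)) * postMean G s q e z)) - postMean G s q e z ^ 2) := by
    intro z
    have hS := sum_weight_pos (s := s) hGv hq z
    have hm := abs_postMean_le (s := s) hGv hq e z
    have ham := abs_le.1 ((Channel.abs_mul_le_of_le_one hm a).trans ha.le)
    have hηm := abs_le.1 ((Channel.abs_mul_le_of_le_one hm (a * (P / (1 - P)))).trans
      ((Channel.abs_mul_odds_le hP).trans ha.le))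
    rw [Channel.integral_bern]
    simp only [postMean, weight_update e hdens] at *
    -- Masses and signed masses after each of the two outputs are expressed through the cavity mean,
    -- which yields Bayes' update formulas.
    have k := sum_spin_mul (s := fun v => s v e) hS
    have k1 := k fun ε => (Channel.bern P a).dens ε 1
    have k0 := k fun ε => (Channel.bern P a).dens ε 0
    have j1 := k fun ε => sgn ε * (Channel.bern P a).dens ε 1
    have j0 := k fun ε => sgn ε * (Channel.bern P a).dens ε 0
    simp only [mul_assoc] at j1 j0
    rw [k1, k0, j1, j0]
    simp only [Channel.bern, if_true, zero_ne_one, if_false, Channel.sgn_one, Channel.sgn_neg_one]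
    set m := (∑ v, sgn (s v e) * weight G s q v z) / ∑ v, weight G s q v z
    set S := ∑ v, weight G s q v z
    set η := a * ((P : ℝ) / (1 - P))
    have n1 : 1 + a * m ≠ 0 := by linarith
    have n0 : 1 - η * m ≠ 0 := by linarith
    have r1 : (1 + m) / 2 * (1 + a * 1) + (1 - m) / 2 * (1 + a * -1) = 1 + a * m := by ring
    have r0 : (1 + m) / 2 * (1 - η * 1) + (1 - m) / 2 * (1 - η * -1) = 1 - η * m := by ring
    have s1 : (1 + m) / 2 * (1 * (1 + a * 1)) + (1 - m) / 2 * (-1 * (1 + a * -1)) = m + a := by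
      ring
    have s0 : (1 + m) / 2 * (1 * (1 - η * 1)) + (1 - m) / 2 * (-1 * (1 - η * -1)) = m - η := by
      ring
    rw [r1, r0, s1, s0]
    have hS' := hS.ne'
    field_simp
  simp_rw [hpt]
  exact abs_integral_sum_weight_mul_le hGv hq fun z =>
    abs_bern_update_sq_sub_le hP ha (abs_postMean_le hGv hq e z)

/-- Expanding `infoDeriv` at the cavity mean costs P|a| + 2P². Passing to the full posterior mean
costs P/2 · 20P = 10P². -/
lemma abs_edgeDeriv_sub_le (hP : (P : ℝ) ≤ 1 / 2) {a : ℝ} (ha : |a| < 1 / 2) (hq : IsPrior q)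
    {e : E} (he : T e) :
    |edgeDeriv T P a s q M e - P / 2 * (1 - ∫ z, (∑ v, weight (bernFamily T P a) s q v z) *
      postMean (bernFamily T P a) s q e z ^ 2 ∂(refLaw (bernFamily T P a) M))| ≤
      P * |a| + 12 * P ^ 2 := by
  have hP0 : (0 : ℝ) ≤ P := P.2.1
  have hC := bernFamily_valid (T := T) hP ha
  have h1 := abs_integral_postMean_sq_sub_le (s := s) (M := M) hP ha hq hC (e := e)
    (by simp [bernFamily, he])
  set G := cavity (bernFamily T P a) e with hG
  have hGv : ∀ i, (G i).Valid := cavity_valid hC e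
  have hm := fun z => abs_postMean_le (s := s) hGv hq e z
  have hm2 : ∀ z, |postMean G s q e z ^ 2| ≤ 1 := fun z => by
    rw [abs_pow]; exact pow_le_one₀ (abs_nonneg _) (hm z)
  have i1 := integrable_sum_weight_mul (s := s) (M := M) hGv hq
    ((measurable_postMean (s := s) hGv hq e).pow_const 2) hm2
  have i0 : Integrable (fun z => ∑ v, weight G s q v z) (refLaw G M) :=
    integrable_finsetSum _ fun v _ => integrable_weight_refLaw hGv hq v
  have h2 : |edgeDeriv T P a s q M e - P / 2 * (1 - ∫ z, (∑ v, weight G s q v z) *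
      postMean G s q e z ^ 2 ∂(refLaw G M))| ≤ P * |a| + 2 * P ^ 2 := by
    have hmeas : Measurable fun z => Channel.infoDeriv P (postMean G s q e z) a := by
      have := measurable_postMean (s := s) hGv hq e
      have := measurable_logRatio
      unfold Channel.infoDeriv Channel.gapDeriv
      fun_prop
    have i2 := integrable_sum_weight_mul (s := s) (M := M) hGv hq hmeas
      fun z => Channel.abs_infoDeriv_le hP ha.le (hm z)
    rw [edgeDeriv, if_pos he, ← hG, ← integral_sum_weight_refLaw (s := s) (M := M) hGv hq,
      ← integral_sub i0 i1, ← integral_const_mul, ← integral_sub i2 ((i0.sub' i1).const_mul _)]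
    have : ∀ z, (∑ v, weight G s q v z) * Channel.infoDeriv P (postMean G s q e z) a -
        P / 2 * (∑ v, weight G s q v z - (∑ v, weight G s q v z) * postMean G s q e z ^ 2) =
        (∑ v, weight G s q v z) * (Channel.infoDeriv P (postMean G s q e z) a -
          (1 - postMean G s q e z ^ 2) / 2 * P) := fun z => by ring
    simp_rw [this]
    exact abs_integral_sum_weight_mul_le hGv hq fun z =>
      Channel.abs_infoDeriv_sub_le hP ha.le (hm z)
  obtain ⟨h3, h4⟩ := abs_le.1 h1
  obtain ⟨h5, h6⟩ := abs_le.1 h2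
  rw [abs_le]
  constructor <;> nlinarith
end Family

/-! ### Quantitative bounds and the double limit -/

/-- The order of limits matters: for fixed `d` the second term vanishes as n grows, however large
`c' d` is, and the first then vanishes with d. -/
lemma tendsto_limsup_ofReal {X : ℝ → ℕ → ℝ} {c : ℝ} {c' : ℝ → ℝ}
    (h : ∀ᶠ d : ℝ in atTop, ∀ᶠ n : ℕ in atTop, X d n ≤ c / Real.sqrt d + c' d / Real.sqrt n) :
    Tendsto (fun d : ℝ => limsup (fun n : ℕ => ENNReal.ofReal (X d n)) atTop) atTop (𝓝 0) := by
  have h1 : Tendsto (fun d : ℝ => ENNReal.ofReal (c / Real.sqrt d)) atTop (𝓝 0) := by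
    rw [← ENNReal.ofReal_zero]
    exact ENNReal.tendsto_ofReal (tendsto_const_nhds.div_atTop Real.tendsto_sqrt_atTop)
  refine tendsto_of_tendsto_of_tendsto_of_le_of_le' tendsto_const_nhds h1
    (Eventually.of_forall fun _ => zero_le) ?_
  filter_upwards [h] with d hd
  have h2 : Tendsto (fun n : ℕ => ENNReal.ofReal (c / Real.sqrt d + c' d / Real.sqrt n)) atTop
      (𝓝 (ENNReal.ofReal (c / Real.sqrt d))) := by
    refine ENNReal.tendsto_ofReal ?_
    have : Tendsto (fun n : ℕ => c' d / Real.sqrt n) atTop (𝓝 0) :=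
      tendsto_const_nhds.div_atTop (Real.tendsto_sqrt_atTop.comp tendsto_natCast_atTop_atTop)
    simpa using tendsto_const_nhds.add this
  rw [← h2.limsup_eq]
  exact limsup_le_limsup (hd.mono fun n hn => ENNReal.ofReal_le_ofReal hn)

lemma card_sym2_le (n : ℕ) : (Fintype.card (Sym2 (Fin n)) : ℝ) ≤ (n : ℝ) ^ 2 := by
  have := Fintype.card_le_of_surjective (fun z : Fin n × Fin n => s(z.1, z.2)) fun e => by
    induction e with
    | _ i j => exact ⟨(i, j), rfl⟩
  rw [Fintype.card_prod, Fintype.card_fin, ← sq] at this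
  exact_mod_cast this

/-- The mean square error runs over ordered pairs, the channels over unordered ones; this supplies
the factor 2. -/
lemma sum_sum_sym2 {n : ℕ} {φ : Sym2 (Fin n) → ℝ} (hφ : ∀ i, φ s(i, i) = 0) :
    ∑ i, ∑ j, φ s(i, j) = 2 * ∑ e, if ¬ e.IsDiag then φ e else 0 := by
  have h1 : ∑ e, (if ¬ e.IsDiag then φ e else 0) = ∑ i, ∑ j, if i < j then φ s(i, j) else 0 := by
    rw [← Finset.sum_filter, ← Finset.sym2_univ, Finset.sum_sym2_filter_not_isDiag,
      ← Finset.sum_product' (f := fun i j => if i < j then φ s(i, j) else 0), ← Finset.sum_filter]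
    refine Finset.sum_congr ?_ fun _ _ => rfl
    ext ⟨i, j⟩
    simp only [Finset.mem_filter, Finset.mem_offDiag, Finset.mem_univ, true_and,
      Finset.mem_product]
    exact ⟨fun h => h.2, fun h => ⟨h.ne, h⟩⟩
  have h2 : ∀ i j, φ s(i, j) = (if i < j then φ s(i, j) else 0) + if j < i then φ s(j, i) else 0 := by
    intro i j
    rcases lt_trichotomy i j with h | h | h
    · simp [h, h.not_gt]
    · subst h; simp [hφ]
    · rw [if_neg h.not_gt, if_pos h, zero_add, Sym2.eq_swap]
  rw [h1]
  rw [Finset.sum_congr rfl fun i _ => Finset.sum_congr rfl fun j _ => h2 i j]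
  simp_rw [Finset.sum_add_distrib]
  rw [Finset.sum_comm (f := fun i j => if j < i then φ s(j, i) else 0), two_mul]

/-- The sparsity regime in which the estimates hold. -/
structure Regime (lam d : ℝ) (n : ℕ) : Prop where
  one_le : 1 ≤ d
  two_mul_le : 2 * d ≤ n
  abs_lt : |lam / Real.sqrt d| < 1 / 2
  sq_le : lam ^ 2 ≤ n / 6

lemma eventually_regime (lam : ℝ) : ∀ᶠ d : ℝ in atTop, ∀ᶠ n : ℕ in atTop, Regime lam d n := by
  have h : Tendsto (fun d : ℝ => |lam / Real.sqrt d|) atTop (𝓝 0) := by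
    simpa using (tendsto_const_nhds.div_atTop Real.tendsto_sqrt_atTop :
      Tendsto (fun d : ℝ => lam / Real.sqrt d) atTop (𝓝 0)).abs
  filter_upwards [h.eventually_lt_const (by norm_num : (0 : ℝ) < 1 / 2), eventually_ge_atTop 1]
    with d h1 h2
  filter_upwards [tendsto_natCast_atTop_atTop.eventually_ge_atTop (2 * d),
    tendsto_natCast_atTop_atTop.eventually_ge_atTop (6 * lam ^ 2)] with n h3 h4
  exact ⟨h2, h3, h1, by linarith⟩

lemma Regime.natCast_pos {lam d : ℝ} {n : ℕ} (h : Regime lam d n) : (0 : ℝ) < n := by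
  linarith [h.one_le, h.two_mul_le]

/-- The Bernoulli strength a²P = (λ²/d)(d/n) and the Gaussian strength τ = λ²/n coincide, so the
leading terms cancel. The Bernoulli third moment gives the 1/√d term; all other errors are
O_d(n^(-3/2)). -/
lemma Regime.abs_info_sub_le {lam d : ℝ} {n : ℕ} (h : Regime lam d n) (e : Sym2 (Fin n)) {m : ℝ}
    (hm : |m| ≤ 1) :
    |(graphChannel n d lam e).info m - (gaussChannel n lam e).info m| ≤
      (8 * |lam| ^ 3 / Real.sqrt d + (lam ^ 2 * d + lam ^ 4 / 2 + 4 * lam ^ 2 + 156 * lam ^ 4) /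
        Real.sqrt n) / n := by
  have hd : 0 < d := by linarith [h.one_le]
  have hn := h.natCast_pos
  have hn1 : (1 : ℝ) ≤ n := by linarith [h.one_le, h.two_mul_le]
  have hsd : 0 < Real.sqrt d := Real.sqrt_pos.2 hd
  have hsn : 0 < Real.sqrt n := Real.sqrt_pos.2 hn
  have hsn1 : 1 ≤ Real.sqrt n := Real.one_le_sqrt.2 hn1
  unfold graphChannel gaussChannel
  split_ifs with he
  · rw [Channel.blank_info, Channel.blank_info, sub_self, abs_zero]
    positivity
  have hP := edgeProb_le hd.le h.two_mul_le
  have hPe := edgeProb_coe hd.le h.two_mul_le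
  have hdd : Real.sqrt d ^ 2 = d := Real.sq_sqrt hd.le
  have hnn : Real.sqrt n ^ 2 = n := Real.sq_sqrt hn.le
  have hτ : lam ^ 2 * ((1 / n : ℝ≥0) : ℝ) = lam ^ 2 / n := by simp [div_eq_mul_inv]
  have ha : (lam / Real.sqrt d) ^ 2 * (d / n) = lam ^ 2 / n := by
    rw [div_pow, hdd]; field_simp
  have h1 := Channel.abs_info_bern_sub_le hP (h.abs_lt.trans (by norm_num)) hm
  -- The choice c = 1/√n makes cτ and τ²/c both of order n^(-3/2). The condition τ ≤ 1/6 is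
  -- `Regime.sq_le`.
  have h2 := Channel.abs_info_gauss_sub_le (v := 1 / n) (x := lam)
    (by rw [hτ, div_le_iff₀ hn]; linarith [h.sq_le]) hm (c := 1 / Real.sqrt n) (by positivity)
  rw [hτ] at h2
  rw [hPe, ha] at h1
  refine (abs_sub_le _ ((1 - m ^ 2) / 2 * (lam ^ 2 / n)) _).trans ?_
  rw [abs_sub_comm ((1 - m ^ 2) / 2 * (lam ^ 2 / n))]
  refine (add_le_add h1 h2).trans ?_
  have t1 : 8 * (d / n * |lam / Real.sqrt d| ^ 3) = 8 * |lam| ^ 3 / Real.sqrt d / n := by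
    rw [abs_div, abs_of_pos hsd]
    nth_rewrite 1 [← hdd]
    field_simp
  have t2 : (lam / Real.sqrt d) ^ 2 * (d / n) ^ 2 = lam ^ 2 * d / n / n := by
    rw [div_pow, hdd]; field_simp
  have t3 : 2 * (2 * (1 / Real.sqrt n) * (lam ^ 2 / n) + 78 * (lam ^ 2 / n) ^ 2 / (1 / Real.sqrt n)) =
      (4 * lam ^ 2 + 156 * lam ^ 4) / Real.sqrt n / n := by
    have : 78 * (lam ^ 2 / n) ^ 2 / (1 / Real.sqrt n) = 78 * lam ^ 4 / Real.sqrt n / n := by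
      rw [div_pow]
      nth_rewrite 1 [← hnn]
      field_simp
      rw [hnn]
    rw [this]; field_simp; ring
  have hle : ∀ x : ℝ, 0 ≤ x → x / n ≤ x / Real.sqrt n := fun x hx =>
    div_le_div_of_nonneg_left hx hsn (by nlinarith)
  have t4 : lam ^ 2 * d / n / n ≤ lam ^ 2 * d / Real.sqrt n / n := by
    gcongr
    nlinarith
  have t5 : (lam ^ 2 / n) ^ 2 / 2 ≤ lam ^ 4 / 2 / Real.sqrt n / n := by
    have : (lam ^ 2 / n) ^ 2 / 2 = lam ^ 4 / 2 / n / n := by field_simp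
    rw [this]
    gcongr
    nlinarith
  rw [t1, t2, t3]
  calc _ ≤ 8 * |lam| ^ 3 / Real.sqrt d / n + lam ^ 2 * d / Real.sqrt n / n +
        (lam ^ 4 / 2 / Real.sqrt n / n + (4 * lam ^ 2 + 156 * lam ^ 4) / Real.sqrt n / n) := by
        gcongr
    _ = _ := by ring

lemma Regime.abs_graphInfo_sub_gaussInfo_le {lam d : ℝ} {n : ℕ} (h : Regime lam d n) (p : ℕ)
    (mu : ℝ) :
    1 / n * |graphInfo n p d lam mu - gaussInfo n p lam mu| ≤ 8 * |lam| ^ 3 / Real.sqrt d +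
      (lam ^ 2 * d + lam ^ 4 / 2 + 4 * lam ^ 2 + 156 * lam ^ 4) / Real.sqrt n := by
  have hd : 0 < d := by linarith [h.one_le]
  have hn := h.natCast_pos
  have hl := h.abs_lt.trans (by norm_num : (1 / 2 : ℝ) < 1)
  obtain ⟨M, q, hM, hq, hgauss, hgraph⟩ := exists_model n p mu
  rw [hgauss lam (by rintro rfl; simp at hn), (hgraph d lam hd h.two_mul_le hl).1,
    sub_sub_sub_cancel_left]
  have hb := abs_condEntropy_sub_le (s := edgeSpin) (M := M) hq (gaussChannel_valid (lam := lam))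
    (graphChannel_valid hd.le h.two_mul_le hl) fun e m hm => h.abs_info_sub_le e hm
  rw [Finset.sum_const, Finset.card_univ, nsmul_eq_mul] at hb
  have hc := card_sym2_le n
  set K := 8 * |lam| ^ 3 / Real.sqrt d +
      (lam ^ 2 * d + lam ^ 4 / 2 + 4 * lam ^ 2 + 156 * lam ^ 4) / Real.sqrt n
  have hK : 0 ≤ K := by positivity
  calc 1 / n * _ ≤ 1 / n * ((n : ℝ) ^ 2 * (K / n)) := by
        refine mul_le_mul_of_nonneg_left (hb.trans ?_) (by positivity)
        exact mul_le_mul_of_nonneg_right hc (by positivity)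
    _ = K := by field_simp

lemma graphChannel_eq_bernFamily (n : ℕ) (d lam : ℝ) : graphChannel n d lam =
    bernFamily (fun e : Sym2 (Fin n) => ¬ e.IsDiag) (edgeProb n d) (lam / Real.sqrt d) := by
  ext1 e
  by_cases h : e.IsDiag <;> simp [graphChannel, bernFamily, h]

lemma integral_postMean_sq_diag {n : ℕ} {β : Type} [MeasurableSpace β] {M : Measure β}
    [IsProbabilityMeasure M] {q : Label n → β → ℝ} (hq : IsPrior q)
    {C : Sym2 (Fin n) → Channel} (hC : ∀ e, (C e).Valid) (i : Fin n) :
    ∫ z, (∑ v, weight C edgeSpin q v z) * postMean C edgeSpin q s(i, i) z ^ 2 ∂(refLaw C M) = 1 := by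
  have h1 : ∀ z, postMean C edgeSpin q s(i, i) z = 1 := by
    intro z
    have : ∀ v : Label n, sgn (edgeSpin v s(i, i)) = 1 := by intro v; simp [edgeSpin, sgn]
    simp only [postMean, this, one_mul]
    exact div_self (sum_weight_pos hC hq z).ne'
  simp_rw [h1, one_pow, mul_one]
  exact integral_sum_weight_refLaw hC hq

lemma Regime.exists_hasDerivSqAt {lam d : ℝ} {n : ℕ} (h : Regime lam d n) (p : ℕ) (mu : ℝ) :
    ∃ D : ℝ, HasDerivSqAt (fun θ => graphInfo n p d θ mu) D lam ∧
      |1 / n * D - 1 / 4 * mmse (graphModel n p d lam mu)| ≤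
        |lam| / Real.sqrt d + 12 * d / Real.sqrt n := by
  have hd : 0 < d := by linarith [h.one_le]
  have hn := h.natCast_pos
  have hn1 : (1 : ℝ) ≤ n := by linarith [h.one_le, h.two_mul_le]
  have hsd : 0 < Real.sqrt d := Real.sqrt_pos.2 hd
  have hsn1 : 1 ≤ Real.sqrt n := Real.one_le_sqrt.2 hn1
  have hnn : Real.sqrt n ^ 2 = n := Real.sq_sqrt hn.le
  have hl := h.abs_lt.trans (by norm_num : (1 / 2 : ℝ) < 1)
  have hP := edgeProb_le hd.le h.two_mul_le
  have hPe := edgeProb_coe hd.le h.two_mul_le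
  have hdd : Real.sqrt d ^ 2 = d := Real.sq_sqrt hd.le
  obtain ⟨M, q, hM, hq, -, hgraph⟩ := exists_model n p mu
  set a := lam / Real.sqrt d with ha
  set P := edgeProb n d with hPd
  set δ := fun e => edgeDeriv (fun e : Sym2 (Fin n) => ¬ e.IsDiag) P a edgeSpin q M e with hδ
  -- The differentiation was in a² = λ²/d, so passing to λ² divides by d.
  refine ⟨(∑ e, δ e) / Real.sqrt d ^ 2, ?_, ?_⟩
  · have h1 : HasDerivSqAt (fun b => n * Real.log 2 -
        condEntropy (bernFamily (fun e : Sym2 (Fin n) => ¬ e.IsDiag) P b) edgeSpin q M)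
        (∑ e, δ e) a := by
      have := (hasDerivSqAt_condEntropy (T := fun e : Sym2 (Fin n) => ¬ e.IsDiag)
        (s := edgeSpin) (M := M) hP h.abs_lt hq)
      rw [HasDerivSqAt] at this ⊢
      convert this.neg using 2
      · rw [← neg_div]; ring
      · rw [neg_neg]
    refine (h1.comp_div hsd.ne').congr_of_eventuallyEq ?_
    have hc : ContinuousAt (fun θ : ℝ => |θ / Real.sqrt d|) lam := by fun_prop
    -- The entropy formula needs |θ/√d| < 1, an open condition, hence holds for all θ near λ.
    filter_upwards [hc.eventually_lt_const hl] with θ hθ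
    rw [(hgraph d θ hd h.two_mul_le hθ).1, graphChannel_eq_bernFamily]
  · rw [(hgraph d lam hd h.two_mul_le hl).2]
    set φ : Sym2 (Fin n) → ℝ := fun e =>
      1 - ∫ z, (∑ v, weight (graphChannel n d lam) edgeSpin q v z) *
          postMean (graphChannel n d lam) edgeSpin q e z ^ 2
            ∂(refLaw (graphChannel n d lam) M) with hφ
    have hdiag : ∀ i, φ s(i, i) = 0 := fun i => by
      rw [hφ]
      simp only
      rw [integral_postMean_sq_diag hq (graphChannel_valid hd.le h.two_mul_le hl), sub_self]
    have hsum := sum_sum_sym2 hdiag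
    rw [hsum, hdd]
    have he : ∀ e, |δ e - P / 2 * (if ¬ e.IsDiag then φ e else 0)| ≤ P * |a| + 12 * P ^ 2 := by
      intro e
      by_cases hed : e.IsDiag
      · simp only [hδ, edgeDeriv, hed, not_true_eq_false, if_false, mul_zero, sub_zero, abs_zero]
        have : (0 : ℝ) ≤ P := P.2.1
        positivity
      · rw [if_pos hed]
        simp only [hδ, hφ, graphChannel_eq_bernFamily]
        exact abs_edgeDeriv_sub_le (T := fun e : Sym2 (Fin n) => ¬ e.IsDiag) hP h.abs_lt hq hed
    -- With P = d/n both main terms have coefficient 1/(2n²): (1/(nd)) · P/2 on the left and (1/4) ·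
    -- 2/n² from the mean square error.
    have e1 : 1 / n * ((∑ e, δ e) / d) - 1 / 4 * (((n : ℝ) ^ 2)⁻¹ *
        (2 * ∑ e, if ¬ e.IsDiag then φ e else 0)) =
        1 / (n * d) * ∑ e, (δ e - P / 2 * (if ¬ e.IsDiag then φ e else 0)) := by
      rw [Finset.sum_sub_distrib, ← Finset.mul_sum, hPe]
      field_simp
      ring
    rw [e1, abs_mul, abs_of_pos (by positivity)]
    have h3 : |∑ e, (δ e - P / 2 * (if ¬ e.IsDiag then φ e else 0))| ≤
        (n : ℝ) ^ 2 * (P * |a| + 12 * P ^ 2) := by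
      refine (Finset.abs_sum_le_sum_abs _ _).trans ((Finset.sum_le_sum fun e _ => he e).trans ?_)
      rw [Finset.sum_const, Finset.card_univ, nsmul_eq_mul]
      have : (0 : ℝ) ≤ P := P.2.1
      exact mul_le_mul_of_nonneg_right (card_sym2_le n) (by positivity)
    calc 1 / (n * d) * _ ≤ 1 / (n * d) * ((n : ℝ) ^ 2 * (P * |a| + 12 * P ^ 2)) :=
          mul_le_mul_of_nonneg_left h3 (by positivity)
      _ = |lam| / Real.sqrt d + 12 * d / n := by
          rw [hPe, ha, abs_div, abs_of_pos hsd]; field_simp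
      _ ≤ |lam| / Real.sqrt d + 12 * d / Real.sqrt n := by
          gcongr
          nlinarith

end CSBM

end

theorem theorem4 (lam mu : ℝ) (hm : 0 ≤ mu) (p : ℕ → ℕ) :
    Tendsto
      (fun d : ℝ => limsup
        (fun n : ℕ => ENNReal.ofReal
          (1 / n * |CSBM.graphInfo n (p n) d lam mu - CSBM.gaussInfo n (p n) lam mu|)) atTop)
      atTop (𝓝 0) ∧
    ∃ D : ℝ → ℕ → ℝ,
      (∀ᶠ d : ℝ in atTop, ∀ᶠ n : ℕ in atTop,
        CSBM.HasDerivSqAt (fun θ => CSBM.graphInfo n (p n) d θ mu) (D d n) lam) ∧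
      Tendsto
        (fun d : ℝ => limsup
          (fun n : ℕ => ENNReal.ofReal
            |1 / n * D d n - 1 / 4 * CSBM.mmse (CSBM.graphModel n (p n) d lam mu)|) atTop)
        atTop (𝓝 0) := by
  constructor
  · refine CSBM.tendsto_limsup_ofReal (c := 8 * |lam| ^ 3)
      (c' := fun d => lam ^ 2 * d + lam ^ 4 / 2 + 4 * lam ^ 2 + 156 * lam ^ 4) ?_
    filter_upwards [CSBM.eventually_regime lam] with d hd
    filter_upwards [hd] with n hn
    exact hn.abs_graphInfo_sub_gaussInfo_le (p n) mu
  -- The derivative must be a function of all d and n; outside the regime its value is the arbitrary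
  -- 0.
  · have hD : ∀ d n, ∃ D : ℝ, CSBM.Regime lam d n →
        CSBM.HasDerivSqAt (fun θ => CSBM.graphInfo n (p n) d θ mu) D lam ∧
        |1 / n * D - 1 / 4 * CSBM.mmse (CSBM.graphModel n (p n) d lam mu)| ≤
          |lam| / Real.sqrt d + 12 * d / Real.sqrt n := by
      intro d n
      by_cases h : CSBM.Regime lam d n
      · obtain ⟨D, hD⟩ := h.exists_hasDerivSqAt (p n) mu
        exact ⟨D, fun _ => hD⟩
      · exact ⟨0, fun h' => absurd h' h⟩
    choose D hD using hD
    refine ⟨D, (CSBM.eventually_regime lam).mono fun d hd => hd.mono fun n hn => (hD d n hn).1,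
      CSBM.tendsto_limsup_ofReal (c := |lam|) (c' := fun d => 12 * d) ?_⟩
    exact (CSBM.eventually_regime lam).mono fun d hd => hd.mono fun n hn => (hD d n hn).2
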